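/- Let $\mathbb T^2=\mathbb R^2/\mathbb Z^2$ and, for $(\alpha,\alpha')\in\mathbb R^2$, let $R_{\alpha,\alpha'}(x,y)=(x+\alpha,y+\alpha')$ on $\mathbb T^2$. For a $C^\infty$ function $\varphi:\mathbb T^2\to(0,\infty)$ let $M_\varphi=(\mathbb T^2\times\mathbb R)/\sim$, where $\sim$ is the equivalence relation generated by $(z,s+\varphi(z))\sim(R_{\alpha,\alpha'}(z),s)$; it has $\{(z,s):z\in\mathbb T^2,\ 0\le s<\varphi(z)\}$ as a fundamental domain. The special flow $T^t=T^t_{\alpha,\alpha',\varphi}$, $t\in\mathbb R$, over $R_{\alpha,\alpha'}$ under the ceiling function $\varphi$ is the flow on $M_\varphi$ induced by $(z,s)\mapsto(z,s+t)$. Let $\mu$ be the probability measure on $M_\varphi$ obtained by normalizing the product of the Haar measure of $\mathbb T^2$ and the Lebesgue measure on the fibres $[0,\varphi(z))$, and let $d$ be the quotient metric on $M_\varphi$, seen as the set $\{(z,s):0\le s\le\varphi(z)\}$ with its Euclidean metric and with $(z,\varphi(z))$ glued to $(R_{\alpha,\alpha'}(z),0)$. **Theorem.** There exist $(\alpha,\alpha')\in\mathbb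 R^2$ and a strictly positive function $\varphi\in C^\infty(\mathbb T^2)$ such that: 1. the special flow $T^t_{\alpha,\alpha',\varphi}$ preserves $\mu$ and is mixing, that is, $\lim_{t\to\infty}\mu(T^tA\cap B)=\mu(A)\,\mu(B)$ for all measurable $A,B\subset M_\varphi$; 2. $\mu$-almost every $\xi\in M_\varphi$ is super-recurrent for the time-one map $T^1=T^1_{\alpha,\alpha',\varphi}$, that is, there are a real number $a>1$ and integers $0\le k_0<k_1<k_2<\cdots$ (both depending on $\xi$) with $d\big((T^1)^{k_n}\xi,\xi\big)\le\exp(-k_n^{a})$ for all $n$. -/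

import Mathlib

open MeasureTheory Filter Topology
open scoped ContDiff

noncomputable section

namespace SpecialFlow

/-! ### Super-recurrence and mixing -/

/-- `x` is super-recurrent for `T`: for some exponent `a > 1` there are integers `k₀ < k₁ < …` with
`d (T^{k_n} x, x) ≤ exp (-k_n ^ a)` for all `n`. -/
def SuperRecurrent {X : Type*} [MetricSpace X] (T : X → X) (x : X) : Prop :=
  ∃ a : ℝ, 1 < a ∧ ∃ k : ℕ → ℕ, StrictMono k ∧
    ∀ n, dist (T^[k n] x) x ≤ Real.exp (-((k n : ℝ) ^ a))

/-- The flow `T` preserves `ν` and is mixing: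
`ν (T^t A ∩ B) → ν A * ν B` as `t → ∞`, for all measurable `A`, `B`. -/
structure IsMixing {X : Type*} [MeasurableSpace X] (T : ℝ → X → X) (ν : Measure X) : Prop where
  measurePreserving : ∀ t, MeasurePreserving (T t) ν ν
  tendsto : ∀ A B : Set X, MeasurableSet A → MeasurableSet B →
    Tendsto (fun t : ℝ => ν (T t '' A ∩ B)) atTop (𝓝 (ν A * ν B))

/-! ### The two-torus, its rotations and smooth ceiling functions -/

/-- The two-torus `ℝ² / ℤ²`; `volume` on it is the normalized Haar measure. -/
abbrev Torus2 : Type := UnitAddCircle × UnitAddCircle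

/-- The rotation `(x, y) ↦ (x + α, y + α')` of the two-torus. -/
def rotation (α α' : ℝ) : Torus2 ≃ Torus2 :=
  Equiv.addRight ((α : UnitAddCircle), (α' : UnitAddCircle))

/-- A smooth strictly positive function on the two-torus
(smooth means that its lift to `ℝ²` is `C^∞`). -/
structure Ceiling where
  toFun : Torus2 → ℝ
  smooth' : ContDiff ℝ ∞ (fun v : ℝ × ℝ => toFun ((v.1 : UnitAddCircle), (v.2 : UnitAddCircle)))
  pos' : ∀ z, 0 < toFun z

instance : CoeFun Ceiling (fun _ => Torus2 → ℝ) := ⟨Ceiling.toFun⟩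

/-! ### The special flow -/

/-- The map `(z, s) ↦ (T z, s - φ z)`, whose orbits are the classes of the equivalence relation
generated by `(z, s + φ z) ∼ (T z, s)`. -/
def glue {L : Type*} (T : L ≃ L) (φ : L → ℝ) : Equiv.Perm (L × ℝ) where
  toFun p := (T p.1, p.2 - φ p.1)
  invFun p := (T.symm p.1, p.2 + φ (T.symm p.1))
  left_inv p := by simp
  right_inv p := by simp

/-- The equivalence relation on `L × ℝ` generated by `(z, s + φ z) ∼ (T z, s)`. -/
def glueSetoid {L : Type*} (T : L ≃ L) (φ : L → ℝ) : Setoid (L × ℝ) :=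
  Equiv.Perm.SameCycle.setoid (glue T φ)

/-- The vertical translation `(z, s) ↦ (z, s + t)`. -/
def vertical {L : Type*} (t : ℝ) (p : L × ℝ) : L × ℝ := (p.1, p.2 + t)

theorem glue_zpow_vertical {L : Type*} (T : L ≃ L) (φ : L → ℝ) (t : ℝ) (i : ℤ) (p : L × ℝ) :
    (glue T φ ^ i) (vertical t p) = vertical t ((glue T φ ^ i) p) := by
  let V : Equiv.Perm (L × ℝ) :=
    ⟨vertical t, vertical (-t), fun p => by simp [vertical], fun p => by simp [vertical]⟩
  have h : Commute (glue T φ) V := by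
    ext p <;> simp [V, glue, vertical]
    ring
  exact congrArg (fun e : Equiv.Perm (L × ℝ) => e p) (h.zpow_left i).eq

/-- The phase space `M_φ = (𝕋² × ℝ) / ∼`, where `(z, s + φ z) ∼ (R_{α,α'} z, s)`. -/
def Space (α α' : ℝ) (φ : Ceiling) : Type :=
  Quotient (glueSetoid (rotation α α') φ)

variable {α α' : ℝ} {φ : Ceiling}

/-- The projection `𝕋² × ℝ → M_φ`. -/
def proj (α α' : ℝ) (φ : Ceiling) (p : Torus2 × ℝ) : Space α α' φ :=
  Quotient.mk (glueSetoid (rotation α α') φ) p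

/-- The special flow `T^t` over `R_{α,α'}` under the ceiling function `φ`. -/
def flow (α α' : ℝ) (φ : Ceiling) (t : ℝ) : Space α α' φ → Space α α' φ :=
  Quotient.map (vertical t) (by
    rintro p q ⟨i, hi⟩
    exact ⟨i, by rw [glue_zpow_vertical, hi]⟩)

/-- The quotient σ-algebra. -/
instance : MeasurableSpace (Space α α' φ) :=
  inferInstanceAs (MeasurableSpace (Quotient (glueSetoid (rotation α α') φ)))

/-- The fundamental domain `{(z, s) : 0 ≤ s < φ z}`. -/
def domain (φ : Ceiling) : Set (Torus2 × ℝ) := {p | 0 ≤ p.2 ∧ p.2 < φ p.1}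

/-- The measure `μ` on `M_φ`: the normalized product of the Haar measure of `𝕋²` and the Lebesgue
measure on the fibres `[0, φ z)`. -/
def measure (α α' : ℝ) (φ : Ceiling) : Measure (Space α α' φ) :=
  (((volume : Measure (Torus2 × ℝ)) (domain φ))⁻¹ •
    (volume : Measure (Torus2 × ℝ)).restrict (domain φ)).map (proj α α' φ)

/-! ### The metric of `M_φ`

`M_φ` is the compact set `{(z, s) : 0 ≤ s ≤ φ z}` with its top `(z, φ z)` glued to its bottom
`(R_{α,α'} z, 0)`; it carries the quotient of the Euclidean metric of this set. -/

/-- The Euclidean distance on `𝕋² × ℝ`. -/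
def euclid (p q : Torus2 × ℝ) : ℝ :=
  Real.sqrt (dist p.1.1 q.1.1 ^ 2 + dist p.1.2 q.1.2 ^ 2 + dist p.2 q.2 ^ 2)

/-- The closed fundamental domain `{(z, s) : 0 ≤ s ≤ φ z}`. -/
def closedDomain (φ : Ceiling) : Set (Torus2 × ℝ) := {p | 0 ≤ p.2 ∧ p.2 ≤ φ p.1}

/-- `Chain ξ η ℓ`: there are finitely many pairs `(pᵢ, qᵢ)` of points of the closed fundamental
domain, of total Euclidean length `ℓ`, with `p₁` over `ξ`, each `qᵢ` glued to `pᵢ₊₁`, and the last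
`qᵢ` over `η`. -/
inductive Chain : Space α α' φ → Space α α' φ → ℝ → Prop
  | nil (ξ : Space α α' φ) : Chain ξ ξ 0
  | cons {p q : Torus2 × ℝ} {η : Space α α' φ} {ℓ : ℝ} (hp : p ∈ closedDomain φ)
      (hq : q ∈ closedDomain φ) (h : Chain (proj α α' φ q) η ℓ) :
      Chain (proj α α' φ p) η (euclid p q + ℓ)

/-- The quotient distance: the infimum of the lengths of chains from `ξ` to `η`. -/
def chainDist (ξ η : Space α α' φ) : ℝ := sInf {ℓ | Chain ξ η ℓ}

/-! The facts below show that `chainDist` is a metric. -/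

theorem Ceiling.exists_lipschitz (φ : Ceiling) : ∃ K : ℝ, 0 ≤ K ∧
    ∀ z w : Torus2, |φ z - φ w| ≤ K * dist z w := by
  set F : ℝ × ℝ → ℝ := fun v => φ ((v.1 : UnitAddCircle), (v.2 : UnitAddCircle)) with hF
  have hs : ContDiff ℝ ∞ F := φ.smooth'
  set S : Set (ℝ × ℝ) := Set.Icc (-1) 2 ×ˢ Set.Icc (-1) 2 with hS
  have hSc : IsCompact S := isCompact_Icc.prod isCompact_Icc
  have hSv : Convex ℝ S := (convex_Icc _ _).prod (convex_Icc _ _)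
  obtain ⟨C, hC⟩ := hSc.exists_bound_of_continuousOn
    (hs.continuous_fderiv (by simp)).continuousOn
  refine ⟨max C 0, le_max_right _ _, ?_⟩
  have key : ∀ a : UnitAddCircle, ∀ b : UnitAddCircle, ∃ x ∈ Set.Icc (-1 : ℝ) 2,
      ∃ y ∈ Set.Icc (-1 : ℝ) 2,
      (x : UnitAddCircle) = a ∧ (y : UnitAddCircle) = b ∧ |x - y| = dist a b := by
    intro a b
    induction a using QuotientAddGroup.induction_on with | H a =>
    induction b using QuotientAddGroup.induction_on with | H b =>
    have h1 : ((round (a - b) : ℝ) : UnitAddCircle) = 0 :=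
      (AddCircle.coe_eq_zero_iff (1 : ℝ)).2 ⟨round (a - b), by simp⟩
    have h2 : ((⌊a⌋ : ℝ) : UnitAddCircle) = 0 :=
      (AddCircle.coe_eq_zero_iff (1 : ℝ)).2 ⟨⌊a⌋, by simp⟩
    have hr := abs_le.1 (abs_sub_round (a - b))
    have f1 := Int.floor_le a
    have f2 := Int.lt_floor_add_one a
    refine ⟨a - ⌊a⌋, ⟨by linarith, by linarith⟩, b - ⌊a⌋ + round (a - b),
      ⟨by linarith, by linarith⟩, ?_, ?_, ?_⟩
    · rw [AddCircle.coe_sub, h2, sub_zero]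
    · rw [AddCircle.coe_add, AddCircle.coe_sub, h1, h2, sub_zero, add_zero]
    · have : dist (a : UnitAddCircle) (b : UnitAddCircle) = |a - b - round (a - b)| := by
        rw [dist_eq_norm, ← AddCircle.coe_sub, UnitAddCircle.norm_eq]
      refine Eq.trans ?_ this.symm
      congr 1
      ring
  intro z w
  obtain ⟨x, hx, x', hx', rfl', rfl'', e1⟩ := key z.1 w.1
  obtain ⟨y, hy, y', hy', sfl', sfl'', e2⟩ := key z.2 w.2
  have := hSv.norm_image_sub_le_of_norm_fderiv_le (f := F) (C := max C 0)
    (x := (x', y')) (y := (x, y))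
    (fun v _ => (hs.differentiable (by simp)) v)
    (fun v hv => (hC v hv).trans (le_max_left _ _)) ⟨hx', hy'⟩ ⟨hx, hy⟩
  have e3 : F (x, y) = φ z := by simp only [hF, rfl', sfl']
  have e4 : F (x', y') = φ w := by simp only [hF, rfl'', sfl'']
  rw [e3, e4, Real.norm_eq_abs] at this
  refine this.trans_eq ?_
  congr 1
  rw [Prod.dist_eq, ← e1, ← e2]
  rfl

theorem Ceiling.continuous (φ : Ceiling) : Continuous φ := by
  obtain ⟨K, hK, h⟩ := φ.exists_lipschitz
  exact (LipschitzWith.of_dist_le_mul (K := ⟨K, hK⟩) h).continuous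

theorem Ceiling.exists_lower (φ : Ceiling) : ∃ c : ℝ, 0 < c ∧ ∀ z, c ≤ φ z := by
  obtain ⟨z, -, hz⟩ := isCompact_univ.exists_isMinOn Set.univ_nonempty φ.continuous.continuousOn
  exact ⟨φ z, φ.pos' z, fun w => hz (Set.mem_univ w)⟩

theorem Ceiling.exists_upper (φ : Ceiling) : ∃ c : ℝ, ∀ z, φ z ≤ c := by
  obtain ⟨z, -, hz⟩ := isCompact_univ.exists_isMaxOn Set.univ_nonempty φ.continuous.continuousOn
  exact ⟨φ z, fun w => hz (Set.mem_univ w)⟩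

theorem proj_eq_iff {p q : Torus2 × ℝ} : proj α α' φ p = proj α α' φ q ↔
    ∃ i : ℤ, (glue (rotation α α') φ ^ i) p = q :=
  Quotient.eq (r := glueSetoid (rotation α α') φ)

theorem proj_glue (p : Torus2 × ℝ) :
    proj α α' φ (glue (rotation α α') φ p) = proj α α' φ p :=
  (proj_eq_iff.2 ⟨1, by simp⟩).symm

theorem exists_rep (ξ : Space α α' φ) : ∃ p ∈ closedDomain φ, proj α α' φ p = ξ := by
  obtain ⟨c, hc, hcφ⟩ := φ.exists_lower
  have main : ∀ k : ℕ, ∀ p : Torus2 × ℝ, |p.2| ≤ k * c →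
      ∃ q ∈ closedDomain φ, proj α α' φ q = proj α α' φ p := by
    intro k
    induction k with
    | zero =>
      intro p hp
      have h0 : p.2 = 0 := by simpa using hp
      exact ⟨p, ⟨h0.ge, by rw [h0]; exact (φ.pos' _).le⟩, rfl⟩
    | succ k ih =>
      intro p hp
      push_cast at hp
      obtain ⟨hp1, hp2⟩ := abs_le.1 hp
      by_cases h1 : 0 ≤ p.2
      · by_cases h2 : p.2 ≤ φ p.1
        · exact ⟨p, ⟨h1, h2⟩, rfl⟩
        · have := hcφ p.1
          have hb : |(glue (rotation α α') φ p).2| ≤ k * c := by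
            change |p.2 - φ p.1| ≤ _
            rw [abs_le]
            constructor <;> nlinarith
          obtain ⟨q, hq, e⟩ := ih _ hb
          exact ⟨q, hq, e.trans (proj_glue p)⟩
      · set r := (glue (rotation α α') φ).symm p with hr
        have hrp : glue (rotation α α') φ r = p := by simp [hr]
        have h2 : p.2 = r.2 - φ r.1 := by rw [← hrp]; rfl
        have h3 := hcφ r.1
        have hrpp : proj α α' φ r = proj α α' φ p := by rw [← hrp, proj_glue]
        by_cases h4 : 0 ≤ r.2
        · exact ⟨r, ⟨h4, by linarith⟩, hrpp⟩
        · have hb : |r.2| ≤ k * c := by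
            rw [abs_le]
            constructor <;> nlinarith
          obtain ⟨q, hq, e⟩ := ih _ hb
          exact ⟨q, hq, e.trans hrpp⟩
  induction ξ using Quotient.inductionOn with | h p =>
  obtain ⟨k, hk⟩ := exists_nat_ge (|p.2| / c)
  exact main k p ((div_le_iff₀ hc).1 hk)

/-- Points of the closed fundamental domain are identified only along the seam. -/
theorem seam {p q : Torus2 × ℝ} (hp : p ∈ closedDomain φ) (hq : q ∈ closedDomain φ)
    (h : proj α α' φ p = proj α α' φ q) :
    p = q ∨ glue (rotation α α') φ p = q ∨ glue (rotation α α') φ q = p := by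
  have neg : ∀ (n : ℕ) (r : Torus2 × ℝ), r ∈ closedDomain φ →
      ((glue (rotation α α') φ ^ (n + 2)) r).2 < 0 := by
    intro n r hr
    induction n with
    | zero =>
      have h1 : ((glue (rotation α α') φ ^ (0 + 2)) r).2 =
        r.2 - φ r.1 - φ (rotation α α' r.1) := rfl
      have := φ.pos' (rotation α α' r.1)
      have := hr.2
      linarith
    | succ n ih =>
      rw [pow_succ', Equiv.Perm.mul_apply]
      have := φ.pos' ((glue (rotation α α') φ ^ (n + 2)) r).1
      change ((glue (rotation α α') φ ^ (n + 2)) r).2 - φ _ < 0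
      linarith
  have pos : ∀ (n : ℕ) (r s : Torus2 × ℝ), r ∈ closedDomain φ → s ∈ closedDomain φ →
      (glue (rotation α α') φ ^ n) r = s → r = s ∨ glue (rotation α α') φ r = s := by
    intro n r s hr hs e
    match n, e with
    | 0, e => exact Or.inl (by simpa using e)
    | 1, e => exact Or.inr (by simpa using e)
    | n + 2, e =>
      have := neg n r hr
      rw [e] at this
      exact absurd hs.1 (not_le.2 this)
  obtain ⟨i, hi⟩ := proj_eq_iff.1 h
  obtain ⟨n, rfl | rfl⟩ := i.eq_nat_or_neg
  · rw [zpow_natCast] at hi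
    rcases pos n p q hp hq hi with h | h
    · exact Or.inl h
    · exact Or.inr (Or.inl h)
  · rw [zpow_neg, zpow_natCast, Equiv.Perm.inv_eq_iff_eq] at hi
    rcases pos n q p hq hp hi.symm with h | h
    · exact Or.inl h.symm
    · exact Or.inr (Or.inr h)

/-- An auxiliary map to the three-torus that separates the points of `M_φ`. -/
def toTorus3 (α α' : ℝ) (φ : Ceiling) (p : Torus2 × ℝ) : Torus2 × UnitAddCircle :=
  (p.1 + (((p.2 / φ p.1 * α : ℝ) : UnitAddCircle), ((p.2 / φ p.1 * α' : ℝ) : UnitAddCircle)),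
    ((p.2 / φ p.1 : ℝ) : UnitAddCircle))

theorem toTorus3_seam {p q : Torus2 × ℝ} (hp : p ∈ closedDomain φ) (hq : q ∈ closedDomain φ)
    (h : glue (rotation α α') φ p = q) : toTorus3 α α' φ p = toTorus3 α α' φ q := by
  have h0 : q.2 = p.2 - φ p.1 := by rw [← h]; rfl
  have hz : q.1 = p.1 + ((α : UnitAddCircle), (α' : UnitAddCircle)) := by rw [← h]; rfl
  have h1 : p.2 = φ p.1 := le_antisymm hp.2 (by linarith [hq.1])
  have h2 : q.2 = 0 := by linarith
  have h3 : p.2 / φ p.1 = 1 := by rw [h1]; exact div_self (φ.pos' _).ne'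
  unfold toTorus3
  rw [h3, h2, hz]
  ext <;> simp

theorem toTorus3_congr {p q : Torus2 × ℝ} (hp : p ∈ closedDomain φ) (hq : q ∈ closedDomain φ)
    (h : proj α α' φ p = proj α α' φ q) : toTorus3 α α' φ p = toTorus3 α α' φ q := by
  rcases seam hp hq h with rfl | h | h
  · rfl
  · exact toTorus3_seam hp hq h
  · exact (toTorus3_seam hq hp h).symm

theorem proj_eq_of_toTorus3_eq {p q : Torus2 × ℝ} (hp : p ∈ closedDomain φ)
    (hq : q ∈ closedDomain φ) (h : toTorus3 α α' φ p = toTorus3 α α' φ q) :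
    proj α α' φ p = proj α α' φ q := by
  have hφp := φ.pos' p.1
  have hφq := φ.pos' q.1
  have up0 : 0 ≤ p.2 / φ p.1 := div_nonneg hp.1 hφp.le
  have uq0 : 0 ≤ q.2 / φ q.1 := div_nonneg hq.1 hφq.le
  have up1 : p.2 / φ p.1 ≤ 1 := (div_le_one hφp).2 hp.2
  have uq1 : q.2 / φ q.1 ≤ 1 := (div_le_one hφq).2 hq.2
  have ep : p.2 = p.2 / φ p.1 * φ p.1 := (div_mul_cancel₀ _ hφp.ne').symm
  have eq : q.2 = q.2 / φ q.1 * φ q.1 := (div_mul_cancel₀ _ hφq.ne').symm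
  unfold toTorus3 at h
  obtain ⟨hz, hu⟩ := Prod.mk.inj h
  generalize p.2 / φ p.1 = u at *
  generalize q.2 / φ q.1 = v at *
  have hn : ∃ n : ℤ, u - v = n := by
    have : ((u - v : ℝ) : UnitAddCircle) = 0 := by rw [AddCircle.coe_sub, hu, sub_self]
    obtain ⟨n, hn⟩ := (AddCircle.coe_eq_zero_iff (1 : ℝ)).1 this
    exact ⟨n, by simpa using hn.symm⟩
  obtain ⟨n, hn⟩ := hn
  have n1 : n ≤ 1 := by exact_mod_cast (by linarith : (n : ℝ) ≤ 1)
  have n2 : -1 ≤ n := by exact_mod_cast (by linarith : (-1 : ℝ) ≤ n)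
  have aux : ∀ {p q : Torus2 × ℝ} {u v : ℝ}, u = 1 → v = 0 →
      p.2 = u * φ p.1 → q.2 = v * φ q.1 →
      p.1 + (((u * α : ℝ) : UnitAddCircle), ((u * α' : ℝ) : UnitAddCircle)) =
        q.1 + (((v * α : ℝ) : UnitAddCircle), ((v * α' : ℝ) : UnitAddCircle)) →
      proj α α' φ p = proj α α' φ q := by
    rintro p q _ _ rfl rfl e1 e2 e
    have e' : glue (rotation α α') φ p = q := by
      refine Prod.ext ?_ ?_
      · have : p.1 + ((α : UnitAddCircle), (α' : UnitAddCircle)) = q.1 := by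
          have h0 : ((0 : UnitAddCircle), (0 : UnitAddCircle)) = 0 := rfl
          simpa [h0] using e
        exact this
      · change p.2 - φ p.1 = q.2
        linarith
    rw [← e', proj_glue]
  interval_cases n
  · push_cast at hn
    exact (aux (by linarith) (by linarith) eq ep hz.symm).symm
  · have huv : u = v := by push_cast at hn; linarith
    subst huv
    have hz' : p.1 = q.1 := add_right_cancel hz
    have : p = q := Prod.ext hz' (by rw [ep, eq, hz'])
    rw [this]
  · push_cast at hn
    exact aux (by linarith) (by linarith) ep eq hz

theorem euclid_nonneg (p q : Torus2 × ℝ) : 0 ≤ euclid p q := Real.sqrt_nonneg _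

theorem euclid_self (p : Torus2 × ℝ) : euclid p p = 0 := by simp [euclid]

theorem euclid_comm (p q : Torus2 × ℝ) : euclid p q = euclid q p := by
  simp only [euclid, dist_comm]

theorem dist_le_euclid (p q : Torus2 × ℝ) : dist p q ≤ euclid p q := by
  rw [Prod.dist_eq, Prod.dist_eq]
  refine max_le (max_le ?_ ?_) ?_ <;> refine Real.le_sqrt_of_sq_le ?_ <;> nlinarith [
    sq_nonneg (dist p.1.1 q.1.1), sq_nonneg (dist p.1.2 q.1.2), sq_nonneg (dist p.2 q.2)]

theorem toTorus3_lipschitz (α α' : ℝ) (φ : Ceiling) : ∃ C : ℝ, 0 ≤ C ∧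
    ∀ p ∈ closedDomain φ, ∀ q ∈ closedDomain φ,
      dist (toTorus3 α α' φ p) (toTorus3 α α' φ q) ≤ C * euclid p q := by
  obtain ⟨K, hK, hL⟩ := φ.exists_lipschitz
  obtain ⟨c, hc, hcφ⟩ := φ.exists_lower
  have hcoe : ∀ x y : ℝ, dist (x : UnitAddCircle) (y : UnitAddCircle) ≤ |x - y| := by
    intro x y
    rw [dist_eq_norm, ← AddCircle.coe_sub, UnitAddCircle.norm_eq]
    simpa using round_le (x - y) 0
  set D : ℝ := (1 + K) / c with hD
  have hD0 : 0 ≤ D := by positivity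
  refine ⟨1 + D * (1 + |α| + |α'|), by positivity, ?_⟩
  intro p hp q hq
  have hE := dist_le_euclid p q
  have hE0 := euclid_nonneg p q
  set E := euclid p q
  have hφp := φ.pos' p.1
  have hφq := φ.pos' q.1
  have d1 : dist p.1 q.1 ≤ E := (le_max_left _ _).trans hE
  have d2 : |p.2 - q.2| ≤ E := (le_max_right _ _).trans hE
  have hu : |p.2 / φ p.1 - q.2 / φ q.1| ≤ D * E := by
    have e : p.2 / φ p.1 - q.2 / φ q.1 =
        ((p.2 - q.2) + (q.2 / φ q.1) * (φ q.1 - φ p.1)) / φ p.1 := by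
      field_simp
      ring
    have v0 : 0 ≤ q.2 / φ q.1 := div_nonneg hq.1 hφq.le
    have v1 : q.2 / φ q.1 ≤ 1 := (div_le_one hφq).2 hq.2
    have b1 : |φ q.1 - φ p.1| ≤ K * E := by
      rw [abs_sub_comm]
      exact (hL _ _).trans (mul_le_mul_of_nonneg_left d1 hK)
    have b2 : |(p.2 - q.2) + (q.2 / φ q.1) * (φ q.1 - φ p.1)| ≤ (1 + K) * E := by
      refine (abs_add_le _ _).trans ?_
      rw [abs_mul, abs_of_nonneg v0]
      nlinarith [abs_nonneg (φ q.1 - φ p.1)]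
    have e2 : D * E = (1 + K) * E / c := by rw [hD, div_mul_eq_mul_div]
    rw [e, abs_div, abs_of_pos hφp, e2]
    exact div_le_div₀ (by positivity) b2 hc (hcφ _)
  have hmul : ∀ a : ℝ, |p.2 / φ p.1 * a - q.2 / φ q.1 * a| ≤ D * E * |a| := by
    intro a
    rw [← sub_mul, abs_mul]
    exact mul_le_mul_of_nonneg_right hu (abs_nonneg a)
  have x1 : dist p.1.1 q.1.1 ≤ E := (le_max_left _ _).trans d1
  have x2 : dist p.1.2 q.1.2 ≤ E := (le_max_right _ _).trans d1
  have hDE : 0 ≤ D * E := mul_nonneg hD0 hE0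
  have a1 : 0 ≤ D * E * |α| := mul_nonneg hDE (abs_nonneg _)
  have a2 : 0 ≤ D * E * |α'| := mul_nonneg hDE (abs_nonneg _)
  have split : (1 + D * (1 + |α| + |α'|)) * E = E + D * E + D * E * |α| + D * E * |α'| := by ring
  rw [split, Prod.dist_eq, Prod.dist_eq]
  refine max_le (max_le ?_ ?_) ?_
  · have := dist_add_add_le p.1.1 ((p.2 / φ p.1 * α : ℝ) : UnitAddCircle) q.1.1
      ((q.2 / φ q.1 * α : ℝ) : UnitAddCircle)
    have h2 := (hcoe (p.2 / φ p.1 * α) (q.2 / φ q.1 * α)).trans (hmul α)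
    exact this.trans (by linarith)
  · have := dist_add_add_le p.1.2 ((p.2 / φ p.1 * α' : ℝ) : UnitAddCircle) q.1.2
      ((q.2 / φ q.1 * α' : ℝ) : UnitAddCircle)
    have h2 := (hcoe (p.2 / φ p.1 * α') (q.2 / φ q.1 * α')).trans (hmul α')
    exact this.trans (by linarith)
  · have := (hcoe (p.2 / φ p.1) (q.2 / φ q.1)).trans hu
    exact this.trans (by linarith)

theorem Chain.nonneg {ξ η : Space α α' φ} {ℓ : ℝ} (h : Chain ξ η ℓ) : 0 ≤ ℓ := by
  induction h with
  | nil => exact le_rfl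
  | cons hp hq h ih => exact add_nonneg (euclid_nonneg _ _) ih

theorem Chain.trans {ξ η ζ : Space α α' φ} {ℓ m : ℝ} (h : Chain ξ η ℓ) (h' : Chain η ζ m) :
    Chain ξ ζ (ℓ + m) := by
  induction h with
  | nil => simpa using h'
  | cons hp hq h ih => rw [add_assoc]; exact Chain.cons hp hq (ih h')

theorem Chain.single {p q : Torus2 × ℝ} (hp : p ∈ closedDomain φ) (hq : q ∈ closedDomain φ) :
    Chain (proj α α' φ p) (proj α α' φ q) (euclid p q) := by
  simpa using Chain.cons hp hq (Chain.nil (proj α α' φ q))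

theorem Chain.symm {ξ η : Space α α' φ} {ℓ : ℝ} (h : Chain ξ η ℓ) : Chain η ξ ℓ := by
  induction h with
  | nil => exact Chain.nil _
  | cons hp hq h ih =>
    rw [add_comm, euclid_comm]
    exact ih.trans (Chain.single hq hp)

theorem Chain.exists (ξ η : Space α α' φ) : {ℓ | Chain ξ η ℓ}.Nonempty := by
  obtain ⟨p, hp, rfl⟩ := exists_rep ξ
  obtain ⟨q, hq, rfl⟩ := exists_rep η
  exact ⟨_, Chain.single hp hq⟩

theorem Chain.bddBelow (ξ η : Space α α' φ) : BddBelow {ℓ | Chain ξ η ℓ} :=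
  ⟨0, fun _ h => h.nonneg⟩

theorem Chain.toTorus3_le {C : ℝ}
    (hC : ∀ p ∈ closedDomain φ, ∀ q ∈ closedDomain φ,
      dist (toTorus3 α α' φ p) (toTorus3 α α' φ q) ≤ C * euclid p q)
    {ξ η : Space α α' φ} {ℓ : ℝ} (h : Chain ξ η ℓ) :
    ∀ p ∈ closedDomain φ, ∀ q ∈ closedDomain φ, proj α α' φ p = ξ → proj α α' φ q = η →
      dist (toTorus3 α α' φ p) (toTorus3 α α' φ q) ≤ C * ℓ := by
  induction h with
  | nil ξ =>
    intro p hp q hq e1 e2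
    rw [toTorus3_congr hp hq (e1.trans e2.symm)]
    simp
  | @cons a b η ℓ ha hb h ih =>
    intro p hp q hq e1 e2
    rw [toTorus3_congr hp ha e1, mul_add]
    exact (dist_triangle _ (toTorus3 α α' φ b) _).trans
      (add_le_add (hC _ ha _ hb) (ih b hb q hq rfl e2))

/-- The quotient metric on `M_φ`. -/
instance : MetricSpace (Space α α' φ) where
  dist := chainDist
  dist_self ξ := le_antisymm (csInf_le (Chain.bddBelow ξ ξ) (Chain.nil ξ))
    (le_csInf (Chain.exists ξ ξ) fun _ h => h.nonneg)
  dist_comm ξ η := by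
    have : {ℓ | Chain ξ η ℓ} = {ℓ | Chain η ξ ℓ} :=
      Set.ext fun _ => ⟨Chain.symm, Chain.symm⟩
    exact congrArg sInf this
  dist_triangle ξ η ζ := by
    refine le_of_forall_pos_le_add fun ε hε => ?_
    obtain ⟨ℓ, hℓ, h1⟩ := Real.lt_sInf_add_pos (Chain.exists ξ η) (half_pos hε)
    obtain ⟨m, hm, h2⟩ := Real.lt_sInf_add_pos (Chain.exists η ζ) (half_pos hε)
    have h3 : sInf {ℓ | Chain ξ ζ ℓ} ≤ ℓ + m :=
      csInf_le (Chain.bddBelow ξ ζ) (Chain.trans hℓ hm)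
    change sInf {ℓ | Chain ξ ζ ℓ} ≤ sInf {ℓ | Chain ξ η ℓ} + sInf {ℓ | Chain η ζ ℓ} + ε
    linarith
  eq_of_dist_eq_zero := by
    intro ξ η h
    obtain ⟨C, hC0, hC⟩ := toTorus3_lipschitz α α' φ
    obtain ⟨p, hp, rfl⟩ := exists_rep ξ
    obtain ⟨q, hq, rfl⟩ := exists_rep η
    refine proj_eq_of_toTorus3_eq hp hq (dist_le_zero.1 (le_of_forall_pos_le_add fun ε hε => ?_))
    have hε' : 0 < ε / (C + 1) := by positivity
    obtain ⟨ℓ, hℓ, h1⟩ := Real.lt_sInf_add_pos (Chain.exists (proj α α' φ p) (proj α α' φ q)) hε'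
    have h0 : sInf {ℓ | Chain (proj α α' φ p) (proj α α' φ q) ℓ} = 0 := h
    rw [h0, zero_add, lt_div_iff₀ (by positivity)] at h1
    have h2 := Chain.toTorus3_le hC hℓ p hp q hq rfl rfl
    have h3 := Chain.nonneg hℓ
    nlinarith

/-- `μ` is a probability measure. -/
instance : IsProbabilityMeasure (measure α α' φ) := by
  obtain ⟨c, hc, hcφ⟩ := φ.exists_lower
  obtain ⟨d, hd⟩ := φ.exists_upper
  have hlow : (Set.univ : Set Torus2) ×ˢ Set.Ico 0 c ⊆ domain φ :=
    fun p hp => ⟨hp.2.1, hp.2.2.trans_le (hcφ _)⟩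
  have hup : domain φ ⊆ (Set.univ : Set Torus2) ×ˢ Set.Ico 0 d :=
    fun p hp => ⟨Set.mem_univ _, hp.1, hp.2.trans_le (hd _)⟩
  have v : ∀ e : ℝ, (volume : Measure (Torus2 × ℝ)) (Set.univ ×ˢ Set.Ico 0 e) =
      ENNReal.ofReal e := by
    intro e
    rw [Measure.volume_eq_prod, Measure.prod_prod, Real.volume_Ico, sub_zero,
      Measure.volume_eq_prod, ← Set.univ_prod_univ, Measure.prod_prod]
    simp
  have h0 : (volume : Measure (Torus2 × ℝ)) (domain φ) ≠ 0 := by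
    have := measure_mono (μ := (volume : Measure (Torus2 × ℝ))) hlow
    rw [v] at this
    exact ((ENNReal.ofReal_pos.2 hc).trans_le this).ne'
  have h1 : (volume : Measure (Torus2 × ℝ)) (domain φ) ≠ ⊤ := by
    have := measure_mono (μ := (volume : Measure (Torus2 × ℝ))) hup
    rw [v] at this
    exact (this.trans_lt ENNReal.ofReal_lt_top).ne
  have hm : Measurable (proj α α' φ) := measurable_quotient_mk''
  refine ⟨?_⟩
  unfold measure
  rw [Measure.map_apply hm MeasurableSet.univ]
  simp [ENNReal.inv_mul_cancel h0 h1]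

end SpecialFlow

end

/-!
The base is the rotation by `rot 0 = ∑ 1 / freq (2 i)` and `rot 1 = ∑ 1 / freq (2 i + 1)`, for
frequencies `freq k` of super-exponential growth which serve the two coordinates alternately. The
ceiling function `roof` is `1` plus small terms `wave k`, the `k`-th one depending on the
coordinate `k % 2` only and oscillating at frequency `freq k`. Up to scaling, `wave k` is a sine
wave flattened to zero on a proportion about `1 / invWidth k` of its period, where `invWidth k` is
of order `√k`. Two effects compete: the sine parts stretch, which gives mixing, and the flat parts
do nothing, which gives recurrence. As the proportion of the flat parts tends to zero, almost all
of the space is stretched at any given time; as it tends to zero slowly, almost every point is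
infinitely often in the flat parts of two consecutive terms.

*Birkhoff sums.* Each term changes sign under half of its period, so that its sum over an orbit of
the rational rotation of a later denominator vanishes. Hence, up to times `m` with `m ^ 2` small in
comparison with the next frequency of the same coordinate, the Birkhoff sums in one coordinate
behave like `m` times the current term. Where this term is a sine wave they are almost affine with
a large slope (`Tower.abs_birk_stretch`); where it vanishes, the Birkhoff sum over a multiple of
its frequency is tiny (`Tower.abs_birk_le_of_flat`).

*Mixing.* By `isMixing_of_continuous` it suffices to bound the correlations of continuous
observables. For `t` between `start k` and `start (k + 1)`, the flow at time `t` maps a very short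
segment in the coordinate `k % 2` to a nearly vertical segment, a long orbit segment run at
constant speed (`exists_slope`), unless the segment lies in a set of small measure
(`measureReal_badSet_le`). Along long orbit segments, continuous functions average to their mean
uniformly, because the base rotation is approximated by rational rotations with dense orbits
(`exists_forall_window`). So the observables average out along the short segments
(`eventually_horizontal_average`), and averaging a correlation over the corresponding translations
yields its limit (`abs_correlation_sub_le`, `tendsto_continuous_correlation`). The two coordinates
are needed so that at each time one of them stretches: the windows of even stages alone leave gaps,
which the odd stages fill.

*Super-recurrence.* If the base point lies in `flatSet i`, where the terms of stages `2 i` and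
`2 i + 1` vanish, then at time `N = freq (2 i + 1)` both the base rotation and the vertical
displacement return with an error of order `N ^ 2 / freq (2 i + 2)`, which is eventually less than
`exp (-N ^ 2)` as `freq (2 i + 2) ≥ exp (N ^ 3)` (`superRecurrent_of_frequently`). The sets
`flatSet i` have proportion at least `1 / (invWidth (2 i) * invWidth (2 i + 1))` inside every set
with the periods of the later ones (`measureReal_le_mul_flat`). These proportions have infinite
sum, and so almost every point lies in infinitely many of the sets (`ae_frequently_flat`), as in
the second Borel–Cantelli lemma.
-/

noncomputable section

namespace SpecialFlow

/-! ### Sums along rational rotations -/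

theorem sum_range_shift {f : ℝ → ℝ} (hf : Function.Periodic f 1) {q : ℕ} (hq : 0 < q) (x : ℝ) :
    ∑ n ∈ Finset.range q, f (x + 1 / q + n / q) = ∑ n ∈ Finset.range q, f (x + n / q) := by
  have h := Finset.sum_range_succ' (fun n : ℕ => f (x + n / q)) q
  have h2 := Finset.sum_range_succ (fun n : ℕ => f (x + n / q)) q
  have hq' : (q : ℝ) ≠ 0 := by positivity
  have e : f (x + (q : ℝ) / q) = f (x + ((0 : ℕ) : ℝ) / q) := by
    rw [div_self hq', hf]; simp
  have e2 : ∀ n : ℕ, f (x + 1 / q + n / q) = f (x + ((n + 1 : ℕ) : ℝ) / q) := by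
    intro n; congr 1; push_cast; ring
  simp only [e2]
  linarith

theorem sum_range_shift_nat {f : ℝ → ℝ} (hf : Function.Periodic f 1) {q : ℕ} (hq : 0 < q) (d : ℕ)
    (x : ℝ) :
    ∑ n ∈ Finset.range q, f (x + d / q + n / q) = ∑ n ∈ Finset.range q, f (x + n / q) := by
  induction d with
  | zero => simp
  | succ d ih =>
    rw [← ih, ← sum_range_shift hf hq (x + d / q)]
    refine Finset.sum_congr rfl fun n _ => ?_
    congr 1; push_cast; ring

/-- The orbit of a rotation by a reduced fraction of denominator `q` is the grid of step `1 / q`. -/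
theorem sum_range_coprime {f : ℝ → ℝ} (hf : Function.Periodic f 1) {p q : ℕ} (hq : 0 < q)
    (hpq : p.Coprime q) (x : ℝ) :
    ∑ n ∈ Finset.range q, f (x + n * (p / q)) = ∑ n ∈ Finset.range q, f (x + n / q) := by
  have : NeZero q := ⟨hq.ne'⟩
  have hq' : (q : ℝ) ≠ 0 := by positivity
  set F : ZMod q → ℝ := fun a => f (x + a.val / q) with hF
  have key : ∀ n : ℕ, f (x + n / q) = F (n : ZMod q) := by
    intro n
    simp only [hF, ZMod.val_natCast]
    have : (n : ℝ) = ((n % q : ℕ) : ℝ) + ((n / q : ℕ) : ℝ) * q := by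
      exact_mod_cast (Nat.mod_add_div' n q).symm
    have e : x + (n : ℝ) / q = x + ((n % q : ℕ) : ℝ) / q + ((n / q : ℕ) : ℝ) * 1 := by
      rw [this]; field_simp
      ring
    rw [e, hf.nat_mul]
  have total : ∀ G : ZMod q → ℝ, ∑ n ∈ Finset.range q, G (n : ZMod q) = ∑ a, G a := by
    intro G
    refine Finset.sum_bij (fun n _ => (n : ZMod q)) (fun _ _ => Finset.mem_univ _) ?_ ?_
      (fun _ _ => rfl)
    · intro a ha b hb h
      have := congrArg ZMod.val h
      rwa [ZMod.val_natCast, ZMod.val_natCast, Nat.mod_eq_of_lt (Finset.mem_range.1 ha),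
        Nat.mod_eq_of_lt (Finset.mem_range.1 hb)] at this
    · intro a _
      exact ⟨a.val, Finset.mem_range.2 (ZMod.val_lt a), ZMod.natCast_zmod_val a⟩
  have h1 : ∀ n : ℕ, f (x + n * (p / q)) = F ((n : ZMod q) * p) := by
    intro n
    have := key (n * p)
    push_cast at this
    rw [← this]; congr 1; ring
  simp only [h1, key]
  rw [total (fun a => F (a * p)), total F]
  let u : (ZMod q)ˣ := ZMod.unitOfCoprime p hpq
  exact Equiv.sum_comp u.mulRight F

theorem sum_range_block_mul {ψ : ℝ → ℝ} {q : ℕ} {a : ℝ}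
    (h0 : ∀ x, ∑ n ∈ Finset.range q, ψ (x + n * a) = 0) (k : ℕ) (x : ℝ) :
    ∑ n ∈ Finset.range (q * k), ψ (x + n * a) = 0 := by
  induction k with
  | zero => simp
  | succ k ih =>
    rw [Nat.mul_succ, Finset.sum_range_add, ih, zero_add, ← h0 (x + (q * k : ℕ) * a)]
    refine Finset.sum_congr rfl fun n _ => ?_
    congr 1; push_cast; ring

/-- A sum along a rotation is bounded by one block when the sums over blocks vanish. -/
theorem abs_sum_range_le_of_block {ψ : ℝ → ℝ} {q : ℕ} (hq : 0 < q) {a C : ℝ}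
    (hC : ∀ x, |ψ x| ≤ C) (h0 : ∀ x, ∑ n ∈ Finset.range q, ψ (x + n * a) = 0) (m : ℕ) (x : ℝ) :
    |∑ n ∈ Finset.range m, ψ (x + n * a)| ≤ q * C := by
  have hC0 : 0 ≤ C := (abs_nonneg _).trans (hC 0)
  conv_lhs => rw [← Nat.div_add_mod m q]
  rw [Finset.sum_range_add, sum_range_block_mul h0, zero_add]
  refine (Finset.abs_sum_le_sum_abs _ _).trans ((Finset.sum_le_card_nsmul _ _ C
    fun n _ => hC _).trans ?_)
  rw [Finset.card_range, nsmul_eq_mul]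
  gcongr
  exact (Nat.mod_lt m hq).le

theorem abs_sum_range_sub_le {ψ : ℝ → ℝ} {K : ℝ} (hψ : ∀ x y, |ψ x - ψ y| ≤ K * |x - y|)
    {a b e : ℝ} (hab : |a - b| ≤ e) (m : ℕ) (x : ℝ) :
    |∑ n ∈ Finset.range m, ψ (x + n * a) - ∑ n ∈ Finset.range m, ψ (x + n * b)| ≤
      m * (K * (m * e)) := by
  have hK : 0 ≤ K := by
    have := (abs_nonneg _).trans (hψ 1 0)
    simpa using this
  rw [← Finset.sum_sub_distrib]
  refine (Finset.abs_sum_le_sum_abs _ _).trans ((Finset.sum_le_card_nsmul _ _ (K * (m * e))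
    fun n hn => (hψ _ _).trans ?_).trans ?_)
  · have : x + n * a - (x + n * b) = n * (a - b) := by ring
    rw [this, abs_mul, Nat.abs_cast]
    gcongr
    exact (Finset.mem_range.1 hn).le
  · rw [Finset.card_range, nsmul_eq_mul]

/-! ### Towers of antiperiodic functions -/

/-- A sequence of functions `X i` of period `1 / Q i` which change sign under half a period, for
rapidly growing frequencies `Q i`; sizes and Lipschitz constants are small. -/
structure Tower (Q : ℕ → ℕ) (X : ℕ → ℝ → ℝ) : Prop where
  pos : ∀ i, 0 < Q i
  dvd : ∀ i, 2 * Q i ^ 2 ∣ Q (i + 1)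
  anti : ∀ i x, X i (x + 1 / (2 * Q i)) = -X i x
  bound : ∀ i x, |X i x| ≤ (1 / 2) ^ (i + 4) / Q i
  lip : ∀ i x y, |X i x - X i y| ≤ (1 / 2) ^ (i + 4) * |x - y|

/-- The rotation angle `∑ 1 / Q i`. -/
def angle (Q : ℕ → ℕ) : ℝ := ∑' i, 1 / (Q i : ℝ)

/-- The partial sum `∑_{j ≤ i} 1 / Q j`, a fraction of denominator `Q i`. -/
def angleApprox (Q : ℕ → ℕ) (i : ℕ) : ℝ := ∑ j ∈ Finset.range (i + 1), 1 / (Q j : ℝ)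

namespace Tower

variable {Q : ℕ → ℕ} {X : ℕ → ℝ → ℝ}

theorem two_mul_le (h : Tower Q X) (i : ℕ) : 2 * Q i ≤ Q (i + 1) := by
  have h1 := Nat.le_of_dvd (h.pos _) (h.dvd i)
  have h2 := h.pos i
  nlinarith

theorem geom_le (h : Tower Q X) (i k : ℕ) :
    1 / (Q (i + k) : ℝ) ≤ (1 / 2) ^ k * (1 / (Q i : ℝ)) := by
  induction k with
  | zero => simp
  | succ k ih =>
    have h1 : (2 : ℝ) * Q (i + k) ≤ Q (i + k + 1) := by exact_mod_cast h.two_mul_le (i + k)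
    have h2 : (0 : ℝ) < Q (i + k) := by exact_mod_cast h.pos _
    calc 1 / (Q (i + (k + 1)) : ℝ) ≤ 1 / (2 * Q (i + k)) :=
          one_div_le_one_div_of_le (by positivity) h1
      _ = 1 / 2 * (1 / (Q (i + k) : ℝ)) := by field_simp
      _ ≤ 1 / 2 * ((1 / 2) ^ k * (1 / (Q i : ℝ))) := by gcongr
      _ = _ := by ring

theorem summable_inv (h : Tower Q X) : Summable fun i => 1 / (Q i : ℝ) := by
  refine Summable.of_nonneg_of_le (fun i => by positivity) (fun i => ?_)
    ((summable_geometric_two).mul_right (1 / (Q 0 : ℝ)))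
  simpa using h.geom_le 0 i

theorem angle_sub_nonneg_le (h : Tower Q X) (i : ℕ) :
    0 ≤ angle Q - angleApprox Q i ∧ angle Q - angleApprox Q i ≤ 2 / Q (i + 1) := by
  have h1 := h.summable_inv.sum_add_tsum_nat_add (i + 1)
  have h2 : angle Q - angleApprox Q i = ∑' k, 1 / (Q (k + (i + 1)) : ℝ) := by
    rw [angle, ← h1, angleApprox]; ring
  rw [h2]
  refine ⟨tsum_nonneg fun k => by positivity, ?_⟩
  have h3 : Summable fun k : ℕ => (1 / 2 : ℝ) ^ k * (1 / (Q (i + 1) : ℝ)) :=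
    summable_geometric_two.mul_right _
  refine (Summable.tsum_le_tsum (fun k => ?_) ((summable_nat_add_iff (i + 1)).2 h.summable_inv)
    h3).trans ?_
  · rw [add_comm k]; exact h.geom_le (i + 1) k
  · rw [tsum_mul_right, tsum_geometric_two]
    exact le_of_eq (by ring)

theorem abs_angle_sub_le (h : Tower Q X) (i : ℕ) :
    |angle Q - angleApprox Q i| ≤ 2 / Q (i + 1) := by
  obtain ⟨h1, h2⟩ := h.angle_sub_nonneg_le i
  rwa [abs_of_nonneg h1]

theorem dvd_of_le (h : Tower Q X) {i j : ℕ} (hij : i ≤ j) : Q i ∣ Q j := by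
  induction j, hij using Nat.le_induction with
  | base => exact dvd_rfl
  | succ j _ ih =>
    exact ih.trans ((Dvd.intro_left (2 * Q j) (by ring)).trans (h.dvd j))

theorem two_mul_dvd (h : Tower Q X) {i j : ℕ} (hij : i < j) : 2 * Q i ∣ Q j := by
  refine (Dvd.dvd.trans ?_ (h.dvd i)).trans (h.dvd_of_le hij)
  exact Dvd.intro (Q i) (by ring)

/-- Each numerator is `1` modulo every prime factor of the denominator, because `Q i ^ 2` divides
`Q (i + 1)`. -/
theorem exists_coprime (h : Tower Q X) (i : ℕ) :
    ∃ p : ℕ, p.Coprime (Q i) ∧ angleApprox Q i = p / Q i := by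
  induction i with
  | zero => exact ⟨1, by simp, by simp [angleApprox]⟩
  | succ i ih =>
    obtain ⟨p, -, hp⟩ := ih
    obtain ⟨c, hc⟩ := h.dvd i
    have q0 : (Q i : ℝ) ≠ 0 := by exact_mod_cast (h.pos i).ne'
    have c0 : c ≠ 0 := by
      rintro rfl
      have := h.pos (i + 1)
      rw [hc] at this
      simp at this
    have c0' : (c : ℝ) ≠ 0 := by exact_mod_cast c0
    have e : Q (i + 1) = Q i * (2 * Q i * c) := by rw [hc]; ring
    refine ⟨p * (2 * Q i * c) + 1, ?_, ?_⟩
    · have hA : (p * (2 * Q i * c) + 1).Coprime (2 * Q i * c) := by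
        rw [add_comm]; exact (Nat.coprime_add_mul_right_left 1 _ p).2 (Nat.coprime_one_left _)
      rw [e]
      exact Nat.Coprime.mul_right (hA.coprime_dvd_right ⟨2 * c, by ring⟩) hA
    · rw [angleApprox, Finset.sum_range_succ, ← angleApprox, hp, e]
      push_cast
      field_simp

theorem periodic (h : Tower Q X) (i : ℕ) : Function.Periodic (X i) (1 / (Q i : ℝ)) := by
  intro x
  have q0 : (Q i : ℝ) ≠ 0 := by exact_mod_cast (h.pos i).ne'
  have e : x + 1 / (Q i : ℝ) = x + 1 / (2 * Q i) + 1 / (2 * Q i) := by field_simp; ring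
  rw [e, h.anti, h.anti, neg_neg]

theorem periodic_one (h : Tower Q X) (i : ℕ) : Function.Periodic (X i) 1 := by
  have := (h.periodic i).nat_mul (Q i)
  have q0 : (Q i : ℝ) ≠ 0 := by exact_mod_cast (h.pos i).ne'
  rwa [mul_one_div_cancel q0] at this

/-- `X i` is invariant under the rational rotation by `angleApprox Q i`. -/
theorem add_mul_angleApprox (h : Tower Q X) (i n : ℕ) (x : ℝ) :
    X i (x + n * angleApprox Q i) = X i x := by
  obtain ⟨p, -, hp⟩ := h.exists_coprime i
  have e : (n : ℝ) * angleApprox Q i = ((n * p : ℕ) : ℝ) * (1 / Q i) := by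
    rw [hp]; push_cast; ring
  rw [e]
  exact (h.periodic i).nat_mul (n * p) x

/-- Antiperiodicity kills the sums of `X j` over the orbits of the later rational rotations. -/
theorem sum_block_eq_zero (h : Tower Q X) {i j : ℕ} (hij : j < i) (x : ℝ) :
    ∑ n ∈ Finset.range (Q i), X j (x + n * angleApprox Q i) = 0 := by
  obtain ⟨p, hpq, hp⟩ := h.exists_coprime i
  rw [hp, sum_range_coprime (h.periodic_one j) (h.pos i) hpq]
  obtain ⟨d, hd⟩ := h.two_mul_dvd hij
  have q0 : (Q j : ℝ) ≠ 0 := by exact_mod_cast (h.pos j).ne'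
  have d0 : (d : ℝ) ≠ 0 := by
    have := h.pos i
    rw [hd] at this
    exact_mod_cast (Nat.pos_of_mul_pos_left this).ne'
  have e : (d : ℝ) / Q i = 1 / (2 * Q j) := by rw [hd]; push_cast; field_simp
  have h1 := sum_range_shift_nat (h.periodic_one j) (h.pos i) d x
  have h2 : ∀ n : ℕ, X j (x + d / Q i + n / Q i) = -X j (x + n / Q i) := by
    intro n
    rw [← h.anti j, e]; congr 1; ring
  simp only [h2, Finset.sum_neg_distrib] at h1
  linarith

/-- The sum `∑ X i`. -/
def total (X : ℕ → ℝ → ℝ) (x : ℝ) : ℝ := ∑' i, X i x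

theorem bound' (h : Tower Q X) (i : ℕ) (x : ℝ) : |X i x| ≤ (1 / 2) ^ (i + 4) := by
  refine (h.bound i x).trans (div_le_self (by positivity) ?_)
  exact_mod_cast h.pos i

theorem summable_half : Summable fun i : ℕ => (1 / 2 : ℝ) ^ (i + 4) :=
  (summable_nat_add_iff 4).2 summable_geometric_two

theorem summable (h : Tower Q X) (x : ℝ) : Summable fun i => X i x :=
  Summable.of_norm_bounded summable_half fun i => h.bound' i x

theorem total_periodic (h : Tower Q X) : Function.Periodic (total X) 1 := by
  intro x
  simp only [total]
  exact tsum_congr fun i => h.periodic_one i x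

theorem sum_half_le (n : ℕ) : ∑ i ∈ Finset.range n, (1 / 2 : ℝ) ^ (i + 4) ≤ 1 / 8 := by
  have h1 : ∀ n : ℕ, ∑ i ∈ Finset.range n, (1 / 2 : ℝ) ^ (i + 4) = 1 / 8 - 1 / 8 * (1 / 2) ^ n := by
    intro n
    induction n with
    | zero => simp
    | succ n ih => rw [Finset.sum_range_succ, ih]; ring
  rw [h1]
  have : (0 : ℝ) < (1 / 2) ^ n := by positivity
  linarith

theorem abs_total_le (h : Tower Q X) (x : ℝ) : |total X x| ≤ 1 / 8 := by
  refine (norm_tsum_le_tsum_norm (h.summable x).norm).trans ?_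
  refine (h.summable x).norm.tsum_le_of_sum_range_le fun n => ?_
  exact (Finset.sum_le_sum fun i _ => h.bound' i x).trans (sum_half_le n)

/-- The sum of the terms of index less than `i`. -/
def low (X : ℕ → ℝ → ℝ) (i : ℕ) (x : ℝ) : ℝ := ∑ j ∈ Finset.range i, X j x

theorem low_lip (h : Tower Q X) (i : ℕ) (x y : ℝ) : |low X i x - low X i y| ≤ 1 / 8 * |x - y| := by
  rw [low, low, ← Finset.sum_sub_distrib]
  refine (Finset.abs_sum_le_sum_abs _ _).trans
    ((Finset.sum_le_sum fun j _ => h.lip j x y).trans ?_)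
  rw [← Finset.sum_mul]
  gcongr
  exact sum_half_le i

theorem sum_low_eq_zero (h : Tower Q X) (i : ℕ) (x : ℝ) :
    ∑ n ∈ Finset.range (Q i), low X i (x + n * angleApprox Q i) = 0 := by
  simp only [low]
  rw [Finset.sum_comm]
  exact Finset.sum_eq_zero fun j hj => h.sum_block_eq_zero (Finset.mem_range.1 hj) x

/-- The terms of index greater than `i` are of size `1 / Q (i + 1)`. -/
theorem abs_total_sub_le (h : Tower Q X) (i : ℕ) (x : ℝ) :
    |total X x - low X i x - X i x| ≤ 1 / Q (i + 1) := by
  have h1 := (h.summable x).sum_add_tsum_nat_add (i + 1)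
  rw [Finset.sum_range_succ] at h1
  have h2 : total X x - low X i x - X i x = ∑' k, X (k + (i + 1)) x := by
    rw [total, ← h1, low]; ring
  have hs : Summable fun k => X (k + (i + 1)) x := (summable_nat_add_iff (i + 1)).2 (h.summable x)
  have q0 : (0 : ℝ) < Q (i + 1) := by exact_mod_cast h.pos _
  rw [h2]
  refine (norm_tsum_le_tsum_norm hs.norm).trans (hs.norm.tsum_le_of_sum_range_le fun n => ?_)
  calc ∑ k ∈ Finset.range n, ‖X (k + (i + 1)) x‖
      ≤ ∑ k ∈ Finset.range n, (1 / 2) ^ (k + 4) * (1 / (Q (i + 1) : ℝ)) := by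
        refine Finset.sum_le_sum fun k _ => (h.bound _ x).trans ?_
        rw [div_eq_mul_one_div]
        refine mul_le_mul ?_ ?_ (by positivity) (by positivity)
        · exact pow_le_pow_of_le_one (by norm_num) (by norm_num) (by omega)
        · refine one_div_le_one_div_of_le q0 ?_
          exact_mod_cast Nat.le_of_dvd (h.pos _) (h.dvd_of_le (by omega))
    _ ≤ 1 / 8 * (1 / (Q (i + 1) : ℝ)) := by
        rw [← Finset.sum_mul]; gcongr; exact sum_half_le n
    _ ≤ 1 / Q (i + 1) := by
        have : 0 < 1 / (Q (i + 1) : ℝ) := by positivity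
        linarith

/-- The Birkhoff sum of `total X` along the rotation by `angle Q`. -/
def birk (Q : ℕ → ℕ) (X : ℕ → ℝ → ℝ) (m : ℕ) (x : ℝ) : ℝ :=
  ∑ n ∈ Finset.range m, total X (x + n * angle Q)

theorem abs_birk_sub_le (h : Tower Q X) (i m : ℕ) (x : ℝ) :
    |birk Q X m x - ∑ n ∈ Finset.range m, low X i (x + n * angle Q) -
      ∑ n ∈ Finset.range m, X i (x + n * angle Q)| ≤ m / Q (i + 1) := by
  rw [birk, ← Finset.sum_sub_distrib, ← Finset.sum_sub_distrib]
  refine (Finset.abs_sum_le_sum_abs _ _).trans ((Finset.sum_le_card_nsmul _ _ _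
    fun n _ => h.abs_total_sub_le i _).trans ?_)
  rw [Finset.card_range, nsmul_eq_mul, mul_one_div]

/-- Along a multiple `N` of the denominator `Q i`, the Birkhoff sum is tiny wherever `X i`
vanishes. -/
theorem abs_birk_le_of_flat (h : Tower Q X) {i N : ℕ} (hN : Q i ∣ N) {x : ℝ} (hx : X i x = 0) :
    |birk Q X N x| ≤ 2 * (N : ℝ) ^ 2 / Q (i + 1) := by
  obtain ⟨k, rfl⟩ := hN
  rcases Nat.eq_zero_or_pos k with rfl | hk
  · simp [birk]
  have q0 : (0 : ℝ) < Q (i + 1) := by exact_mod_cast h.pos _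
  have ha := h.abs_angle_sub_le i
  set N : ℕ := Q i * k with hNdef
  have N1 : (1 : ℝ) ≤ N := by exact_mod_cast Nat.mul_pos (h.pos i) hk
  have h1 := h.abs_birk_sub_le i N x
  have h2 := abs_sum_range_sub_le (h.low_lip i) ha N x
  rw [sum_range_block_mul (h.sum_low_eq_zero i), sub_zero] at h2
  have h3 := abs_sum_range_sub_le (h.lip i) ha N x
  simp only [h.add_mul_angleApprox, hx, Finset.sum_const_zero, sub_zero] at h3
  have h4 : ((1 : ℝ) / 2) ^ (i + 4) ≤ 1 / 8 := by
    have := pow_le_pow_of_le_one (a := (1 / 2 : ℝ)) (by norm_num) (by norm_num)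
      (show 3 ≤ i + 4 by omega)
    norm_num at this ⊢
    linarith
  have h5 : (N : ℝ) * ((1 / 2) ^ (i + 4) * (N * (2 / Q (i + 1)))) ≤
      N * (1 / 8 * (N * (2 / Q (i + 1)))) := by gcongr
  have e1 : (N : ℝ) * (1 / 8 * (N * (2 / Q (i + 1)))) = 1 / 4 * ((N : ℝ) ^ 2 / Q (i + 1)) := by ring
  have e2 : (N : ℝ) / Q (i + 1) ≤ (N : ℝ) ^ 2 / Q (i + 1) := by gcongr; nlinarith
  have e3 : 0 ≤ (N : ℝ) ^ 2 / Q (i + 1) := by positivity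
  rw [e1] at h2 h5
  rw [mul_div_assoc]
  rw [abs_le] at *
  constructor <;> linarith

theorem abs_sin_add_sub_le {A A₀ d u : ℝ} (hd : |A - A₀| ≤ d) :
    |Real.sin (A + u) - Real.sin A - u * Real.cos A₀| ≤ (|u| + d) * |u| := by
  have hc : ∀ v, |Real.cos (A + v) - Real.cos A₀| ≤ |v| + d := by
    intro v
    have := Real.abs_cos_sub_cos_le (A + v) A₀
    refine this.trans ?_
    have e : A + v - A₀ = v + (A - A₀) := by ring
    rw [e]
    exact (abs_add_le _ _).trans (by linarith)
  have hder : ∀ v, HasDerivAt (fun v => Real.sin (A + v) - v * Real.cos A₀)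
      (Real.cos (A + v) - Real.cos A₀) v := by
    intro v
    have h1 := (Real.hasDerivAt_sin (A + v)).comp_const_add A v
    have h2 := h1.sub ((hasDerivAt_id v).mul_const (Real.cos A₀))
    rw [one_mul] at h2
    exact h2
  have := Convex.norm_image_sub_le_of_norm_deriv_le (s := Metric.closedBall (0 : ℝ) |u|)
    (f := fun v => Real.sin (A + v) - v * Real.cos A₀) (C := |u| + d) (x := 0) (y := u)
    (fun v _ => (hder v).differentiableAt)
    (fun v hv => by
      rw [(hder v).deriv]
      refine (hc v).trans ?_
      have : |v| ≤ |u| := by simpa using hv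
      linarith)
    (convex_closedBall _ _) (by simp) (by simp)
  simp only [Real.norm_eq_abs, add_zero, zero_mul, sub_zero] at this
  refine le_trans (le_of_eq ?_) this
  congr 1; ring

/-- The Birkhoff sums are almost affine, with large slope, on short intervals on which `X i` is a
pure sine wave. -/
theorem abs_birk_stretch (h : Tower Q X) {i m : ℕ} {B x r : ℝ} (hB : 0 ≤ B) (hr : 0 ≤ r)
    (hsin : ∀ x', |x' - x| ≤ r + m * (2 / Q (i + 1)) →
      X i x' = B * Real.sin (2 * Real.pi * Q i * x')) :
    |birk Q X m (x + r) - birk Q X m x -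
        m * B * (2 * Real.pi * Q i * Real.cos (2 * Real.pi * Q i * x)) * r| ≤
      Q i * r + 3 * (m : ℝ) ^ 2 / Q (i + 1) +
        m * B * ((2 * Real.pi * Q i) ^ 2 * (r * (r + m * (2 / Q (i + 1))))) := by
  rcases Nat.eq_zero_or_pos m with rfl | hm
  · simp [birk]; positivity
  have m1 : (1 : ℝ) ≤ m := by exact_mod_cast hm
  have q0 : (0 : ℝ) < Q (i + 1) := by exact_mod_cast h.pos _
  have qi : (0 : ℝ) < Q i := by exact_mod_cast h.pos _
  have ha := h.abs_angle_sub_le i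
  set w : ℝ := 2 * Real.pi * Q i with hw
  have w0 : 0 < w := by positivity
  -- the tail
  have t1 := h.abs_birk_sub_le i m (x + r)
  have t2 := h.abs_birk_sub_le i m x
  -- the low part
  set ψ : ℝ → ℝ := fun v => low X i (v + r) - low X i v with hψ
  have hψlip : ∀ u v, |ψ u - ψ v| ≤ 1 / 4 * |u - v| := by
    intro u v
    have h1 := h.low_lip i (u + r) (v + r)
    have h2 := h.low_lip i u v
    have e : ψ u - ψ v = (low X i (u + r) - low X i (v + r)) - (low X i u - low X i v) := by
      simp only [hψ]; ring
    rw [e]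
    rw [add_sub_add_right_eq_sub] at h1
    exact (abs_sub _ _).trans (by linarith)
  have hψb : ∀ v, |ψ v| ≤ r := by
    intro v
    refine (h.low_lip i (v + r) v).trans ?_
    rw [add_sub_cancel_left, abs_of_nonneg hr]
    linarith
  have hψ0 : ∀ v, ∑ n ∈ Finset.range (Q i), ψ (v + n * angleApprox Q i) = 0 := by
    intro v
    simp only [hψ, Finset.sum_sub_distrib]
    rw [h.sum_low_eq_zero i v, sub_zero, ← h.sum_low_eq_zero i (v + r)]
    refine Finset.sum_congr rfl fun n _ => ?_
    congr 1; ring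
  have l1 := abs_sum_range_le_of_block (h.pos i) hψb hψ0 m x
  have l2 := abs_sum_range_sub_le hψlip ha m x
  have l3 : ∑ n ∈ Finset.range m, ψ (x + n * angle Q) =
      ∑ n ∈ Finset.range m, low X i (x + r + n * angle Q) -
        ∑ n ∈ Finset.range m, low X i (x + n * angle Q) := by
    rw [← Finset.sum_sub_distrib]
    refine Finset.sum_congr rfl fun n _ => ?_
    simp only [hψ]; congr 2; ring
  -- the sine wave
  have s1 : |∑ n ∈ Finset.range m, X i (x + r + n * angle Q) -
      ∑ n ∈ Finset.range m, X i (x + n * angle Q) - m * B * (w * Real.cos (w * x)) * r| ≤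
      m * (B * (w ^ 2 * (r * (r + m * (2 / Q (i + 1)))))) := by
    have e : m * B * (w * Real.cos (w * x)) * r =
        ∑ n ∈ Finset.range m, B * (w * Real.cos (w * x)) * r := by
      rw [Finset.sum_const, Finset.card_range, nsmul_eq_mul]; ring
    rw [e, ← Finset.sum_sub_distrib, ← Finset.sum_sub_distrib]
    refine (Finset.abs_sum_le_sum_abs _ _).trans ((Finset.sum_le_card_nsmul _ _
      (B * (w ^ 2 * (r * (r + m * (2 / Q (i + 1)))))) fun n hn => ?_).trans ?_)
    · set θ : ℝ := n * (angle Q - angleApprox Q i) with hθ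
      have hθb : |θ| ≤ m * (2 / Q (i + 1)) := by
        rw [hθ, abs_mul, Nat.abs_cast]
        gcongr
        exact (Finset.mem_range.1 hn).le
      have r1 : X i (x + r + n * angle Q) = X i (x + r + θ) := by
        rw [← h.add_mul_angleApprox i n (x + r + θ)]; congr 1; rw [hθ]; ring
      have r2 : X i (x + n * angle Q) = X i (x + θ) := by
        rw [← h.add_mul_angleApprox i n (x + θ)]; congr 1; rw [hθ]; ring
      have c1 : |x + r + θ - x| ≤ r + m * (2 / Q (i + 1)) := by
        have : x + r + θ - x = r + θ := by ring
        rw [this]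
        refine (abs_add_le _ _).trans ?_
        rw [abs_of_nonneg hr]; linarith
      have c2 : |x + θ - x| ≤ r + m * (2 / Q (i + 1)) := by
        rw [add_sub_cancel_left]; linarith
      rw [r1, r2, hsin _ c1, hsin _ c2]
      have hd : |w * (x + θ) - w * x| ≤ w * (m * (2 / Q (i + 1))) := by
        have : w * (x + θ) - w * x = w * θ := by ring
        rw [this, abs_mul, abs_of_pos w0]; gcongr
      have key := abs_sin_add_sub_le (u := w * r) hd
      rw [abs_of_nonneg (by positivity : 0 ≤ w * r)] at key
      have e1 : w * (x + r + θ) = w * (x + θ) + w * r := by ring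
      have e2 : B * Real.sin (w * (x + r + θ)) - B * Real.sin (w * (x + θ)) -
          B * (w * Real.cos (w * x)) * r =
          B * (Real.sin (w * (x + θ) + w * r) - Real.sin (w * (x + θ)) -
            w * r * Real.cos (w * x)) := by rw [e1]; ring
      rw [e2, abs_mul, abs_of_nonneg hB]
      refine mul_le_mul_of_nonneg_left (key.trans (le_of_eq ?_)) hB
      ring
    · rw [Finset.card_range, nsmul_eq_mul]
  have e3 : (m : ℝ) / Q (i + 1) ≤ (m : ℝ) ^ 2 / Q (i + 1) := by gcongr; nlinarith
  have e4 : (m : ℝ) * (1 / 4 * (m * (2 / Q (i + 1)))) = 1 / 2 * ((m : ℝ) ^ 2 / Q (i + 1)) := by ring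
  have e5 : 0 ≤ (m : ℝ) ^ 2 / Q (i + 1) := by positivity
  have e6 : (m : ℝ) * (B * (w ^ 2 * (r * (r + m * (2 / Q (i + 1)))))) =
      m * B * (w ^ 2 * (r * (r + m * (2 / Q (i + 1))))) := by ring
  rw [e4] at l2
  rw [e6] at s1
  rw [l3] at l2
  rw [mul_div_assoc]
  generalize m * B * (w ^ 2 * (r * (r + m * (2 / Q (i + 1))))) = Z at *
  generalize m * B * (w * Real.cos (w * x)) * r = Y at *
  have l4 : |(∑ n ∈ Finset.range m, low X i (x + r + n * angle Q) -
        ∑ n ∈ Finset.range m, low X i (x + n * angle Q))| ≤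
      Q i * r + 1 / 2 * ((m : ℝ) ^ 2 / Q (i + 1)) := by
    rw [abs_le] at l1 l2 ⊢
    constructor <;> linarith
  clear l1 l2 l3
  rw [abs_le] at *
  constructor <;> linarith

end Tower

/-! ### The profile of the ceiling function -/

/-- A sine wave flattened near its zeros: it vanishes where `L * |sin| ≤ 7` and agrees with the sine
where `L * |sin| ≥ 10`. -/
def profile (L u : ℝ) : ℝ :=
  Real.sin (2 * Real.pi * u) *
    Real.smoothTransition ((L * Real.sin (2 * Real.pi * u) / 7) ^ 2 - 1)

theorem profile_contDiff (L : ℝ) : ContDiff ℝ ∞ (profile L) := by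
  have h : ContDiff ℝ ∞ fun u : ℝ => Real.sin (2 * Real.pi * u) :=
    Real.contDiff_sin.comp (contDiff_const.mul contDiff_id)
  refine h.mul (Real.smoothTransition.contDiff.comp ?_)
  exact (((contDiff_const.mul h).div_const _).pow 2).sub contDiff_const

theorem profile_add_half (L u : ℝ) : profile L (u + 1 / 2) = -profile L u := by
  have h : Real.sin (2 * Real.pi * (u + 1 / 2)) = -Real.sin (2 * Real.pi * u) := by
    rw [show 2 * Real.pi * (u + 1 / 2) = 2 * Real.pi * u + Real.pi by ring, Real.sin_add_pi]
  unfold profile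
  rw [h, show (L * -Real.sin (2 * Real.pi * u) / 7) ^ 2 =
    (L * Real.sin (2 * Real.pi * u) / 7) ^ 2 by ring]
  ring

theorem profile_periodic (L : ℝ) : Function.Periodic (profile L) 1 := by
  intro u
  rw [show u + 1 = u + 1 / 2 + 1 / 2 by ring, profile_add_half, profile_add_half, neg_neg]

theorem profile_eq_zero {L u : ℝ} (h : |L * Real.sin (2 * Real.pi * u)| ≤ 7) : profile L u = 0 := by
  unfold profile
  rw [Real.smoothTransition.zero_of_nonpos, mul_zero]
  have := sq_le_sq' (abs_le.1 h).1 (abs_le.1 h).2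
  rw [div_pow]
  linarith

theorem profile_eq_sin {L u : ℝ} (h : 10 ≤ |L * Real.sin (2 * Real.pi * u)|) :
    profile L u = Real.sin (2 * Real.pi * u) := by
  unfold profile
  rw [Real.smoothTransition.one_of_one_le, mul_one]
  have h2 : (10 : ℝ) ^ 2 ≤ (L * Real.sin (2 * Real.pi * u)) ^ 2 := by
    rw [← sq_abs (L * _)]; gcongr
  rw [div_pow]
  linarith

theorem profile_eq_zero_of_round {L u : ℝ} (hL : 0 < L) (h : |u - round u| ≤ 1 / L) :
    profile L u = 0 := by
  apply profile_eq_zero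
  have e : Real.sin (2 * Real.pi * u) = Real.sin (2 * Real.pi * (u - round u)) := by
    rw [show 2 * Real.pi * (u - round u) = 2 * Real.pi * u - (round u : ℤ) * (2 * Real.pi) by ring,
      Real.sin_sub_int_mul_two_pi]
  rw [e, abs_mul, abs_of_pos hL]
  have h1 : |Real.sin (2 * Real.pi * (u - round u))| ≤ 2 * Real.pi * (1 / L) := by
    refine Real.abs_sin_le_abs.trans ?_
    rw [abs_mul, abs_of_pos (by positivity)]
    gcongr
  calc L * |Real.sin (2 * Real.pi * (u - round u))| ≤ L * (2 * Real.pi * (1 / L)) := by gcongr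
    _ = 2 * Real.pi := by field_simp
    _ ≤ 7 := by linarith [Real.pi_lt_d2]

/-- A smooth periodic function has bounded derivatives of all orders. -/
theorem exists_bound_iteratedFDeriv {f : ℝ → ℝ} (hf : ContDiff ℝ ∞ f) {c : ℝ} (hc : 0 < c)
    (hp : Function.Periodic f c) (i : ℕ) : ∃ C, ∀ x, ‖iteratedFDeriv ℝ i f x‖ ≤ C := by
  have hcont : Continuous fun x => ‖iteratedFDeriv ℝ i f x‖ :=
    (hf.continuous_iteratedFDeriv (by exact_mod_cast le_top)).norm
  have hper : Function.Periodic (fun x => ‖iteratedFDeriv ℝ i f x‖) c := by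
    intro x
    change ‖_‖ = ‖_‖
    rw [← iteratedFDeriv_comp_add_right]
    congr 2
    ext z
    rw [hp z]
  obtain ⟨C, hC⟩ := isCompact_Icc.exists_bound_of_continuousOn
    (s := Set.Icc (0 : ℝ) c) hcont.continuousOn
  refine ⟨C, fun x => ?_⟩
  obtain ⟨y, hy, e⟩ := hper.exists_mem_Ico₀ hc x
  have := hC y ⟨hy.1, hy.2.le⟩
  rw [norm_norm] at this
  exact e.le.trans this

theorem exists_profile_bound (L : ℝ) (q : ℕ) (i : ℕ) :
    ∃ C, 0 ≤ C ∧ ∀ x, ‖iteratedFDeriv ℝ i (fun x => profile L (q * x)) x‖ ≤ C := by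
  obtain ⟨C, hC⟩ := exists_bound_iteratedFDeriv (f := fun x => profile L (q * x))
    ((profile_contDiff L).comp (contDiff_const.mul contDiff_id)) one_pos (fun x => by
      have := (profile_periodic L).nat_mul q (q * x)
      rw [mul_one, ← mul_add_one] at this
      exact this) i
  exact ⟨C, (norm_nonneg _).trans (hC 0), hC⟩

/-- A bound for the derivative of order `i` of `x ↦ profile L (q * x)`. -/
def profileBound (L : ℝ) (q i : ℕ) : ℝ := (exists_profile_bound L q i).choose

theorem profileBound_nonneg (L : ℝ) (q i : ℕ) : 0 ≤ profileBound L q i :=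
  (exists_profile_bound L q i).choose_spec.1

theorem le_profileBound (L : ℝ) (q i : ℕ) (x : ℝ) :
    ‖iteratedFDeriv ℝ i (fun x => profile L (q * x)) x‖ ≤ profileBound L q i :=
  (exists_profile_bound L q i).choose_spec.2 x

/-! ### Frequencies and amplitudes -/

/-- The inverse width of the flat part of the profile at stage `k`; it tends to infinity so slowly
that `∑ 1 / (invWidth (2 i) * invWidth (2 i + 1))` diverges. -/
def invWidth (k : ℕ) : ℕ := Nat.sqrt k + 1

/-- The amplitude at stage `k` and frequency `q`: so small that the derivatives of order at most
`k + 1` of the `k`-th term are bounded by `(1 / 2) ^ (k + 4) / q`. -/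
def ampOf (k q : ℕ) : ℝ :=
  (1 / 2) ^ (k + 4) / q / (1 + ∑ i ∈ Finset.range (k + 2), profileBound (invWidth k) q i)

/-- The time from which the stage `k` of amplitude `b` mixes: `b` times this time tends to
infinity. -/
def startOf (k : ℕ) (b : ℝ) : ℝ := (k + 1) / b

/-- The frequencies. The next frequency is a multiple of `2 * freq k ^ 2`, so that `freq k` is the
denominator of a partial sum of the angle and later rotations kill the sums of the `k`-th term, and
of `freq k * invWidth k`, so that later terms are invariant under the translations moving the flat
part of the `k`-th term around. It is at least `(k + 1) * start k ^ 2 * freq k`, which keeps stage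
`k - 1` stretching until `start k`, and `exp (freq k ^ 3)`, which makes the returns
super-exponentially close. -/
def freq : ℕ → ℕ
  | 0 => 1
  | k + 1 => 2 * freq k ^ 2 * (invWidth k * (k + 1) * ⌈startOf k (ampOf k (freq k))⌉₊ ^ 2 *
      ⌈Real.exp ((freq k : ℝ) ^ 3)⌉₊)

/-- The amplitudes. -/
def amp (k : ℕ) : ℝ := ampOf k (freq k)

/-- The time from which stage `k` mixes. -/
def start (k : ℕ) : ℝ := startOf k (amp k)

/-- The `k`-th term of the ceiling function. -/
def wave (k : ℕ) (x : ℝ) : ℝ := amp k * profile (invWidth k) (freq k * x)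

theorem ampOf_pos (k : ℕ) {q : ℕ} (hq : 0 < q) : 0 < ampOf k q := by
  have : 0 ≤ ∑ i ∈ Finset.range (k + 2), profileBound (invWidth k) q i :=
    Finset.sum_nonneg fun i _ => profileBound_nonneg _ _ _
  unfold ampOf
  positivity

theorem freq_pos (k : ℕ) : 0 < freq k := by
  induction k with
  | zero => exact one_pos
  | succ k ih =>
    have h1 : 0 < startOf k (ampOf k (freq k)) := div_pos (by positivity) (ampOf_pos k ih)
    have h2 : 0 < ⌈startOf k (ampOf k (freq k))⌉₊ := Nat.ceil_pos.2 h1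
    have h3 : 0 < ⌈Real.exp ((freq k : ℝ) ^ 3)⌉₊ := Nat.ceil_pos.2 (Real.exp_pos _)
    have h4 : 0 < invWidth k := Nat.succ_pos _
    rw [freq]
    positivity

theorem amp_pos (k : ℕ) : 0 < amp k := ampOf_pos k (freq_pos k)

theorem start_pos (k : ℕ) : 0 < start k := div_pos (by positivity) (amp_pos k)

theorem start_mul_amp (k : ℕ) : start k * amp k = k + 1 := by
  unfold start startOf
  exact div_mul_cancel₀ _ (amp_pos k).ne'

theorem freq_succ (k : ℕ) : freq (k + 1) = 2 * freq k ^ 2 * (invWidth k * (k + 1) *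
    ⌈start k⌉₊ ^ 2 * ⌈Real.exp ((freq k : ℝ) ^ 3)⌉₊) := rfl

theorem two_mul_sq_dvd_freq (k : ℕ) : 2 * freq k ^ 2 ∣ freq (k + 1) :=
  Dvd.intro _ (freq_succ k).symm

theorem freq_mul_invWidth_dvd (k : ℕ) : freq k * invWidth k ∣ freq (k + 1) := by
  rw [freq_succ]
  exact ⟨2 * freq k * ((k + 1) * ⌈start k⌉₊ ^ 2 * ⌈Real.exp ((freq k : ℝ) ^ 3)⌉₊), by ring⟩

theorem exp_le_freq_succ (k : ℕ) : Real.exp ((freq k : ℝ) ^ 3) ≤ freq (k + 1) := by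
  refine (Nat.le_ceil _).trans ?_
  have h0 := freq_pos (k + 1)
  have h1 : ⌈Real.exp ((freq k : ℝ) ^ 3)⌉₊ ∣ freq (k + 1) := by
    rw [freq_succ, ← mul_assoc]
    exact Dvd.intro_left _ rfl
  exact Nat.cast_le.2 (Nat.le_of_dvd h0 h1)

theorem start_sq_le_freq_succ (k : ℕ) :
    (k + 1) * start k ^ 2 * freq k ≤ (freq (k + 1) : ℝ) := by
  have h0 := freq_pos (k + 1)
  have h1 : (k + 1) * ⌈start k⌉₊ ^ 2 * freq k ≤ freq (k + 1) :=
    Nat.le_of_dvd h0 ⟨2 * freq k * (invWidth k * ⌈Real.exp ((freq k : ℝ) ^ 3)⌉₊), by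
      rw [freq_succ]; ring⟩
  have h2 : (((k + 1) * ⌈start k⌉₊ ^ 2 * freq k : ℕ) : ℝ) ≤ (freq (k + 1) : ℝ) :=
    Nat.cast_le.2 h1
  push_cast at h2
  refine le_trans ?_ h2
  have := (start_pos k).le
  gcongr
  exact Nat.le_ceil _

theorem two_mul_freq_le (k : ℕ) : 2 * freq k ≤ freq (k + 1) :=
  Nat.le_of_dvd (freq_pos _) ((Dvd.intro (freq k) (by ring)).trans (two_mul_sq_dvd_freq k))

theorem freq_strictMono : StrictMono freq :=
  strictMono_nat_of_lt_succ fun k => by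
    have := two_mul_freq_le k
    have := freq_pos k
    omega

theorem freq_dvd_of_le {i j : ℕ} (hij : i ≤ j) : freq i ∣ freq j := by
  induction j, hij using Nat.le_induction with
  | base => exact dvd_rfl
  | succ j _ ih =>
    exact ih.trans ((Dvd.intro_left (2 * freq j) (by ring)).trans (two_mul_sq_dvd_freq j))

theorem wave_contDiff (k : ℕ) : ContDiff ℝ ∞ (wave k) :=
  contDiff_const.mul ((profile_contDiff _).comp (contDiff_const.mul contDiff_id))

theorem norm_iteratedFDeriv_wave_le {i k : ℕ} (hi : i < k + 2) (x : ℝ) :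
    ‖iteratedFDeriv ℝ i (wave k) x‖ ≤ (1 / 2) ^ (k + 4) / freq k := by
  have q0 : (0 : ℝ) < freq k := by exact_mod_cast freq_pos k
  have hc : ContDiff ℝ i fun x => profile (invWidth k) (freq k * x) :=
    ((profile_contDiff _).comp (contDiff_const.mul contDiff_id)).of_le (by exact_mod_cast le_top)
  have e : wave k = amp k • fun x => profile (invWidth k) (freq k * x) := rfl
  rw [e, iteratedFDeriv_const_smul_apply hc.contDiffAt, norm_smul, Real.norm_eq_abs,
    abs_of_pos (amp_pos k)]
  have h1 := le_profileBound (invWidth k) (freq k) i x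
  have h2 : profileBound (invWidth k) (freq k) i ≤
      ∑ i ∈ Finset.range (k + 2), profileBound (invWidth k) (freq k) i :=
    Finset.single_le_sum (f := fun i => profileBound (invWidth k) (freq k) i)
      (fun j _ => profileBound_nonneg _ _ j) (Finset.mem_range.2 hi)
  have h3 : 0 ≤ ∑ i ∈ Finset.range (k + 2), profileBound (invWidth k) (freq k) i :=
    Finset.sum_nonneg fun i _ => profileBound_nonneg _ _ _
  unfold amp ampOf
  rw [div_mul_eq_mul_div, div_le_iff₀ (by linarith)]
  gcongr
  linarith

theorem abs_wave_le (k : ℕ) (x : ℝ) : |wave k x| ≤ (1 / 2) ^ (k + 4) / freq k := by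
  have := norm_iteratedFDeriv_wave_le (i := 0) (k := k) (by omega) x
  rwa [norm_iteratedFDeriv_zero] at this

theorem wave_lip (k : ℕ) (x y : ℝ) :
    |wave k x - wave k y| ≤ (1 / 2) ^ (k + 4) * |x - y| := by
  have q1 : (1 : ℝ) ≤ freq k := by exact_mod_cast freq_pos k
  refine Convex.norm_image_sub_le_of_norm_deriv_le (s := Set.univ) (f := wave k)
    (fun v _ => ((wave_contDiff k).differentiable (by simp)) v) (fun v _ => ?_) convex_univ
    (Set.mem_univ y) (Set.mem_univ x)
  have := norm_iteratedFDeriv_wave_le (i := 1) (k := k) (by omega) v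
  rw [norm_iteratedFDeriv_one, ← norm_deriv_eq_norm_fderiv] at this
  exact this.trans (div_le_self (by positivity) q1)

theorem wave_anti (k : ℕ) (x : ℝ) : wave k (x + 1 / (2 * freq k)) = -wave k x := by
  have q0 : (freq k : ℝ) ≠ 0 := by exact_mod_cast (freq_pos k).ne'
  unfold wave
  rw [show (freq k : ℝ) * (x + 1 / (2 * freq k)) = freq k * x + 1 / 2 by field_simp,
    profile_add_half, mul_neg]

/-- The frequencies of the coordinate `c`. -/
def freqOf (c i : ℕ) : ℕ := freq (2 * i + c)

/-- The terms of the coordinate `c`. -/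
def waveOf (c i : ℕ) : ℝ → ℝ := wave (2 * i + c)

theorem tower (c : ℕ) : Tower (freqOf c) (waveOf c) where
  pos i := freq_pos _
  dvd i := by
    have e : freqOf c (i + 1) = freq (2 * i + c + 1 + 1) := by unfold freqOf; congr 1; ring
    rw [e]
    exact (two_mul_sq_dvd_freq (2 * i + c)).trans (freq_dvd_of_le (by omega))
  anti i x := wave_anti _ x
  bound i x := (abs_wave_le _ x).trans (by
    unfold freqOf
    gcongr ?_ / _
    exact pow_le_pow_of_le_one (by norm_num) (by norm_num) (by omega))
  lip i x y := (wave_lip _ x y).trans (by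
    gcongr ?_ * _
    exact pow_le_pow_of_le_one (by norm_num) (by norm_num) (by omega))

theorem total_contDiff (c : ℕ) : ContDiff ℝ ∞ (Tower.total (waveOf c)) := by
  refine contDiff_tsum_of_eventually (v := fun _ i => (1 / 2 : ℝ) ^ (i + 4))
    (fun i => wave_contDiff _) (fun _ _ => Tower.summable_half) fun k _ => ?_
  rw [Nat.cofinite_eq_atTop]
  filter_upwards [eventually_ge_atTop k] with i hi x
  refine (norm_iteratedFDeriv_wave_le (by omega) x).trans ?_
  refine (div_le_self (by positivity) (by exact_mod_cast freq_pos _)).trans ?_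
  exact pow_le_pow_of_le_one (by norm_num) (by norm_num) (by omega)

/-! ### The flow -/

/-- The angle of the rotation in the coordinate `c`. -/
def rot (c : ℕ) : ℝ := angle (freqOf c)

/-- The part of the ceiling function depending on the coordinate `c`. -/
def part (c : ℕ) : UnitAddCircle → ℝ := (tower c).total_periodic.lift

theorem part_coe (c : ℕ) (x : ℝ) : part c (x : UnitAddCircle) = Tower.total (waveOf c) x :=
  Function.Periodic.lift_coe _ x

theorem abs_part_le (c : ℕ) (x : UnitAddCircle) : |part c x| ≤ 1 / 8 := by
  induction x using QuotientAddGroup.induction_on with | H x =>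
  exact (congrArg abs (part_coe c x)).le.trans ((tower c).abs_total_le x)

/-- The ceiling function. -/
def roof : Ceiling where
  toFun z := 1 + part 0 z.1 + part 1 z.2
  smooth' := by
    simp only [part_coe]
    exact (contDiff_const.add ((total_contDiff 0).comp contDiff_fst)).add
      ((total_contDiff 1).comp contDiff_snd)
  pos' z := by
    have h1 := abs_le.1 (abs_part_le 0 z.1)
    have h2 := abs_le.1 (abs_part_le 1 z.2)
    linarith

theorem roof_bounds (z : Torus2) : 1 / 2 ≤ roof z ∧ roof z ≤ 3 / 2 := by
  have h1 := abs_le.1 (abs_part_le 0 z.1)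
  have h2 := abs_le.1 (abs_part_le 1 z.2)
  change 1 / 2 ≤ 1 + part 0 z.1 + part 1 z.2 ∧ 1 + part 0 z.1 + part 1 z.2 ≤ 3 / 2
  constructor <;> linarith

/-! ### The fundamental domain -/

section Deck

variable {α α' : ℝ} {φ : Ceiling}

/-- The translation vector of the rotation. -/
def vec (α α' : ℝ) : Torus2 := ((α : UnitAddCircle), (α' : UnitAddCircle))

/-- The Birkhoff sums of the ceiling function. -/
def bsum (α α' : ℝ) (φ : Ceiling) (n : ℕ) (z : Torus2) : ℝ :=
  ∑ i ∈ Finset.range n, φ (z + i • vec α α')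

theorem glue_pow_apply (n : ℕ) (p : Torus2 × ℝ) :
    (glue (rotation α α') φ ^ n) p = (p.1 + n • vec α α', p.2 - bsum α α' φ n p.1) := by
  induction n with
  | zero => simp [bsum]
  | succ n ih =>
    rw [pow_succ', Equiv.Perm.mul_apply, ih]
    refine Prod.ext ?_ ?_
    · change p.1 + n • vec α α' + vec α α' = _
      rw [succ_nsmul, add_assoc]
    · change p.2 - bsum α α' φ n p.1 - φ (p.1 + n • vec α α') = p.2 - bsum α α' φ (n + 1) p.1
      rw [bsum, bsum, Finset.sum_range_succ]
      ring

theorem glue_zpow_add (i j : ℤ) (p : Torus2 × ℝ) :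
    (glue (rotation α α') φ ^ (i + j)) p =
      (glue (rotation α α') φ ^ i) ((glue (rotation α α') φ ^ j) p) := by
  rw [zpow_add, Equiv.Perm.mul_apply]

theorem glue_pow_snd_le {c : ℝ} (hc : ∀ z, c ≤ φ z) (n : ℕ) (p : Torus2 × ℝ) :
    ((glue (rotation α α') φ ^ n) p).2 ≤ p.2 - n * c := by
  rw [glue_pow_apply]
  have : (n : ℝ) * c ≤ bsum α α' φ n p.1 := by
    have := Finset.card_nsmul_le_sum (Finset.range n) (fun i => φ (p.1 + i • vec α α')) c
      fun i _ => hc _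
    rw [Finset.card_range, nsmul_eq_mul] at this
    exact this
  change p.2 - bsum α α' φ n p.1 ≤ _
  linarith

/-- The `i`-th iterate of the gluing map moves the second coordinate by at least `c |i|`. -/
theorem abs_mul_le_of_glue {c : ℝ} (hc : ∀ z, c ≤ φ z) (i : ℤ) (p : Torus2 × ℝ) :
    |(i : ℝ)| * c ≤ |p.2| + |((glue (rotation α α') φ ^ i) p).2| := by
  obtain ⟨n, rfl | rfl⟩ := i.eq_nat_or_neg
  · have := glue_pow_snd_le (α := α) (α' := α') hc n p
    rw [zpow_natCast]
    have h1 := le_abs_self p.2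
    have h2 := neg_abs_le ((glue (rotation α α') φ ^ n) p).2
    rw [Int.cast_natCast, Nat.abs_cast]
    linarith
  · set r := (glue (rotation α α') φ ^ (-(n : ℤ))) p with hr
    have e : (glue (rotation α α') φ ^ n) r = p := by
      rw [hr, ← zpow_natCast, ← glue_zpow_add]; simp
    have := glue_pow_snd_le (α := α) (α' := α') hc n r
    rw [e] at this
    have h1 := neg_abs_le p.2
    have h2 := le_abs_self r.2
    rw [Int.cast_neg, Int.cast_natCast, abs_neg, Nat.abs_cast]
    linarith

/-- The group `ℤ` of the deck transformations `glue ^ i` of `𝕋² × ℝ → M_φ`. -/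
def Deck (_ _ : ℝ) (_ : Ceiling) : Type := ℤ

instance : AddCommGroup (Deck α α' φ) := inferInstanceAs (AddCommGroup ℤ)

instance : Countable (Deck α α' φ) := inferInstanceAs (Countable ℤ)

instance : AddAction (Deck α α' φ) (Torus2 × ℝ) where
  vadd i p := (glue (rotation α α') φ ^ (show ℤ from i)) p
  zero_vadd p := by
    change (glue (rotation α α') φ ^ (0 : ℤ)) p = p
    simp
  add_vadd i j p := glue_zpow_add (show ℤ from i) (show ℤ from j) p

instance : (volume : Measure Torus2).IsAddHaarMeasure :=
  inferInstanceAs (Measure.prod (volume : Measure UnitAddCircle)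
    (volume : Measure UnitAddCircle)).IsAddHaarMeasure

instance : IsProbabilityMeasure (volume : Measure UnitAddCircle) :=
  ⟨UnitAddCircle.measure_univ⟩

instance : IsProbabilityMeasure (volume : Measure Torus2) :=
  inferInstanceAs (IsProbabilityMeasure (Measure.prod (volume : Measure UnitAddCircle)
    (volume : Measure UnitAddCircle)))

theorem measurePreserving_add_torus (a : Torus2) :
    MeasurePreserving (fun z : Torus2 => z + a) volume volume :=
  measurePreserving_add_right volume a

theorem measurePreserving_vertical (t : ℝ) :
    MeasurePreserving (vertical t : Torus2 × ℝ → Torus2 × ℝ) volume volume :=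
  (MeasurePreserving.id (volume : Measure Torus2)).prod
    (measurePreserving_add_right (volume : Measure ℝ) t)

theorem continuous_glue : Continuous (glue (rotation α α') φ) := by
  have h := φ.continuous
  exact (by fun_prop : Continuous fun p : Torus2 × ℝ => (p.1 + vec α α', p.2 - φ p.1))

theorem continuous_glue_symm : Continuous (glue (rotation α α') φ).symm := by
  have h := φ.continuous
  have : Continuous fun p : Torus2 × ℝ => (p.1 + -vec α α', p.2 + φ (p.1 + -vec α α')) := by
    fun_prop
  exact this

theorem measurePreserving_glue :
    MeasurePreserving (glue (rotation α α') φ) volume volume := by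
  refine MeasurePreserving.skew_product (g := fun z s => s - φ z)
    (measurePreserving_add_torus (vec α α')) ?_ (ae_of_all _ fun z => ?_)
  · have h := φ.continuous
    exact (by fun_prop : Continuous fun p : Torus2 × ℝ => p.2 - φ p.1).measurable
  · exact (measurePreserving_sub_right (volume : Measure ℝ) (φ z)).map_eq

theorem continuous_glue_zpow (i : ℤ) : Continuous ⇑(glue (rotation α α') φ ^ i) := by
  have aux : ∀ (g : Equiv.Perm (Torus2 × ℝ)), Continuous g → ∀ n : ℕ, Continuous ⇑(g ^ n) := by
    intro g hg n
    rw [Equiv.Perm.coe_pow]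
    exact hg.iterate n
  obtain ⟨n, rfl | rfl⟩ := i.eq_nat_or_neg
  · rw [zpow_natCast]; exact aux _ continuous_glue n
  · rw [zpow_neg, zpow_natCast, ← inv_pow]; exact aux _ continuous_glue_symm n

theorem measurePreserving_glue_zpow (i : ℤ) :
    MeasurePreserving ⇑(glue (rotation α α') φ ^ i) volume volume := by
  have aux : ∀ n : ℕ, MeasurePreserving ⇑(glue (rotation α α') φ ^ n) volume volume := by
    intro n
    rw [Equiv.Perm.coe_pow]
    exact measurePreserving_glue.iterate n
  obtain ⟨n, rfl | rfl⟩ := i.eq_nat_or_neg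
  · rw [zpow_natCast]; exact aux n
  · let e : Torus2 × ℝ ≃ᵐ Torus2 × ℝ :=
      ⟨glue (rotation α α') φ ^ n, by
        have := continuous_glue_zpow (α := α) (α' := α') (φ := φ) n
        rw [zpow_natCast] at this
        exact this.measurable, by
        have := continuous_glue_zpow (α := α) (α' := α') (φ := φ) (-n)
        rw [zpow_neg, zpow_natCast] at this
        exact this.measurable⟩
    have := MeasurePreserving.symm e (aux n)
    rw [zpow_neg, zpow_natCast]
    exact this

instance : MeasurableConstVAdd (Deck α α' φ) (Torus2 × ℝ) where
  measurable_const_vadd i := (continuous_glue_zpow (show ℤ from i)).measurable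

instance : VAddInvariantMeasure (Deck α α' φ) (Torus2 × ℝ) volume where
  measure_preimage_vadd i _ hs :=
    (measurePreserving_glue_zpow (show ℤ from i)).measure_preimage hs.nullMeasurableSet

theorem measurableSet_domain : MeasurableSet (domain φ) := by
  have h := φ.continuous
  exact (measurableSet_le measurable_const measurable_snd).inter
    (measurableSet_lt measurable_snd (h.measurable.comp measurable_fst))

theorem domain_subset : domain φ ⊆ closedDomain φ := fun _ hp => ⟨hp.1, hp.2.le⟩

theorem glue_zpow_injective (p : Torus2 × ℝ) {i j : ℤ}
    (h : (glue (rotation α α') φ ^ i) p = (glue (rotation α α') φ ^ j) p) : i = j := by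
  obtain ⟨c, hc, hcφ⟩ := φ.exists_lower
  by_contra hij
  -- a periodic point would have orbit of bounded height
  have aux : ∀ {n : ℕ} {q : Torus2 × ℝ}, 0 < n → (glue (rotation α α') φ ^ n) q = q → False := by
    intro n q hn e
    have := glue_pow_snd_le (α := α) (α' := α') hcφ n q
    rw [e] at this
    have : (0 : ℝ) < n * c := by positivity
    linarith
  have aux2 : ∀ {i j : ℤ}, i < j →
      (glue (rotation α α') φ ^ i) p = (glue (rotation α α') φ ^ j) p → False := by
    intro i j hlt e
    obtain ⟨n, hn⟩ := Int.eq_ofNat_of_zero_le (sub_nonneg.2 hlt.le)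
    refine aux (n := n) (q := (glue (rotation α α') φ ^ i) p) (by omega) ?_
    rw [← zpow_natCast, ← glue_zpow_add, e]
    congr 2
    omega
  rcases lt_or_gt_of_ne hij with hlt | hlt
  · exact aux2 hlt h
  · exact aux2 hlt h.symm

theorem exists_glue_mem_domain (p : Torus2 × ℝ) :
    ∃ i : ℤ, (glue (rotation α α') φ ^ i) p ∈ domain φ := by
  obtain ⟨q, hq, e⟩ := exists_rep (proj α α' φ p)
  obtain ⟨i, hi⟩ := proj_eq_iff.1 e.symm
  rcases hq.2.lt_or_eq with h | h
  · exact ⟨i, hi ▸ ⟨hq.1, h⟩⟩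
  · refine ⟨1 + i, ?_⟩
    rw [glue_zpow_add, hi, zpow_one]
    have e2 : (glue (rotation α α') φ q) = (q.1 + vec α α', 0) :=
      Prod.ext rfl (by change q.2 - φ q.1 = 0; linarith)
    rw [e2]
    exact ⟨le_rfl, φ.pos' _⟩

theorem eq_of_mem_domain {p q : Torus2 × ℝ} (hp : p ∈ domain φ) (hq : q ∈ domain φ)
    (h : proj α α' φ p = proj α α' φ q) : p = q := by
  have aux : ∀ {p q : Torus2 × ℝ}, p ∈ domain φ → q ∈ domain φ →
      glue (rotation α α') φ p ≠ q := by
    rintro p q hp hq rfl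
    have h1 : 0 ≤ p.2 - φ p.1 := hq.1
    linarith [hp.2]
  rcases seam (domain_subset hp) (domain_subset hq) h with h | h | h
  · exact h
  · exact absurd h (aux hp hq)
  · exact absurd h (aux hq hp)

theorem existsUnique_glue_mem_domain (p : Torus2 × ℝ) :
    ∃! i : ℤ, (glue (rotation α α') φ ^ i) p ∈ domain φ := by
  obtain ⟨i, hi⟩ := exists_glue_mem_domain (α := α) (α' := α') (φ := φ) p
  refine ⟨i, hi, fun j hj => ?_⟩
  refine glue_zpow_injective p (eq_of_mem_domain hj hi (α := α) (α' := α') ?_)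
  rw [proj_eq_iff]
  exact ⟨i - j, by rw [← glue_zpow_add]; simp⟩

theorem isAddFundamentalDomain :
    IsAddFundamentalDomain (Deck α α' φ) (domain φ) (volume : Measure (Torus2 × ℝ)) :=
  IsAddFundamentalDomain.mk' measurableSet_domain.nullMeasurableSet existsUnique_glue_mem_domain

theorem vertical_neg_vertical (t : ℝ) (p : Torus2 × ℝ) : vertical (-t) (vertical t p) = p := by
  simp [vertical]

/-- The vertical translates of the fundamental domain are fundamental domains. -/
theorem isAddFundamentalDomain_vertical (t : ℝ) :
    IsAddFundamentalDomain (Deck α α' φ) (vertical t ⁻¹' domain φ)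
      (volume : Measure (Torus2 × ℝ)) := by
  refine IsAddFundamentalDomain.mk'
    ((measurePreserving_vertical t).measurable measurableSet_domain).nullMeasurableSet fun p => ?_
  have := existsUnique_glue_mem_domain (α := α) (α' := α') (φ := φ) (vertical t p)
  simp only [glue_zpow_vertical] at this
  exact this

/-! ### Functions invariant under the gluing map -/

/-- `h` descends to a function on `M_φ`. -/
def Invariant {β : Type*} (α α' : ℝ) (φ : Ceiling) (h : Torus2 × ℝ → β) : Prop :=
  ∀ p, h (glue (rotation α α') φ p) = h p

theorem Invariant.pow {β : Type*} {h : Torus2 × ℝ → β} (hh : Invariant α α' φ h) (n : ℕ)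
    (p : Torus2 × ℝ) : h ((glue (rotation α α') φ ^ n) p) = h p := by
  induction n with
  | zero => simp
  | succ n ih => rw [pow_succ', Equiv.Perm.mul_apply, hh, ih]

theorem Invariant.zpow {β : Type*} {h : Torus2 × ℝ → β} (hh : Invariant α α' φ h) (i : ℤ)
    (p : Torus2 × ℝ) : h ((glue (rotation α α') φ ^ i) p) = h p := by
  obtain ⟨n, rfl | rfl⟩ := i.eq_nat_or_neg
  · rw [zpow_natCast]; exact hh.pow n p
  · rw [← hh.pow n, ← zpow_natCast, ← glue_zpow_add]; simp

theorem Invariant.vertical {β : Type*} {h : Torus2 × ℝ → β} (hh : Invariant α α' φ h) (t : ℝ) :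
    Invariant α α' φ fun p => h (vertical t p) := by
  intro p
  have := glue_zpow_vertical (rotation α α') φ t 1 p
  rw [zpow_one] at this
  change h (SpecialFlow.vertical t (glue (rotation α α') φ p)) = _
  rw [← this, hh]

/-- The flow preserves the integrals of invariant functions. -/
theorem Invariant.setLIntegral_vertical {h : Torus2 × ℝ → ENNReal} (hh : Invariant α α' φ h)
    (t : ℝ) : ∫⁻ p in domain φ, h (SpecialFlow.vertical t p) = ∫⁻ p in domain φ, h p := by
  have e : (SpecialFlow.vertical t ⁻¹' (SpecialFlow.vertical (-t) ⁻¹' domain φ)) = domain φ := by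
    ext p; simp only [Set.mem_preimage, vertical_neg_vertical]
  rw [(isAddFundamentalDomain (α := α) (α' := α') (φ := φ)).setLIntegral_eq
    (isAddFundamentalDomain_vertical (α := α) (α' := α') (-t)) h
    (fun g p => hh.zpow (show ℤ from g) p)]
  let V : Torus2 × ℝ ≃ᵐ Torus2 × ℝ :=
    ⟨⟨SpecialFlow.vertical t, SpecialFlow.vertical (-t), fun p => by simp [SpecialFlow.vertical],
      fun p => by simp [SpecialFlow.vertical]⟩, (measurePreserving_vertical t).measurable,
      (measurePreserving_vertical (-t)).measurable⟩
  have := (measurePreserving_vertical t).setLIntegral_comp_preimage_emb V.measurableEmbedding h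
    (SpecialFlow.vertical (-t) ⁻¹' domain φ)
  rw [e] at this
  exact this

theorem Invariant.measure_vertical {A : Set (Torus2 × ℝ)} (hA : MeasurableSet A)
    (hh : Invariant α α' φ (· ∈ A)) (t : ℝ) :
    volume (SpecialFlow.vertical t ⁻¹' A ∩ domain φ) = volume (A ∩ domain φ) := by
  have hi : Invariant α α' φ (A.indicator (fun _ => (1 : ENNReal))) := by
    intro p
    have : glue (rotation α α') φ p ∈ A ↔ p ∈ A := iff_of_eq (hh p)
    by_cases hp : p ∈ A
    · rw [Set.indicator_of_mem hp, Set.indicator_of_mem (this.2 hp)]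
    · rw [Set.indicator_of_notMem hp, Set.indicator_of_notMem fun hg => hp (this.1 hg)]
  have := hi.setLIntegral_vertical t
  rw [lintegral_indicator_const hA, one_mul, Measure.restrict_apply hA] at this
  rw [← this, ← Measure.restrict_apply ((measurePreserving_vertical t).measurable hA),
    ← lintegral_indicator_one ((measurePreserving_vertical t).measurable hA)]
  rfl

theorem exists_domain_bound (φ : Ceiling) : ∃ C : ℝ, ∀ p ∈ closedDomain φ, |p.2| ≤ C := by
  obtain ⟨C, hC⟩ := φ.exists_upper
  exact ⟨C, fun p hp => by rw [abs_of_nonneg hp.1]; exact hp.2.trans (hC _)⟩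

/-- A horizontal strip meets only finitely many translates of the fundamental domain. -/
theorem exists_lintegral_strip_le (α α' : ℝ) (φ : Ceiling) (K : ℝ) : ∃ N : ℕ,
    ∀ h : Torus2 × ℝ → ENNReal, Measurable h → Invariant α α' φ h →
      ∫⁻ p in {p : Torus2 × ℝ | |p.2| ≤ K}, h p ≤ N * ∫⁻ p in domain φ, h p := by
  obtain ⟨c, hc, hcφ⟩ := φ.exists_lower
  obtain ⟨C, hC⟩ := exists_domain_bound φ
  obtain ⟨n, hn⟩ := exists_nat_gt ((C + K) / c)
  have hS : MeasurableSet {p : Torus2 × ℝ | |p.2| ≤ K} :=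
    measurableSet_le (by fun_prop) measurable_const
  refine ⟨(Finset.Icc (-(n : ℤ)) n).card, fun h hm hh => ?_⟩
  rw [← lintegral_indicator hS,
    (isAddFundamentalDomain (α := α) (α' := α') (φ := φ)).lintegral_eq_tsum'']
  let I : Finset ℤ := Finset.Icc (-(n : ℤ)) n
  have h0 : ∀ i : Deck α α' φ, i ∉ (show Finset (Deck α α' φ) from I) →
      ∫⁻ p in domain φ, {p : Torus2 × ℝ | |p.2| ≤ K}.indicator h (i +ᵥ p) = 0 := by
    intro i hi
    rw [setLIntegral_congr_fun (g := fun _ => 0) measurableSet_domain, lintegral_zero]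
    intro p hp
    refine Set.indicator_of_notMem (fun hq => hi ?_) _
    have h1 := abs_mul_le_of_glue (α := α) (α' := α') hcφ (show ℤ from i) p
    have h2 := hC p (domain_subset hp)
    have h3 : |((glue (rotation α α') φ ^ (show ℤ from i)) p).2| ≤ K := hq
    have h4 : |((show ℤ from i : ℤ) : ℝ)| < n := by
      refine lt_of_le_of_lt ?_ hn
      rw [le_div_iff₀ hc]
      linarith
    have h5 : |(show ℤ from i)| < (n : ℤ) := by exact_mod_cast h4
    have h6 := abs_lt.1 h5
    exact (Finset.mem_Icc (α := ℤ)).2 ⟨h6.1.le, h6.2.le⟩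
  rw [tsum_eq_sum h0, ← nsmul_eq_mul]
  refine Finset.sum_le_card_nsmul _ _ _ fun i _ => lintegral_mono fun p => ?_
  refine (Set.indicator_le_self _ _ _).trans (le_of_eq ?_)
  exact hh.zpow (show ℤ from i) p

/-- The sum of the values of `G` over the orbit of the gluing map. -/
def periodize (α α' : ℝ) (φ : Ceiling) (G : Torus2 × ℝ → ℝ) (p : Torus2 × ℝ) : ℝ :=
  ∑' i : ℤ, G ((glue (rotation α α') φ ^ i) p)

theorem periodize_invariant (G : Torus2 × ℝ → ℝ) :
    Invariant α α' φ (periodize α α' φ G) := by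
  intro p
  unfold periodize
  rw [← (Equiv.addRight (1 : ℤ)).tsum_eq fun i => G ((glue (rotation α α') φ ^ i) p)]
  refine tsum_congr fun i => ?_
  rw [Equiv.coe_addRight, glue_zpow_add, zpow_one]

theorem exists_strip_of_hasCompactSupport {G : Torus2 × ℝ → ℝ} (hG : HasCompactSupport G) :
    ∃ K : ℝ, ∀ p, G p ≠ 0 → |p.2| ≤ K := by
  obtain ⟨K, hK⟩ := hG.isCompact.exists_bound_of_continuousOn
    (f := fun p : Torus2 × ℝ => p.2) continuous_snd.continuousOn
  exact ⟨K, fun p hp => hK p (subset_tsupport G hp)⟩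

theorem periodize_eq_sum {G : Torus2 × ℝ → ℝ} (hG : HasCompactSupport G) (R : ℝ) :
    ∃ n : ℕ, ∀ p : Torus2 × ℝ, |p.2| ≤ R → ∀ i ∉ Finset.Icc (-(n : ℤ)) n,
      G ((glue (rotation α α') φ ^ i) p) = 0 := by
  obtain ⟨c, hc, hcφ⟩ := φ.exists_lower
  obtain ⟨K, hK⟩ := exists_strip_of_hasCompactSupport hG
  obtain ⟨n, hn⟩ := exists_nat_gt ((R + K) / c)
  refine ⟨n, fun p hp i hi => ?_⟩
  by_contra hne
  refine hi ?_
  have h1 := abs_mul_le_of_glue (α := α) (α' := α') hcφ i p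
  have h3 := hK _ hne
  have h4 : |(i : ℝ)| < n := by
    refine lt_of_le_of_lt ?_ hn
    rw [le_div_iff₀ hc]
    linarith
  have h5 : |i| < (n : ℤ) := by exact_mod_cast h4
  have h6 := abs_lt.1 h5
  exact Finset.mem_Icc.2 ⟨h6.1.le, h6.2.le⟩

theorem continuous_periodize {G : Torus2 × ℝ → ℝ} (hG : HasCompactSupport G)
    (hGc : Continuous G) : Continuous (periodize α α' φ G) := by
  rw [continuous_iff_continuousAt]
  intro p
  obtain ⟨n, hn⟩ := periodize_eq_sum (α := α) (α' := α') (φ := φ) hG (|p.2| + 1)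
  have hc : Continuous fun q => ∑ i ∈ Finset.Icc (-(n : ℤ)) n,
      G ((glue (rotation α α') φ ^ i) q) :=
    continuous_finsetSum _ fun i _ => hGc.comp (continuous_glue_zpow i)
  refine hc.continuousAt.congr ?_
  have : {q : Torus2 × ℝ | |q.2| < |p.2| + 1} ∈ 𝓝 p :=
    (isOpen_lt (by fun_prop) continuous_const).mem_nhds (by simp)
  filter_upwards [this] with q hq
  exact (tsum_eq_sum fun i hi => hn q hq.le i hi).symm

/-- Continuous functions on `M_φ` are bounded. -/
theorem Invariant.exists_bound {h : Torus2 × ℝ → ℝ} (hh : Invariant α α' φ h)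
    (hc : Continuous h) : ∃ C : ℝ, 0 < C ∧ ∀ p, |h p| ≤ C := by
  obtain ⟨R, hR⟩ := exists_domain_bound φ
  have hK : IsCompact ((Set.univ : Set Torus2) ×ˢ Set.Icc (-R) R) :=
    isCompact_univ.prod isCompact_Icc
  obtain ⟨C, hC⟩ := hK.exists_bound_of_continuousOn hc.continuousOn
  refine ⟨max C 1, by positivity, fun p => ?_⟩
  obtain ⟨i, hi⟩ := exists_glue_mem_domain (α := α) (α' := α') (φ := φ) p
  rw [← hh.zpow i p]
  refine (hC _ ⟨Set.mem_univ _, ?_⟩).trans (le_max_left _ _)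
  exact abs_le.1 (hR _ (domain_subset hi))

end Deck

/-! ### Mixing is a property of continuous observables -/

section Reduction

variable {α α' : ℝ} {φ : Ceiling}

theorem exists_volume_domain (φ : Ceiling) :
    volume (domain φ) ≠ 0 ∧ volume (domain φ) ≠ ⊤ := by
  -- a probability measure is a normalization of the volume of the domain
  have hm : Measurable (proj 0 0 φ) := measurable_quotient_mk''
  have h : measure 0 0 φ Set.univ = 1 := measure_univ
  rw [measure, Measure.map_apply hm MeasurableSet.univ] at h
  simp only [Set.preimage_univ, Measure.smul_apply, Measure.restrict_apply MeasurableSet.univ,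
    Set.univ_inter, smul_eq_mul] at h
  constructor <;> intro h0 <;> rw [h0] at h <;> simp at h

/-- The volume of the fundamental domain. -/
def vol (φ : Ceiling) : ℝ := volume.real (domain φ)

theorem vol_pos (φ : Ceiling) : 0 < vol φ :=
  ENNReal.toReal_pos (exists_volume_domain φ).1 (exists_volume_domain φ).2

theorem measurable_proj : Measurable (proj α α' φ) := measurable_quotient_mk''

theorem measure_apply {S : Set (Space α α' φ)} (hS : MeasurableSet S) :
    measure α α' φ S =
      ENNReal.ofReal (volume.real (proj α α' φ ⁻¹' S ∩ domain φ) / vol φ) := by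
  have h1 := exists_volume_domain φ
  have h2 : volume (proj α α' φ ⁻¹' S ∩ domain φ) ≠ ⊤ :=
    ne_top_of_le_ne_top h1.2 (measure_mono Set.inter_subset_right)
  rw [measure, Measure.map_apply measurable_proj hS, Measure.smul_apply,
    Measure.restrict_apply (measurable_proj hS), smul_eq_mul,
    ENNReal.ofReal_div_of_pos (vol_pos φ), vol, Measure.real, Measure.real,
    ENNReal.ofReal_toReal h2, ENNReal.ofReal_toReal h1.2, mul_comm, div_eq_mul_inv]

theorem invariant_preimage_proj (S : Set (Space α α' φ)) :
    Invariant α α' φ (· ∈ proj α α' φ ⁻¹' S) := by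
  intro p
  simp only [Set.mem_preimage, proj_glue]

theorem flow_proj (t : ℝ) (p : Torus2 × ℝ) :
    flow α α' φ t (proj α α' φ p) = proj α α' φ (vertical t p) := rfl

theorem measurable_flow (t : ℝ) : Measurable (flow α α' φ t) :=
  measurable_from_quotient.2
    (measurable_proj.comp (measurePreserving_vertical t).measurable)

theorem measurePreserving_flow (t : ℝ) :
    MeasurePreserving (flow α α' φ t) (measure α α' φ) (measure α α' φ) := by
  refine ⟨measurable_flow t, Measure.ext fun S hS => ?_⟩
  rw [Measure.map_apply (measurable_flow t) hS, measure_apply (measurable_flow t hS),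
    measure_apply hS]
  congr 2
  exact congrArg ENNReal.toReal
    ((invariant_preimage_proj S).measure_vertical (measurable_proj hS) t)

theorem flow_injective (t : ℝ) : Function.Injective (flow α α' φ t) := by
  have : Function.LeftInverse (flow α α' φ (-t)) (flow α α' φ t) := by
    intro ξ
    induction ξ using Quotient.inductionOn with | h p =>
    change proj α α' φ (vertical (-t) (vertical t p)) = proj α α' φ p
    rw [vertical_neg_vertical]
  exact this.injective

theorem flow_image_eq (t : ℝ) (A : Set (Space α α' φ)) :
    flow α α' φ t '' A = flow α α' φ (-t) ⁻¹' A := by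
  refine Set.image_eq_preimage_of_inverse (fun ξ => ?_) (fun ξ => ?_) ▸ rfl
  · induction ξ using Quotient.inductionOn with | h p =>
    change proj α α' φ (vertical (-t) (vertical t p)) = proj α α' φ p
    rw [vertical_neg_vertical]
  · induction ξ using Quotient.inductionOn with | h p =>
    change proj α α' φ (vertical t (vertical (-t) p)) = proj α α' φ p
    have := vertical_neg_vertical (-t) p
    rw [neg_neg] at this
    rw [this]

/-- Indicators of measurable subsets of `M_φ` are limits in `L¹` of continuous functions. -/
theorem exists_continuous_invariant_approx (α α' : ℝ) (φ : Ceiling)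
    {S : Set (Torus2 × ℝ)} (hS : MeasurableSet S) {ε : ℝ} (hε : 0 < ε) :
    ∃ g : Torus2 × ℝ → ℝ, Continuous g ∧ Invariant α α' φ g ∧
      ∫⁻ p in domain φ, ‖S.indicator (fun _ => (1 : ℝ)) p - g p‖ₑ ≤ ENNReal.ofReal ε := by
  set f : Torus2 × ℝ → ℝ := (S ∩ domain φ).indicator fun _ => 1 with hf
  have hSD := hS.inter (measurableSet_domain (φ := φ))
  have hfi : Integrable f := by
    rw [hf, integrable_indicator_iff hSD]
    exact integrableOn_const (ne_top_of_le_ne_top (exists_volume_domain φ).2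
      (measure_mono Set.inter_subset_right))
  obtain ⟨G, hGs, hGε, hGc, hGi⟩ := hfi.exists_hasCompactSupport_integral_sub_le hε
  refine ⟨periodize α α' φ G, continuous_periodize hGs hGc, periodize_invariant G, ?_⟩
  have hm : ∀ i : Deck α α' φ, AEMeasurable (fun p => ‖f (i +ᵥ p) - G (i +ᵥ p)‖ₑ)
      (volume.restrict (domain φ)) := by
    intro i
    have h1 : Measurable fun p : Torus2 × ℝ => i +ᵥ p := measurable_const_vadd i
    have h2 : Measurable f := measurable_const.indicator hSD
    exact (((h2.comp h1).sub (hGc.measurable.comp h1)).enorm).aemeasurable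
  calc ∫⁻ p in domain φ, ‖S.indicator (fun _ => (1 : ℝ)) p - periodize α α' φ G p‖ₑ
      ≤ ∫⁻ p in domain φ, ∑' i : Deck α α' φ, ‖f (i +ᵥ p) - G (i +ᵥ p)‖ₑ := by
        refine setLIntegral_mono' measurableSet_domain fun p hp => ?_
        obtain ⟨n, hn⟩ := periodize_eq_sum (α := α) (α' := α') (φ := φ) hGs |p.2|
        have s1 : Summable fun i : ℤ => G ((glue (rotation α α') φ ^ i) p) :=
          summable_of_ne_finset_zero (s := Finset.Icc (-(n : ℤ)) n) fun i hi => hn p le_rfl i hi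
        -- only the identity brings `p` back to the domain
        have s2 : HasSum (fun i : ℤ => f ((glue (rotation α α') φ ^ i) p))
            (S.indicator (fun _ => (1 : ℝ)) p) := by
          have h0 : ∀ i : ℤ, i ≠ 0 → f ((glue (rotation α α') φ ^ i) p) = 0 := by
            intro i hi0
            refine Set.indicator_of_notMem (fun hq => hi0 ?_) _
            refine glue_zpow_injective (α := α) (α' := α') (φ := φ) p ?_
            rw [zpow_zero, Equiv.Perm.one_apply]
            exact eq_of_mem_domain hq.2 hp (proj_eq_iff.2 ⟨-i, by rw [← glue_zpow_add]; simp⟩)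
          have h1 : f ((glue (rotation α α') φ ^ (0 : ℤ)) p) =
              S.indicator (fun _ => (1 : ℝ)) p := by
            rw [zpow_zero, Equiv.Perm.one_apply, hf]
            by_cases hpS : p ∈ S
            · rw [Set.indicator_of_mem hpS, Set.indicator_of_mem (Set.mem_inter hpS hp)]
            · rw [Set.indicator_of_notMem hpS, Set.indicator_of_notMem fun h => hpS h.1]
          rw [← h1]
          exact hasSum_single 0 h0
        have s3 := s2.sub s1.hasSum
        have s4 : S.indicator (fun _ => (1 : ℝ)) p - periodize α α' φ G p =
            ∑' i : ℤ, (f ((glue (rotation α α') φ ^ i) p) - G ((glue (rotation α α') φ ^ i) p)) :=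
          s3.tsum_eq.symm
        rw [s4]
        exact enorm_tsum_le_tsum_enorm
    _ = ∑' i : Deck α α' φ, ∫⁻ p in domain φ, ‖f (i +ᵥ p) - G (i +ᵥ p)‖ₑ := lintegral_tsum hm
    _ = ∫⁻ p, ‖f p - G p‖ₑ :=
        ((isAddFundamentalDomain (α := α) (α' := α') (φ := φ)).lintegral_eq_tsum''
          fun p => ‖f p - G p‖ₑ).symm
    _ = ENNReal.ofReal (∫ p, ‖f p - G p‖) :=
        (ofReal_integral_norm_eq_lintegral_enorm (hfi.sub hGi)).symm
    _ ≤ ENNReal.ofReal ε := ENNReal.ofReal_le_ofReal hGε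

theorem integrable_mul_vertical {F b : Torus2 × ℝ → ℝ} (hF : Integrable F) (hb : Measurable b)
    {C : ℝ} (hC : ∀ p, |b p| ≤ C) (t : ℝ) : Integrable fun p => F p * b (vertical t p) :=
  hF.mul_bdd (c := C) (hb.comp (measurePreserving_vertical t).measurable).aestronglyMeasurable
    (ae_of_all _ fun _ => hC _)

/-- The decay of correlations passes from continuous observables to measurable sets. -/
theorem tendsto_correlation
    (H : ∀ F g : Torus2 × ℝ → ℝ, Continuous F → HasCompactSupport F → Continuous g →
      Invariant α α' φ g → Tendsto (fun t => ∫ p, F p * g (vertical t p)) atTop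
        (𝓝 ((∫ p, F p) * ((∫ p in domain φ, g p) / vol φ))))
    {S₁ S₂ : Set (Torus2 × ℝ)} (h1 : MeasurableSet S₁) (h2 : MeasurableSet S₂)
    (hi : Invariant α α' φ (· ∈ S₂)) :
    Tendsto (fun t => volume.real ((S₁ ∩ domain φ) ∩ vertical t ⁻¹' S₂)) atTop
      (𝓝 (volume.real (S₁ ∩ domain φ) * (volume.real (S₂ ∩ domain φ) / vol φ))) := by
  have hD := measurableSet_domain (φ := φ)
  have hDfin := (exists_volume_domain φ).2
  have V0 := vol_pos φ
  set f : Torus2 × ℝ → ℝ := (S₁ ∩ domain φ).indicator fun _ => 1 with hf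
  set b : Torus2 × ℝ → ℝ := S₂.indicator fun _ => 1 with hb
  have hfi : Integrable f := by
    rw [hf, integrable_indicator_iff (h1.inter hD)]
    exact integrableOn_const (ne_top_of_le_ne_top hDfin (measure_mono Set.inter_subset_right))
  have hbm : Measurable b := measurable_const.indicator h2
  have hb1 : ∀ p, |b p| ≤ 1 := fun p => by
    by_cases hp : p ∈ S₂
    · rw [hb, Set.indicator_of_mem hp]; simp
    · rw [hb, Set.indicator_of_notMem hp]; simp
  have hbinv : Invariant α α' φ b := by
    intro p
    have : glue (rotation α α') φ p ∈ S₂ ↔ p ∈ S₂ := iff_of_eq (hi p)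
    by_cases hp : p ∈ S₂
    · rw [hb, Set.indicator_of_mem hp, Set.indicator_of_mem (this.2 hp)]
    · rw [hb, Set.indicator_of_notMem hp, Set.indicator_of_notMem fun hg => hp (this.1 hg)]
  have hcorr : ∀ t, volume.real ((S₁ ∩ domain φ) ∩ vertical t ⁻¹' S₂) =
      ∫ p, f p * b (vertical t p) := by
    intro t
    rw [← integral_indicator_one ((h1.inter hD).inter
      ((measurePreserving_vertical t).measurable h2))]
    refine integral_congr_ae (ae_of_all _ fun p => ?_)
    have e : b (vertical t p) = (vertical t ⁻¹' S₂).indicator (fun _ => (1 : ℝ)) p := rfl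
    simp only [e, hf]
    rw [← Set.inter_indicator_mul]
    simp [Set.indicator]
  have hfint : ∫ p, f p = volume.real (S₁ ∩ domain φ) := by
    rw [← integral_indicator_one (h1.inter hD)]; rfl
  have hbint : ∫ p in domain φ, b p = volume.real (S₂ ∩ domain φ) := by
    rw [hb, setIntegral_indicator h2, setIntegral_const, smul_eq_mul, mul_one, Set.inter_comm]
  have hbi : IntegrableOn b (domain φ) := by
    refine Measure.integrableOn_of_bounded hDfin hbm.aestronglyMeasurable
      (M := 1) (ae_of_all _ fun p => hb1 p)
  have hfV : volume.real (S₁ ∩ domain φ) ≤ vol φ := measureReal_mono Set.inter_subset_right hDfin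
  have hbV : volume.real (S₂ ∩ domain φ) ≤ vol φ := measureReal_mono Set.inter_subset_right hDfin
  have hf0 : 0 ≤ volume.real (S₁ ∩ domain φ) := measureReal_nonneg
  have hb0 : 0 ≤ volume.real (S₂ ∩ domain φ) := measureReal_nonneg
  rw [Metric.tendsto_atTop]
  intro η hη
  set ε : ℝ := min 1 (η / (2 * (5 + 1 / vol φ))) with hε
  have ε0 : 0 < ε := lt_min one_pos (by positivity)
  have ε1 : ε ≤ 1 := min_le_left _ _
  have εη : ε * (5 + 1 / vol φ) < η := by
    have : ε ≤ η / (2 * (5 + 1 / vol φ)) := min_le_right _ _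
    rw [le_div_iff₀ (by positivity)] at this
    have h5 : 0 < ε * (5 + 1 / vol φ) := by positivity
    linarith
  obtain ⟨F, hFs, hFε, hFc, hFi⟩ := hfi.exists_hasCompactSupport_integral_sub_le ε0
  obtain ⟨M, hM⟩ := hFc.bounded_above_of_compact_support hFs
  have hM0 : 0 ≤ M := (norm_nonneg _).trans (hM 0)
  obtain ⟨K, hK⟩ := exists_strip_of_hasCompactSupport hFs
  obtain ⟨N, hN⟩ := exists_lintegral_strip_le α α' φ K
  have hδ : 0 < ε / (M * N + 1) := by positivity
  obtain ⟨g, hgc, hginv, hgε⟩ := exists_continuous_invariant_approx α α' φ h2 hδ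
  obtain ⟨C, hC0, hC⟩ := hginv.exists_bound hgc
  have hgi : IntegrableOn g (domain φ) :=
    Measure.integrableOn_of_bounded hDfin hgc.measurable.aestronglyMeasurable
      (M := C) (ae_of_all _ fun p => hC p)
  obtain ⟨t₀, ht₀⟩ := (Metric.tendsto_atTop.1 (H F g hFc hFs hgc hginv)) ε ε0
  refine ⟨t₀, fun t ht => ?_⟩
  have d3 := ht₀ t ht
  rw [Real.dist_eq] at d3 ⊢
  rw [hcorr]
  -- replace the first indicator
  have d1 : |(∫ p, f p * b (vertical t p)) - ∫ p, F p * b (vertical t p)| ≤ ε := by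
    rw [← integral_sub (integrable_mul_vertical hfi hbm hb1 t)
      (integrable_mul_vertical hFi hbm hb1 t)]
    rw [← Real.norm_eq_abs]
    refine (norm_integral_le_integral_norm _).trans (le_trans ?_ hFε)
    refine integral_mono_of_nonneg (ae_of_all _ fun p => norm_nonneg _) (hfi.sub hFi).norm
      (ae_of_all _ fun p => ?_)
    change ‖f p * b (vertical t p) - F p * b (vertical t p)‖ ≤ ‖f p - F p‖
    rw [← sub_mul, norm_mul]
    exact mul_le_of_le_one_right (norm_nonneg _) (hb1 _)
  -- replace the second indicator
  have d2 : |(∫ p, F p * b (vertical t p)) - ∫ p, F p * g (vertical t p)| ≤ ε := by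
    rw [← integral_sub (integrable_mul_vertical hFi hbm hb1 t)
      (integrable_mul_vertical hFi hgc.measurable hC t)]
    have hme : Measurable fun p => ‖b p - g p‖ₑ := (hbm.sub hgc.measurable).enorm
    have hinv : Invariant α α' φ fun p => ‖b p - g p‖ₑ := fun p => by
      simp only [hbinv p, hginv p]
    have hstrip : MeasurableSet {p : Torus2 × ℝ | |p.2| ≤ K} :=
      measurableSet_le (by fun_prop) measurable_const
    have hle : ‖∫ p, (F p * b (vertical t p) - F p * g (vertical t p))‖ₑ ≤ ENNReal.ofReal ε := by
      calc ‖∫ p, (F p * b (vertical t p) - F p * g (vertical t p))‖ₑ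
          ≤ ∫⁻ p, ‖F p * b (vertical t p) - F p * g (vertical t p)‖ₑ :=
            enorm_integral_le_lintegral_enorm _
        _ ≤ ∫⁻ p, {p : Torus2 × ℝ | |p.2| ≤ K}.indicator
              (fun p => ENNReal.ofReal M * ‖b (vertical t p) - g (vertical t p)‖ₑ) p := by
            refine lintegral_mono fun p => ?_
            rw [← mul_sub, enorm_mul]
            by_cases hp : F p = 0
            · rw [hp]; simp
            · rw [Set.indicator_of_mem (show p ∈ {p : Torus2 × ℝ | |p.2| ≤ K} from hK p hp)]
              gcongr
              rw [← ofReal_norm]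
              exact ENNReal.ofReal_le_ofReal (hM p)
        _ = ENNReal.ofReal M * ∫⁻ p in {p : Torus2 × ℝ | |p.2| ≤ K},
              ‖b (vertical t p) - g (vertical t p)‖ₑ := by
            rw [lintegral_indicator hstrip, lintegral_const_mul _
              (show Measurable fun p => ‖b (vertical t p) - g (vertical t p)‖ₑ from
                hme.comp (measurePreserving_vertical t).measurable)]
        _ ≤ ENNReal.ofReal M * (N * ∫⁻ p in domain φ,
              ‖b (vertical t p) - g (vertical t p)‖ₑ) := by
            gcongr
            exact hN _ (hme.comp (measurePreserving_vertical t).measurable) (hinv.vertical t)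
        _ ≤ ENNReal.ofReal M * (N * ENNReal.ofReal (ε / (M * N + 1))) := by
            gcongr
            exact (hinv.setLIntegral_vertical t).le.trans hgε
        _ = ENNReal.ofReal (M * (N * (ε / (M * N + 1)))) := by
            rw [ENNReal.ofReal_mul hM0, ENNReal.ofReal_mul (Nat.cast_nonneg N),
              ENNReal.ofReal_natCast]
        _ ≤ ENNReal.ofReal ε := by
            refine ENNReal.ofReal_le_ofReal ?_
            rw [← mul_assoc, ← mul_div_assoc, div_le_iff₀ (by positivity)]
            nlinarith
    rw [← ofReal_norm, ENNReal.ofReal_le_ofReal_iff ε0.le] at hle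
    exact hle
  have d4 : |(∫ p, f p) - ∫ p, F p| ≤ ε := by
    rw [← integral_sub hfi hFi]
    exact (norm_integral_le_integral_norm _).trans hFε
  have d5 : |(∫ p in domain φ, b p) - ∫ p in domain φ, g p| ≤ ε := by
    rw [← integral_sub hbi hgi]
    have hle : ‖∫ p in domain φ, (b p - g p)‖ₑ ≤ ENNReal.ofReal ε := by
      refine (enorm_integral_le_lintegral_enorm _).trans (hgε.trans
        (ENNReal.ofReal_le_ofReal ?_))
      refine div_le_self ε0.le ?_
      have : 0 ≤ M * N := by positivity
      linarith
    rw [← ofReal_norm, ENNReal.ofReal_le_ofReal_iff ε0.le] at hle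
    exact hle
  rw [hfint] at d4
  rw [hbint] at d5
  set a := volume.real (S₁ ∩ domain φ)
  set c := volume.real (S₂ ∩ domain φ)
  set IF := ∫ p, F p
  set Ig := ∫ p in domain φ, g p
  have d6 : |IF * (Ig / vol φ) - a * (c / vol φ)| ≤ ε * (1 + 1 / vol φ) + ε := by
    have hIF : |IF| ≤ vol φ + ε := by
      rw [abs_le] at d4 ⊢
      constructor <;> linarith
    have e : IF * (Ig / vol φ) - a * (c / vol φ) =
        IF / vol φ * (Ig - c) + (IF - a) * (c / vol φ) := by field_simp; ring
    rw [e]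
    refine (abs_add_le _ _).trans ?_
    rw [abs_mul, abs_mul, abs_div, abs_of_pos V0, abs_sub_comm Ig, abs_sub_comm IF,
      abs_of_nonneg (by positivity : 0 ≤ c / vol φ)]
    have hc1 : c / vol φ ≤ 1 := (div_le_one V0).2 hbV
    have hI1 : |IF| / vol φ ≤ 1 + 1 / vol φ := by
      rw [div_le_iff₀ V0, add_mul, div_mul_cancel₀ _ V0.ne']
      linarith
    have m1 : |IF| / vol φ * |c - Ig| ≤ (1 + 1 / vol φ) * ε :=
      mul_le_mul hI1 d5 (abs_nonneg _) (by positivity)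
    have m2 : |a - IF| * (c / vol φ) ≤ ε * 1 :=
      mul_le_mul d4 hc1 (by positivity) ε0.le
    linarith
  rw [abs_le] at d1 d2 d6
  rw [abs_lt] at d3 ⊢
  constructor <;> nlinarith

/-- The special flow is mixing if the correlations of continuous observables decay. -/
theorem isMixing_of_continuous
    (H : ∀ F g : Torus2 × ℝ → ℝ, Continuous F → HasCompactSupport F → Continuous g →
      Invariant α α' φ g → Tendsto (fun t => ∫ p, F p * g (vertical t p)) atTop
        (𝓝 ((∫ p, F p) * ((∫ p in domain φ, g p) / vol φ)))) :
    IsMixing (flow α α' φ) (measure α α' φ) where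
  measurePreserving := measurePreserving_flow
  tendsto A B hA hB := by
    have V0 := vol_pos φ
    have key := tendsto_correlation H (measurable_proj hA) (measurable_proj hB)
      (invariant_preimage_proj B)
    have e1 : ∀ t, measure α α' φ (flow α α' φ t '' A ∩ B) = ENNReal.ofReal
        (volume.real ((proj α α' φ ⁻¹' A ∩ domain φ) ∩
          vertical t ⁻¹' (proj α α' φ ⁻¹' B)) / vol φ) := by
      intro t
      have hm : MeasurableSet (flow α α' φ t '' A) := by
        rw [flow_image_eq]; exact measurable_flow _ hA
      rw [← (measurePreserving_flow t).measure_preimage (hm.inter hB).nullMeasurableSet,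
        Set.preimage_inter, Set.preimage_image_eq _ (flow_injective t),
        measure_apply (hA.inter (measurable_flow t hB)), Set.preimage_inter, Set.inter_right_comm]
      rfl
    have e2 : measure α α' φ A * measure α α' φ B = ENNReal.ofReal
        (volume.real (proj α α' φ ⁻¹' A ∩ domain φ) *
          (volume.real (proj α α' φ ⁻¹' B ∩ domain φ) / vol φ) / vol φ) := by
      rw [measure_apply hA, measure_apply hB, ← ENNReal.ofReal_mul (by positivity)]
      congr 1
      ring
    simp only [e1, e2]
    exact ENNReal.tendsto_ofReal (key.div_const _)

end Reduction

/-! ### Equidistribution of the rotation -/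

theorem norm_coe_le_abs (x : ℝ) : ‖(x : UnitAddCircle)‖ ≤ |x| := by
  rw [UnitAddCircle.norm_eq]
  simpa using round_le x 0

/-- The multiples of a reduced fraction of denominator `q` are `1 / q`-dense in the circle. -/
theorem exists_nsmul_near {p q : ℕ} (hq : 0 < q) (hpq : p.Coprime q) (u : ℝ) :
    ∃ n : ℕ, ‖((u - n * (p / q) : ℝ) : UnitAddCircle)‖ ≤ 1 / q := by
  have hq' : (0 : ℝ) < q := by exact_mod_cast hq
  have : NeZero q := ⟨hq.ne'⟩
  let w : (ZMod q)ˣ := ZMod.unitOfCoprime p hpq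
  set f : ℤ := ⌊u * q⌋ with hf
  set a : ZMod q := (f : ZMod q) * (w⁻¹ : (ZMod q)ˣ) with ha
  have h1 : ((a.val * p - f : ℤ) : ZMod q) = 0 := by
    have : (w : ZMod q) = (p : ZMod q) := ZMod.coe_unitOfCoprime p hpq
    push_cast
    rw [ZMod.natCast_zmod_val, ha, ← this, mul_assoc, Units.inv_mul, mul_one, sub_self]
  obtain ⟨m, hm⟩ := (ZMod.intCast_zmod_eq_zero_iff_dvd _ _).1 h1
  refine ⟨a.val, ?_⟩
  have h2 : (a.val : ℝ) * p - f = q * m := by exact_mod_cast hm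
  have h3 : u - a.val * (p / q) = (u * q - f) / q + ((-m : ℤ) : ℝ) := by
    push_cast
    field_simp
    linarith
  have h4 : (((-m : ℤ) : ℝ) : UnitAddCircle) = 0 :=
    (AddCircle.coe_eq_zero_iff (1 : ℝ)).2 ⟨-m, by simp⟩
  rw [h3, AddCircle.coe_add, h4, add_zero]
  refine (norm_coe_le_abs _).trans ?_
  have h5 := Int.floor_le (u * q)
  have h6 := Int.lt_floor_add_one (u * q)
  rw [abs_div, abs_of_pos hq', abs_of_nonneg (by linarith)]
  gcongr
  linarith

/-- Over a periodic orbit which is `d`-dense, the Birkhoff sum of a function is close to its mean if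
the function oscillates little at the scale `d`. -/
theorem abs_sum_sub_integral_le {F : Torus2 → ℝ} (hF : Continuous F) {d e : ℝ}
    (hd : ∀ z w, dist z w ≤ d → |F z - F w| ≤ e) {a : Torus2} {N : ℕ} (hN : N • a = 0)
    (hdense : ∀ w : Torus2, ∃ n : ℕ, dist w (n • a) ≤ d) (z : Torus2) :
    |∑ n ∈ Finset.range N, F (z + n • a) - N * ∫ w, F w| ≤ N * e := by
  set Γ : Torus2 → ℝ := fun z => ∑ n ∈ Finset.range N, F (z + n • a) with hΓ
  have hinv : ∀ (m : ℕ) (z : Torus2), Γ (z + m • a) = Γ z := by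
    intro m
    induction m with
    | zero => simp
    | succ m ih =>
      intro z
      rw [succ_nsmul, ← add_assoc, ← ih z]
      have h1 := Finset.sum_range_succ' (fun n : ℕ => F (z + m • a + n • a)) N
      have h2 := Finset.sum_range_succ (fun n : ℕ => F (z + m • a + n • a)) N
      rw [hN] at h2
      rw [zero_smul] at h1
      simp only [hΓ]
      have e2 : ∀ n : ℕ, F (z + m • a + a + n • a) = F (z + m • a + (n + 1) • a) := by
        intro n; congr 1; rw [succ_nsmul']; abel
      simp only [e2]
      linarith
  have hosc : ∀ z w : Torus2, |Γ z - Γ w| ≤ N * e := by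
    intro z w
    obtain ⟨n, hn⟩ := hdense (w - z)
    rw [← hinv n z]
    simp only [hΓ]
    rw [← Finset.sum_sub_distrib]
    refine (Finset.abs_sum_le_sum_abs _ _).trans ((Finset.sum_le_card_nsmul _ _ e
      fun i _ => hd _ _ ?_).trans ?_)
    · rw [dist_eq_norm] at hn ⊢
      refine le_trans (le_of_eq ?_) hn
      rw [← norm_neg]; congr 1; abel
    · rw [Finset.card_range, nsmul_eq_mul]
  have hFi : ∀ b, Integrable fun w => F (w + b) := by
    intro b
    exact (hF.comp (continuous_add_const b)).integrable_of_hasCompactSupport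
      (HasCompactSupport.of_compactSpace _)
  have hint : ∫ w, Γ w = N * ∫ w, F w := by
    simp only [hΓ]
    rw [integral_finsetSum _ fun n _ => hFi _]
    simp only [integral_add_right_eq_self]
    rw [Finset.sum_const, Finset.card_range, nsmul_eq_mul]
  have hΓi : Integrable Γ := integrable_finsetSum _ fun n _ => hFi _
  have e1 : Γ z - ∫ w, Γ w = ∫ w, (Γ z - Γ w) := by
    rw [integral_sub (integrable_const _) hΓi]; simp
  rw [← hint]
  change |Γ z - ∫ w, Γ w| ≤ _
  rw [e1, ← Real.norm_eq_abs]
  have := norm_integral_le_of_norm_le_const (μ := (volume : Measure Torus2))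
    (f := fun w => Γ z - Γ w) (C := N * e) (ae_of_all _ fun w => hosc z w)
  simpa using this

theorem nsmul_vec (n : ℕ) (a b : ℝ) :
    n • vec a b = (((n * a : ℝ) : UnitAddCircle), ((n * b : ℝ) : UnitAddCircle)) := by
  have h : ∀ c : ℝ, n • (c : UnitAddCircle) = ((n * c : ℝ) : UnitAddCircle) := by
    intro c
    rw [← AddCircle.coe_nsmul, nsmul_eq_mul]
  refine Prod.ext (h a) (h b)

/-- The rotation of the flow. -/
abbrev rvec : Torus2 := vec (rot 0) (rot 1)

theorem coe_natCast_eq_zero (n : ℕ) : ((n : ℝ) : UnitAddCircle) = 0 :=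
  (AddCircle.coe_eq_zero_iff (1 : ℝ)).2 ⟨n, by simp⟩

/-- The rational rotation approximating the rotation of the flow at odd stages. -/
def avec (i : ℕ) : Torus2 := vec (angleApprox (freqOf 0) i) (angleApprox (freqOf 1) i)

theorem nsmul_avec (i : ℕ) : freq (2 * i + 1) • avec i = 0 := by
  obtain ⟨p, -, hp⟩ := (tower 0).exists_coprime i
  obtain ⟨p', -, hp'⟩ := (tower 1).exists_coprime i
  obtain ⟨c, hc⟩ := freq_dvd_of_le (show 2 * i ≤ 2 * i + 1 by omega)
  have q0 : (freq (2 * i) : ℝ) ≠ 0 := by exact_mod_cast (freq_pos _).ne'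
  have q1 : (freq (2 * i + 1) : ℝ) ≠ 0 := by exact_mod_cast (freq_pos _).ne'
  rw [avec, nsmul_vec, hp, hp']
  refine Prod.ext ?_ ?_
  · have : (freq (2 * i + 1) : ℝ) * (p / freqOf 0 i) = ((c * p : ℕ) : ℝ) := by
      rw [hc]; unfold freqOf; rw [add_zero]; push_cast; field_simp
    simp only [this, coe_natCast_eq_zero]
    rfl
  · have : (freq (2 * i + 1) : ℝ) * (p' / freqOf 1 i) = (p' : ℝ) := by
      unfold freqOf; field_simp
    simp only [this, coe_natCast_eq_zero]
    rfl

/-- The orbit of the rational rotation is dense at the scale `1 / freq (2 i)`: as `freq (2 i + 1)`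
is a multiple of `freq (2 i) ^ 2`, the times divisible by `freq (2 i)` fix the first coordinate and
still fill the second one. -/
theorem dense_avec (i : ℕ) (w : Torus2) : ∃ n : ℕ, dist w (n • avec i) ≤ 1 / freq (2 * i) := by
  obtain ⟨p, hpc, hp⟩ := (tower 0).exists_coprime i
  obtain ⟨p', hpc', hp'⟩ := (tower 1).exists_coprime i
  obtain ⟨c, hc⟩ := two_mul_sq_dvd_freq (2 * i)
  have q0 : (freq (2 * i) : ℝ) ≠ 0 := by exact_mod_cast (freq_pos _).ne'
  have e0 : freqOf 0 i = freq (2 * i) := rfl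
  set q := freq (2 * i) with hq
  have hqpos : 0 < q := freq_pos _
  set M := 2 * q * c with hM
  have e1 : freqOf 1 i = q * M := by
    change freq (2 * i + 1) = _
    rw [hc, hM]; ring
  have hMpos : 0 < M := by
    have := (tower 1).pos i
    rw [e1] at this
    exact Nat.pos_of_mul_pos_left this
  have hqM : q ≤ M := by
    have : 0 < c := by
      rcases Nat.eq_zero_or_pos c with h | h
      · simp [hM, h] at hMpos
      · exact h
    nlinarith
  have M0 : (M : ℝ) ≠ 0 := by exact_mod_cast hMpos.ne'
  obtain ⟨x, y⟩ := w
  induction x using QuotientAddGroup.induction_on with | H x =>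
  induction y using QuotientAddGroup.induction_on with | H y =>
  rw [e0] at hpc hp
  rw [e1] at hpc' hp'
  obtain ⟨n, hn⟩ := exists_nsmul_near hqpos hpc x
  obtain ⟨l, hl⟩ := exists_nsmul_near hMpos (hpc'.coprime_dvd_right ⟨q, by ring⟩)
    (y - n * (p' / (q * M : ℕ)))
  refine ⟨n + q * l, ?_⟩
  rw [avec, nsmul_vec, hp, hp', Prod.dist_eq]
  refine max_le ?_ ?_
  · change dist (x : UnitAddCircle) _ ≤ _
    have e : ((n + q * l : ℕ) : ℝ) * (p / q) = n * (p / q) + ((l * p : ℕ) : ℝ) := by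
      push_cast; field_simp
    simp only [e]
    rw [dist_eq_norm, AddCircle.coe_add, coe_natCast_eq_zero, add_zero, ← AddCircle.coe_sub]
    exact hn
  · change dist (y : UnitAddCircle) _ ≤ _
    have e : y - ((n + q * l : ℕ) : ℝ) * (p' / (q * M : ℕ)) =
        y - n * (p' / (q * M : ℕ)) - l * (p' / M) := by
      push_cast; field_simp; ring
    rw [dist_eq_norm, ← AddCircle.coe_sub]
    simp only [e]
    refine hl.trans ?_
    gcongr

theorem dist_nsmul_le (i n : ℕ) (z : Torus2) :
    dist (z + n • rvec) (z + n • avec i) ≤ n * (2 / freq (2 * i + 2)) := by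
  rw [dist_add_left, rvec, avec, nsmul_vec, nsmul_vec, Prod.dist_eq]
  have aux : ∀ a b e : ℝ, |a - b| ≤ e →
      dist ((n * a : ℝ) : UnitAddCircle) ((n * b : ℝ) : UnitAddCircle) ≤ n * e := by
    intro a b e h
    rw [dist_eq_norm, ← AddCircle.coe_sub, ← mul_sub]
    refine (norm_coe_le_abs _).trans ?_
    rw [abs_mul, Nat.abs_cast]
    gcongr
  refine max_le (aux _ _ _ ((tower 0).abs_angle_sub_le i))
    (aux _ _ _ (((tower 1).abs_angle_sub_le i).trans ?_))
  have h1 : (0 : ℝ) < freq (2 * i + 2) := by exact_mod_cast freq_pos _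
  have h2 : (freq (2 * i + 2) : ℝ) ≤ freqOf 1 (i + 1) :=
    Nat.cast_le.2 (freq_strictMono.monotone (by omega))
  gcongr

theorem tendsto_freq : Tendsto (fun k => (freq k : ℝ)) atTop atTop :=
  tendsto_natCast_atTop_atTop.comp freq_strictMono.tendsto_atTop

/-- Uniform equidistribution along the odd frequencies. -/
theorem eventually_equidistribution {F : Torus2 → ℝ} (hF : Continuous F) {ε : ℝ} (hε : 0 < ε) :
    ∀ᶠ i : ℕ in atTop, ∀ z : Torus2,
      |∑ n ∈ Finset.range (freq (2 * i + 1)), F (z + n • rvec) -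
        freq (2 * i + 1) * ∫ w, F w| ≤ freq (2 * i + 1) * ε := by
  have huc : UniformContinuous F := CompactSpace.uniformContinuous_of_continuous hF
  obtain ⟨δ, hδ, hFδ⟩ := Metric.uniformContinuous_iff.1 huc (ε / 2) (half_pos hε)
  have h2i : Tendsto (fun i : ℕ => 2 * i) atTop atTop :=
    tendsto_id.const_mul_atTop' (by norm_num)
  filter_upwards [(tendsto_freq.comp h2i).eventually_gt_atTop (1 / δ)] with i hi z
  have q0 : (0 : ℝ) < freq (2 * i) := by exact_mod_cast freq_pos _
  have q1 : (0 : ℝ) < freq (2 * i + 1) := by exact_mod_cast freq_pos _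
  have hq : 1 / (freq (2 * i) : ℝ) < δ := by
    rw [div_lt_iff₀ q0]
    have : 1 / δ < freq (2 * i) := hi
    rw [div_lt_iff₀ hδ] at this
    linarith
  set N := freq (2 * i + 1) with hN
  have hFe : ∀ z w, dist z w ≤ 1 / freq (2 * i) → |F z - F w| ≤ ε / 2 := fun z w h =>
    (hFδ (h.trans_lt hq)).le
  have h1 := abs_sum_sub_integral_le hF hFe (nsmul_avec i) (dense_avec i) z
  have h2 : |∑ n ∈ Finset.range N, F (z + n • rvec) - ∑ n ∈ Finset.range N, F (z + n • avec i)| ≤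
      N * (ε / 2) := by
    rw [← Finset.sum_sub_distrib]
    refine (Finset.abs_sum_le_sum_abs _ _).trans ((Finset.sum_le_card_nsmul _ _ (ε / 2)
      fun n hn => hFe _ _ ((dist_nsmul_le i n z).trans ?_)).trans ?_)
    · have h3 : (n : ℝ) ≤ N := by exact_mod_cast (Finset.mem_range.1 hn).le
      have h4 : (2 * (N : ℝ) ^ 2) ≤ freq (2 * i + 2) := by
        have := Nat.le_of_dvd (freq_pos _) (two_mul_sq_dvd_freq (2 * i + 1))
        exact_mod_cast this
      have h5 : (freq (2 * i) : ℝ) ≤ N := Nat.cast_le.2 (freq_strictMono.monotone (by omega))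
      calc (n : ℝ) * (2 / freq (2 * i + 2)) ≤ N * (2 / (2 * (N : ℝ) ^ 2)) := by gcongr
        _ = 1 / N := by field_simp
        _ ≤ 1 / freq (2 * i) := by gcongr
    · rw [Finset.card_range, nsmul_eq_mul]
  rw [abs_le] at *
  constructor <;> linarith

/-! ### Unique ergodicity of the flow -/

/-- The integral of `g` over the fibre of the fundamental domain. -/
def fibre (φ : Ceiling) (g : Torus2 × ℝ → ℝ) (z : Torus2) : ℝ := ∫ s in (0 : ℝ)..φ z, g (z, s)

theorem continuous_fibre (φ : Ceiling) {g : Torus2 × ℝ → ℝ} (hg : Continuous g) :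
    Continuous (fibre φ g) :=
  intervalIntegral.continuous_parametric_intervalIntegral_of_continuous
    (f := fun z s => g (z, s)) hg φ.continuous

theorem integral_domain (φ : Ceiling) {g : Torus2 × ℝ → ℝ}
    (hi : IntegrableOn g (domain φ)) : ∫ p in domain φ, g p = ∫ z, fibre φ g z := by
  have hD := measurableSet_domain (φ := φ)
  rw [← integral_indicator hD, Measure.volume_eq_prod, integral_prod]
  · refine integral_congr_ae (ae_of_all _ fun z => ?_)
    have e : ∀ s, (domain φ).indicator g (z, s) =
        (Set.Ico 0 (φ z)).indicator (fun s => g (z, s)) s := fun s => rfl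
    simp only [e]
    rw [integral_indicator measurableSet_Ico, fibre, intervalIntegral.integral_of_le (φ.pos' z).le,
      integral_Ico_eq_integral_Ioo, integral_Ioc_eq_integral_Ioo]
  · rw [← Measure.volume_eq_prod]
    exact hi.integrable_indicator hD

theorem integrableOn_domain (φ : Ceiling) {g : Torus2 × ℝ → ℝ} (hg : Continuous g) {C : ℝ}
    (hC : ∀ p, |g p| ≤ C) : IntegrableOn g (domain φ) :=
  Measure.integrableOn_of_bounded (exists_volume_domain φ).2 hg.measurable.aestronglyMeasurable
    (M := C) (ae_of_all _ fun p => hC p)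

theorem vol_eq_integral (φ : Ceiling) : vol φ = ∫ z, φ z := by
  have h := integral_domain φ (g := fun _ => 1)
    (integrableOn_domain φ continuous_const (C := 1) (by simp))
  have h1 : ∫ p in domain φ, (1 : ℝ) = vol φ := by
    rw [setIntegral_const, smul_eq_mul, mul_one]; rfl
  rw [← h1, h]
  refine integral_congr_ae (ae_of_all _ fun z => ?_)
  simp [fibre]

section

variable {α α' : ℝ} {φ : Ceiling}

theorem Invariant.apply_add_bsum {β : Type*} {g : Torus2 × ℝ → β} (hg : Invariant α α' φ g)
    (n : ℕ) (z : Torus2) (u : ℝ) : g (z, u + bsum α α' φ n z) = g (z + n • vec α α', u) := by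
  rw [← hg.pow n, glue_pow_apply]
  simp

/-- The integral along an orbit segment over `n` full fibres. -/
theorem Invariant.integral_bsum {g : Torus2 × ℝ → ℝ} (hg : Invariant α α' φ g)
    (hc : Continuous g) (n : ℕ) (z : Torus2) :
    ∫ u in (0 : ℝ)..bsum α α' φ n z, g (z, u) =
      ∑ i ∈ Finset.range n, fibre φ g (z + i • vec α α') := by
  have hii : ∀ a b, IntervalIntegrable (fun u => g (z, u)) volume a b := fun a b =>
    (hc.comp (by fun_prop : Continuous fun u : ℝ => (z, u))).intervalIntegrable a b
  induction n with
  | zero => simp [bsum]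
  | succ n ih =>
    rw [Finset.sum_range_succ, ← ih,
      ← intervalIntegral.integral_add_adjacent_intervals (hii 0 (bsum α α' φ n z))
        (hii _ (bsum α α' φ (n + 1) z))]
    congr 1
    have e : bsum α α' φ (n + 1) z = φ (z + n • vec α α') + bsum α α' φ n z := by
      rw [bsum, bsum, Finset.sum_range_succ, add_comm]
    have h := intervalIntegral.integral_comp_add_right (fun u => g (z, u)) (bsum α α' φ n z)
      (a := 0) (b := φ (z + n • vec α α'))
    rw [zero_add, ← e] at h
    rw [← h, fibre]
    simp only [hg.apply_add_bsum]

end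

theorem abs_intervalIntegral_le {f : ℝ → ℝ} {C : ℝ} (hC : ∀ u, |f u| ≤ C) (a b : ℝ) :
    |∫ u in a..b, f u| ≤ C * |b - a| := by
  rw [← Real.norm_eq_abs (∫ u in a..b, f u)]
  exact intervalIntegral.norm_integral_le_of_norm_le_const fun u _ => hC u

/-- For some window length, the averages of a continuous function along the flow are close to its
mean, uniformly over the starting points. -/
theorem exists_window {g : Torus2 × ℝ → ℝ} (hg : Invariant (rot 0) (rot 1) roof g)
    (hc : Continuous g) {ε : ℝ} (hε : 0 < ε) : ∃ H₀ : ℝ, 0 < H₀ ∧ ∀ p : Torus2 × ℝ,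
      |(∫ v in (0 : ℝ)..H₀, g (vertical v p)) - (∫ p in domain roof, g p) / vol roof * H₀| ≤
        ε * H₀ := by
  obtain ⟨C, hC0, hC⟩ := hg.exists_bound hc
  have V0 := vol_pos roof
  have hcont : ∀ z : Torus2, Continuous fun u : ℝ => g (z, u) := fun z =>
    hc.comp (by fun_prop : Continuous fun u : ℝ => (z, u))
  set e : ℝ := ε * vol roof / (C + 2) with he
  have e0 : 0 < e := by positivity
  have h2i : Tendsto (fun i : ℕ => 2 * i + 1) atTop atTop :=
    tendsto_atTop_mono (fun i => by simp only [id]; omega) tendsto_id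
  obtain ⟨i, hi1, hi2, hi3⟩ := ((eventually_equidistribution (continuous_fibre roof hc) e0).and
    ((eventually_equidistribution roof.continuous e0).and
      ((tendsto_freq.comp h2i).eventually_ge_atTop (3 * C / e)))).exists
  set N := freq (2 * i + 1) with hN
  have N0 : (0 : ℝ) < N := by exact_mod_cast freq_pos _
  have hN3 : 3 * C ≤ N * e := by
    have : 3 * C / e ≤ N := hi3
    rwa [div_le_iff₀ e0] at this
  refine ⟨N * vol roof, by positivity, fun p => ?_⟩
  obtain ⟨j, hj⟩ := exists_glue_mem_domain (α := rot 0) (α' := rot 1) (φ := roof) p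
  set q := (glue (rotation (rot 0) (rot 1)) roof ^ j) p with hq
  have hpq : ∀ v, g (vertical v p) = g (q.1, v + q.2) := by
    intro v
    have h1 := (hg.vertical v).zpow j p
    rw [← h1, ← hq, vertical, add_comm]
  simp only [hpq]
  rw [intervalIntegral.integral_comp_add_right (fun u => g (q.1, u)), zero_add]
  have hii : ∀ a b, IntervalIntegrable (fun u => g (q.1, u)) volume a b := fun a b =>
    (hcont q.1).intervalIntegrable a b
  set S := bsum (rot 0) (rot 1) roof N q.1 with hS
  have a1 := hi1 q.1
  have a2 : |S - N * vol roof| ≤ N * e := by rw [vol_eq_integral]; exact hi2 q.1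
  rw [← hg.integral_bsum hc, ← hS, ← integral_domain roof (integrableOn_domain roof hc hC)]
    at a1
  have s1 := intervalIntegral.integral_add_adjacent_intervals (hii 0 q.2)
    (hii q.2 (N * vol roof + q.2))
  have s2 := intervalIntegral.integral_add_adjacent_intervals (hii 0 S)
    (hii S (N * vol roof + q.2))
  have b1 := abs_intervalIntegral_le (f := fun u => g (q.1, u)) (fun u => hC _) 0 q.2
  have b2 := abs_intervalIntegral_le (f := fun u => g (q.1, u)) (fun u => hC _) S
    (N * vol roof + q.2)
  have q0 : 0 ≤ q.2 := hj.1
  have q1 : q.2 ≤ 3 / 2 := hj.2.le.trans (roof_bounds _).2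
  have b1' : C * |q.2 - 0| ≤ C * (3 / 2) := by
    rw [sub_zero, abs_of_nonneg q0]; gcongr
  have b2' : C * |N * vol roof + q.2 - S| ≤ C * (N * e + 3 / 2) := by
    gcongr
    rw [abs_le] at a2 ⊢
    constructor <;> linarith
  have e1 : (∫ p in domain roof, g p) / vol roof * (N * vol roof) =
      N * ∫ p in domain roof, g p := by field_simp
  have e2 : ε * (N * vol roof) = N * e * (C + 2) := by rw [he]; field_simp
  rw [e1, e2]
  rw [abs_le] at a1 b1 b2 ⊢
  constructor <;> nlinarith

/-- For all long windows, the averages of a continuous function along the flow are close to its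
mean, uniformly over the starting points. -/
theorem exists_forall_window {g : Torus2 × ℝ → ℝ} (hg : Invariant (rot 0) (rot 1) roof g)
    (hc : Continuous g) {ε : ℝ} (hε : 0 < ε) :
    ∃ H₁ : ℝ, 0 < H₁ ∧ ∀ H : ℝ, H₁ ≤ H → ∀ p : Torus2 × ℝ,
      |(∫ v in (0 : ℝ)..H, g (vertical v p)) - (∫ p in domain roof, g p) / vol roof * H| ≤
        ε * H := by
  obtain ⟨C, hC0, hC⟩ := hg.exists_bound hc
  obtain ⟨H₀, hH₀, hw⟩ := exists_window hg hc (half_pos hε)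
  set c := (∫ p in domain roof, g p) / vol roof with hcdef
  have hcont : ∀ p : Torus2 × ℝ, Continuous fun v : ℝ => g (vertical v p) := fun p =>
    hc.comp (by unfold vertical; fun_prop)
  have hii : ∀ p a b, IntervalIntegrable (fun v => g (vertical v p)) volume a b := fun p a b =>
    (hcont p).intervalIntegrable a b
  have hblock : ∀ (n : ℕ) (p : Torus2 × ℝ),
      |(∫ v in (0 : ℝ)..n * H₀, g (vertical v p)) - c * (n * H₀)| ≤ ε / 2 * (n * H₀) := by
    intro n p
    induction n with
    | zero => simp
    | succ n ih =>
      have h1 := intervalIntegral.integral_add_adjacent_intervals (hii p 0 (n * H₀))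
        (hii p (n * H₀) ((n + 1 : ℕ) * H₀))
      have h2 : ∫ v in (n * H₀)..((n + 1 : ℕ) * H₀), g (vertical v p) =
          ∫ v in (0 : ℝ)..H₀, g (vertical v (vertical (n * H₀) p)) := by
        have := intervalIntegral.integral_comp_add_right (fun v => g (vertical v p)) (n * H₀)
          (a := 0) (b := H₀)
        rw [zero_add] at this
        have e : ((n + 1 : ℕ) : ℝ) * H₀ = H₀ + n * H₀ := by push_cast; ring
        rw [e, ← this]
        refine intervalIntegral.integral_congr fun v _ => ?_
        simp only [vertical]
        congr 2
        ring
      have h3 := hw (vertical (n * H₀) p)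
      rw [← h1, h2]
      have e1 : c * (((n + 1 : ℕ) : ℝ) * H₀) = c * (n * H₀) + c * H₀ := by push_cast; ring
      have e2 : ε / 2 * (((n + 1 : ℕ) : ℝ) * H₀) = ε / 2 * (n * H₀) + ε / 2 * H₀ := by
        push_cast; ring
      rw [e1, e2]
      rw [abs_le] at *
      constructor <;> linarith
  have hcC : 0 ≤ |c| := abs_nonneg c
  refine ⟨max H₀ (2 * ((C + |c|) * H₀) / ε), lt_max_of_lt_left hH₀, fun H hH p => ?_⟩
  have hH1 : H₀ ≤ H := (le_max_left _ _).trans hH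
  have hH2 : 2 * ((C + |c|) * H₀) ≤ H * ε := (div_le_iff₀ hε).1 ((le_max_right _ _).trans hH)
  set n := ⌊H / H₀⌋₊ with hn
  have n1 : n * H₀ ≤ H := by
    have := Nat.floor_le (div_nonneg (hH₀.le.trans hH1) hH₀.le)
    rwa [le_div_iff₀ hH₀] at this
  have n2 : H < n * H₀ + H₀ := by
    have := Nat.lt_floor_add_one (H / H₀)
    rw [div_lt_iff₀ hH₀, ← hn] at this
    linarith
  have h1 := intervalIntegral.integral_add_adjacent_intervals (hii p 0 (n * H₀))
    (hii p (n * H₀) H)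
  have h2 := hblock n p
  have h3 := abs_intervalIntegral_le (f := fun v => g (vertical v p)) (fun u => hC _) (n * H₀) H
  have h4 : C * |H - n * H₀| ≤ C * H₀ := by
    gcongr
    rw [abs_of_nonneg (by linarith)]
    linarith
  have h5 : |c * (H - n * H₀)| ≤ |c| * H₀ := by
    rw [abs_mul, abs_of_nonneg (by linarith : 0 ≤ H - n * H₀)]
    gcongr
    linarith
  have h6 : ε / 2 * (n * H₀) ≤ ε / 2 * H := by gcongr
  rw [← h1]
  rw [abs_le] at *
  constructor <;> nlinarith

/-! ### Stretching of short horizontal segments -/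

/-- The coordinate of index `c % 2` of a point of the torus. -/
def coord (c : ℕ) (z : Torus2) : UnitAddCircle := if c % 2 = 0 then z.1 else z.2

/-- The translation by `r` in the coordinate of index `c % 2`. -/
def dir (c : ℕ) (r : ℝ) : Torus2 := if c % 2 = 0 then ((r : UnitAddCircle), 0) else (0, r)

theorem norm_dir_le (c : ℕ) (r : ℝ) : ‖dir c r‖ ≤ |r| := by
  unfold dir
  split_ifs
  · rw [Prod.norm_def, norm_zero, max_eq_left (norm_nonneg _)]
    exact norm_coe_le_abs r
  · rw [Prod.norm_def, norm_zero, max_eq_right (norm_nonneg _)]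
    exact norm_coe_le_abs r

theorem continuous_dir (c : ℕ) : Continuous (dir c) := by
  have h : Continuous fun r : ℝ => (r : UnitAddCircle) := AddCircle.continuous_mk' 1
  unfold dir
  split_ifs
  · exact h.prodMk continuous_const
  · exact continuous_const.prodMk h

theorem bsum_roof (m : ℕ) (x y : ℝ) :
    bsum (rot 0) (rot 1) roof m ((x : UnitAddCircle), (y : UnitAddCircle)) =
      m + Tower.birk (freqOf 0) (waveOf 0) m x + Tower.birk (freqOf 1) (waveOf 1) m y := by
  have h : ∀ n : ℕ, roof (((x : UnitAddCircle), (y : UnitAddCircle)) + n • vec (rot 0) (rot 1)) =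
      1 + Tower.total (waveOf 0) (x + n * rot 0) + Tower.total (waveOf 1) (y + n * rot 1) := by
    intro n
    rw [nsmul_vec]
    change 1 + part 0 ((x : UnitAddCircle) + ((n * rot 0 : ℝ) : UnitAddCircle)) +
      part 1 ((y : UnitAddCircle) + ((n * rot 1 : ℝ) : UnitAddCircle)) = _
    rw [← AddCircle.coe_add, ← AddCircle.coe_add, part_coe, part_coe]
  simp only [bsum, h, Finset.sum_add_distrib, Tower.birk]
  simp [rot]

/-- A horizontal displacement changes the Birkhoff sums through one coordinate only. -/
theorem bsum_roof_add_dir (c i m : ℕ) (hc : c < 2) {x : ℝ} {z : Torus2}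
    (hx : coord (2 * i + c) z = x) (r : ℝ) :
    bsum (rot 0) (rot 1) roof m (z + dir (2 * i + c) r) - bsum (rot 0) (rot 1) roof m z =
      Tower.birk (freqOf c) (waveOf c) m (x + r) - Tower.birk (freqOf c) (waveOf c) m x := by
  obtain ⟨u, v⟩ := z
  have hmod : (2 * i + c) % 2 = c := by omega
  unfold coord at hx
  unfold dir
  rw [hmod] at hx ⊢
  interval_cases c
  · simp only [if_true] at hx ⊢
    subst hx
    induction v using QuotientAddGroup.induction_on with | H y =>
    change bsum _ _ _ m ((x : UnitAddCircle) + (r : UnitAddCircle), (y : UnitAddCircle) + 0) -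
      bsum _ _ _ m ((x : UnitAddCircle), (y : UnitAddCircle)) = _
    rw [add_zero, ← AddCircle.coe_add, bsum_roof, bsum_roof]
    ring
  · simp only [one_ne_zero, if_false] at hx ⊢
    subst hx
    induction u using QuotientAddGroup.induction_on with | H y =>
    change bsum _ _ _ m ((y : UnitAddCircle) + 0, (x : UnitAddCircle) + (r : UnitAddCircle)) -
      bsum _ _ _ m ((y : UnitAddCircle), (x : UnitAddCircle)) = _
    rw [add_zero, ← AddCircle.coe_add, bsum_roof, bsum_roof]
    ring

/-- Away from the quarter-integers both the sine and the cosine are bounded below. -/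
theorem le_abs_sin_cos {η u : ℝ} (h : η ≤ ‖((4 * u : ℝ) : UnitAddCircle)‖) :
    η ≤ |Real.sin (2 * Real.pi * u)| ∧ η ≤ |Real.cos (2 * Real.pi * u)| := by
  rw [UnitAddCircle.norm_eq] at h
  set v := 4 * u - round (4 * u) with hv
  have hv2 : |v| ≤ 1 / 2 := abs_sub_round _
  have h1 : 2 * |v| ≤ Real.sin (Real.pi * |v|) := by
    have := Real.mul_le_sin (x := Real.pi * |v|) (by positivity) (by
      nlinarith [Real.pi_pos])
    refine le_trans (le_of_eq ?_) this
    field_simp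
  have h2 : |Real.sin (Real.pi * (4 * u))| = |Real.sin (Real.pi * v)| := by
    have e : Real.pi * (4 * u) = Real.pi * v + (round (4 * u) : ℤ) * Real.pi := by rw [hv]; ring
    rw [e, Real.sin_add_int_mul_pi, abs_mul, abs_zpow, abs_neg, abs_one, one_zpow, one_mul]
  have h3 : |Real.sin (Real.pi * v)| = Real.sin (Real.pi * |v|) := by
    rcases abs_cases v with ⟨e, -⟩ | ⟨e, -⟩
    · rw [e]; rw [e] at h1; exact abs_of_nonneg (le_trans (by rw [← e]; positivity) h1)
    · rw [e] at h1 ⊢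
      have h0 : 0 ≤ 2 * -v := by rw [← e]; positivity
      rw [mul_neg Real.pi v, Real.sin_neg] at h1 ⊢
      exact abs_of_nonpos (by linarith)
  have h4 : Real.sin (Real.pi * (4 * u)) =
      2 * Real.sin (2 * Real.pi * u) * Real.cos (2 * Real.pi * u) := by
    rw [← Real.sin_two_mul]; congr 1; ring
  rw [h4, abs_mul, abs_mul, abs_two] at h2
  have s1 := Real.abs_sin_le_one (2 * Real.pi * u)
  have s2 := Real.abs_cos_le_one (2 * Real.pi * u)
  have s3 := abs_nonneg (Real.sin (2 * Real.pi * u))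
  have s4 := abs_nonneg (Real.cos (2 * Real.pi * u))
  constructor <;> nlinarith

theorem amp_le_one (k : ℕ) : amp k ≤ 1 := by
  have h0 : 0 ≤ ∑ i ∈ Finset.range (k + 2), profileBound (invWidth k) (freq k) i :=
    Finset.sum_nonneg fun i _ => profileBound_nonneg _ _ _
  have h1 : (1 : ℝ) ≤ freq k := by exact_mod_cast freq_pos k
  unfold amp ampOf
  refine (div_le_self (by positivity) (by linarith)).trans
    ((div_le_self (by positivity) h1).trans ?_)
  exact pow_le_one₀ (by norm_num) (by norm_num)

theorem le_start (k : ℕ) : (k : ℝ) + 1 ≤ start k := by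
  unfold start startOf
  rw [le_div_iff₀ (amp_pos k)]
  have := amp_le_one k
  nlinarith

theorem bsum_bounds (m : ℕ) (z : Torus2) :
    (m : ℝ) / 2 ≤ bsum (rot 0) (rot 1) roof m z ∧
      bsum (rot 0) (rot 1) roof m z ≤ 3 / 2 * m := by
  have h1 := Finset.card_nsmul_le_sum (Finset.range m)
    (fun i => roof (z + i • vec (rot 0) (rot 1))) (1 / 2) fun i _ => (roof_bounds _).1
  have h2 := Finset.sum_le_card_nsmul (Finset.range m)
    (fun i => roof (z + i • vec (rot 0) (rot 1))) (3 / 2) fun i _ => (roof_bounds _).2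
  rw [Finset.card_range, nsmul_eq_mul] at h1 h2
  unfold bsum
  constructor <;> linarith

/-- The number of returns to the base before time `w`. -/
theorem exists_return (z : Torus2) {w : ℝ} (hw : 0 ≤ w) : ∃ m : ℕ,
    0 ≤ w - bsum (rot 0) (rot 1) roof m z ∧ w - bsum (rot 0) (rot 1) roof m z ≤ 3 / 2 ∧
      (m : ℝ) ≤ 2 * w ∧ 2 / 3 * w - 1 ≤ m := by
  classical
  have hex : ∃ n : ℕ, w < bsum (rot 0) (rot 1) roof (n + 1) z := by
    obtain ⟨n, hn⟩ := exists_nat_gt (2 * w)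
    refine ⟨n, ?_⟩
    have := (bsum_bounds (n + 1) z).1
    push_cast at this
    linarith
  set m := Nat.find hex with hm
  have h1 : w < bsum (rot 0) (rot 1) roof (m + 1) z := Nat.find_spec hex
  have h2 : bsum (rot 0) (rot 1) roof m z ≤ w := by
    rcases Nat.eq_zero_or_pos m with h | h
    · rw [h]; simpa [bsum] using hw
    · have := Nat.find_min hex (m := m - 1) (by omega)
      rw [Nat.sub_add_cancel h] at this
      exact not_lt.1 this
  have h3 : bsum (rot 0) (rot 1) roof (m + 1) z = bsum (rot 0) (rot 1) roof m z +
      roof (z + m • vec (rot 0) (rot 1)) := Finset.sum_range_succ _ _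
  have h4 := (roof_bounds (z + m • vec (rot 0) (rot 1))).2
  have h5 := (bsum_bounds m z).1
  have h6 := (bsum_bounds (m + 1) z).2
  push_cast at h6
  exact ⟨m, by linarith, by linarith, by linarith, by linarith⟩

/-- Averages along the flow are still close to the mean if the flow is run at a constant speed `D`
of either sign, for a time in which it covers a long window. -/
theorem abs_integral_speed_le {g : Torus2 × ℝ → ℝ} {c ε H₁ : ℝ}
    (hw : ∀ H : ℝ, H₁ ≤ H → ∀ p : Torus2 × ℝ,
      |(∫ v in (0 : ℝ)..H, g (vertical v p)) - c * H| ≤ ε * H) {D δ : ℝ} (hδ : 0 < δ) (hD : D ≠ 0)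
    (h : H₁ ≤ |D| * δ) (p : Torus2 × ℝ) :
    |(∫ r in (0 : ℝ)..δ, g (vertical (D * r) p)) - c * δ| ≤ ε * δ := by
  rw [intervalIntegral.integral_comp_mul_left (fun v => g (vertical v p)) hD, mul_zero,
    smul_eq_mul]
  rcases lt_or_gt_of_ne hD with hneg | hpos
  · have h1 := hw (-D * δ) (by rwa [abs_of_neg hneg] at h) (vertical (D * δ) p)
    have h2 : ∫ v in (0 : ℝ)..(-D * δ), g (vertical v (vertical (D * δ) p)) =
        -∫ v in (0 : ℝ)..(D * δ), g (vertical v p) := by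
      have := intervalIntegral.integral_comp_add_right (fun v => g (vertical v p)) (D * δ)
        (a := 0) (b := -D * δ)
      rw [zero_add, show -D * δ + D * δ = 0 by ring] at this
      rw [← intervalIntegral.integral_symm, ← this]
      refine intervalIntegral.integral_congr fun v _ => ?_
      simp only [vertical]
      congr 2
      ring
    rw [h2] at h1
    have e : D⁻¹ * (∫ v in (0 : ℝ)..(D * δ), g (vertical v p)) - c * δ =
        (-D)⁻¹ * (-(∫ v in (0 : ℝ)..(D * δ), g (vertical v p)) - c * (-D * δ)) := by
      field_simp
      ring
    rw [e, abs_mul, abs_of_pos (inv_pos.2 (neg_pos.2 hneg))]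
    calc (-D)⁻¹ * _ ≤ (-D)⁻¹ * (ε * (-D * δ)) :=
          mul_le_mul_of_nonneg_left h1 (inv_pos.2 (neg_pos.2 hneg)).le
      _ = ε * δ := by field_simp
  · have h1 := hw (D * δ) (by rwa [abs_of_pos hpos] at h) p
    have e : D⁻¹ * (∫ v in (0 : ℝ)..(D * δ), g (vertical v p)) - c * δ =
        D⁻¹ * ((∫ v in (0 : ℝ)..(D * δ), g (vertical v p)) - c * (D * δ)) := by
      field_simp
    rw [e, abs_mul, abs_of_pos (inv_pos.2 hpos)]
    calc D⁻¹ * _ ≤ D⁻¹ * (ε * (D * δ)) := mul_le_mul_of_nonneg_left h1 (inv_pos.2 hpos).le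
      _ = ε * δ := by field_simp

/-- In the time window of stage `k`, the next frequency of the same coordinate dwarfs `t ^ 2`. -/
theorem window_estimates {k : ℕ} {t : ℝ} (ht1 : start k ≤ t) (ht2 : t ≤ start (k + 1)) :
    freq k * t / freq (k + 2) ≤ 1 / (k + 1) ∧ t ^ 2 / freq (k + 2) ≤ 1 / (k + 1) := by
  have htk : (k : ℝ) + 1 ≤ t := (le_start k).trans ht1
  have t1 : 1 ≤ t := by
    have : (0 : ℝ) ≤ k := Nat.cast_nonneg k
    linarith
  have t0 : 0 < t := by linarith
  have Q0 : (0 : ℝ) < freq (k + 2) := by exact_mod_cast freq_pos _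
  have k0 : (0 : ℝ) < (k : ℝ) + 1 := by positivity
  have hsq : freq (k + 1) * t ^ 2 / freq (k + 2) ≤ 1 / (k + 1) := by
    have h1 := start_sq_le_freq_succ (k + 1)
    rw [div_le_div_iff₀ Q0 k0, one_mul]
    have h2 : t ^ 2 ≤ start (k + 1) ^ 2 := by gcongr
    have h3 : (k : ℝ) + 1 ≤ (k + 1 : ℕ) + 1 := by push_cast; linarith
    calc (freq (k + 1) : ℝ) * t ^ 2 * (k + 1) ≤
          freq (k + 1) * start (k + 1) ^ 2 * ((k + 1 : ℕ) + 1) := by gcongr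
      _ = ((k + 1 : ℕ) + 1) * start (k + 1) ^ 2 * freq (k + 1) := by ring
      _ ≤ _ := h1
  have hq1 : (freq k : ℝ) ≤ freq (k + 1) := Nat.cast_le.2 (freq_strictMono.monotone (by omega))
  have hone : (1 : ℝ) ≤ freq (k + 1) := by exact_mod_cast freq_pos (k + 1)
  constructor
  · refine le_trans ?_ hsq
    have : t ≤ t ^ 2 := by nlinarith
    gcongr
  · refine le_trans ?_ hsq
    gcongr
    nlinarith [sq_nonneg t]

/-- Near a point where the sine wave of stage `k` is not small, the `k`-th term is a sine wave. -/
theorem wave_eq_sin {k : ℕ} {η x x' : ℝ} (hk : 20 ≤ η * invWidth k)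
    (hx : η ≤ |Real.sin (2 * Real.pi * freq k * x)|) (h : 14 * (freq k * |x' - x|) ≤ η) :
    wave k x' = amp k * Real.sin (2 * Real.pi * freq k * x') := by
  have q0 : (0 : ℝ) < freq k := by exact_mod_cast freq_pos k
  unfold wave
  rw [profile_eq_sin, ← mul_assoc]
  have h1 : |Real.sin (2 * Real.pi * (freq k * x')) - Real.sin (2 * Real.pi * freq k * x)| ≤
      7 * (freq k * |x' - x|) := by
    refine (Real.abs_sin_sub_sin_le _ _).trans ?_
    rw [show 2 * Real.pi * (freq k * x') - 2 * Real.pi * freq k * x =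
      2 * Real.pi * (freq k * (x' - x)) by ring, abs_mul, abs_mul (freq k : ℝ),
      abs_of_pos q0, abs_of_pos (by positivity : 0 < 2 * Real.pi)]
    gcongr
    linarith [Real.pi_lt_d2]
  have h4 : η / 2 ≤ |Real.sin (2 * Real.pi * (freq k * x'))| := by
    have h5 := abs_sub_abs_le_abs_sub (Real.sin (2 * Real.pi * freq k * x))
      (Real.sin (2 * Real.pi * (freq k * x')))
    rw [abs_sub_comm] at h5
    linarith
  rw [abs_mul, Nat.abs_cast]
  have h6 : (0 : ℝ) ≤ invWidth k := Nat.cast_nonneg _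
  calc (10 : ℝ) = 20 / 2 := by norm_num
    _ ≤ η * invWidth k / 2 := by gcongr
    _ = invWidth k * (η / 2) := by ring
    _ ≤ _ := by gcongr

/-- In the time window of stage `k = 2 i + c`, the Birkhoff sums over horizontal segments of length
`δ = H / (t * amp k * freq k)` are almost affine, with a total variation of order `H`. -/
theorem exists_slope {H K η : ℝ} (hH : 0 < H) (hη : 0 < η) {k : ℕ}
    (hk1 : 4 * |K| + 6 ≤ k) (hk2 : 14 * (H + 6) ≤ η * k) (hk3 : 20 ≤ η * invWidth k) {t : ℝ}
    (ht1 : start k ≤ t) (ht2 : t ≤ start (k + 1)) {z : Torus2} {s : ℝ} (hs : |s| ≤ K)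
    (hz : η ≤ ‖(4 * freq k) • coord k z‖) :
    ∃ (m : ℕ) (D : ℝ), 0 ≤ s + t - bsum (rot 0) (rot 1) roof m z ∧
      s + t - bsum (rot 0) (rot 1) roof m z ≤ 3 / 2 ∧
      Real.pi * η * H ≤ |D| * (H / (t * amp k * freq k)) ∧
      |D| * (H / (t * amp k * freq k)) ≤ 20 * H ∧
      ∀ r, 0 ≤ r → r ≤ H / (t * amp k * freq k) →
        |bsum (rot 0) (rot 1) roof m (z + dir k r) - bsum (rot 0) (rot 1) roof m z - D * r| ≤
          (H + 27 + 120 * H * (H + 6)) / (k + 1) := by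
  obtain ⟨i, c, hc, rfl⟩ : ∃ i c, c < 2 ∧ k = 2 * i + c :=
    ⟨k / 2, k % 2, Nat.mod_lt _ two_pos, (Nat.div_add_mod k 2).symm⟩
  set k := 2 * i + c with hk
  have hsK := abs_le.1 hs
  have hK0 : 0 ≤ K := (abs_nonneg s).trans hs
  rw [abs_of_nonneg hK0] at hk1
  have htk : (k : ℝ) + 1 ≤ t := (le_start k).trans ht1
  have t0 : 0 < t := by
    have : (0 : ℝ) ≤ k := Nat.cast_nonneg k
    linarith
  obtain ⟨m, hm1, hm2, hm3, hm4⟩ := exists_return z (w := s + t) (by linarith)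
  have m1 : (m : ℝ) ≤ 3 * t := by linarith
  have m2 : t / 2 ≤ m := by linarith
  have q0 : (0 : ℝ) < freq k := by exact_mod_cast freq_pos k
  have b0 := amp_pos k
  set δ := H / (t * amp k * freq k) with hδ
  have δ0 : 0 < δ := by positivity
  obtain ⟨x, hx⟩ : ∃ x : ℝ, coord k z = x := by
    generalize coord k z = u
    induction u using QuotientAddGroup.induction_on with | H x => exact ⟨x, rfl⟩
  have hsc := le_abs_sin_cos (η := η) (u := freq k * x) (by
    have e : ((4 * (freq k * x) : ℝ) : UnitAddCircle) = (4 * freq k) • (x : UnitAddCircle) := by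
      rw [← AddCircle.coe_nsmul, nsmul_eq_mul]; push_cast; congr 1; ring
    rw [e, ← hx]; exact hz)
  rw [← mul_assoc] at hsc
  have hQ : freqOf c i = freq k := rfl
  have hQ' : freqOf c (i + 1) = freq (k + 2) := by unfold freqOf; congr 1; omega
  have Q0 : (0 : ℝ) < freq (k + 2) := by exact_mod_cast freq_pos _
  have k0 : (0 : ℝ) < (k : ℝ) + 1 := by positivity
  -- the size of the parameters
  have htb : (k : ℝ) + 1 ≤ t * amp k := by
    rw [← start_mul_amp k]; gcongr
  have hqδ : freq k * δ = H / (t * amp k) := by rw [hδ]; field_simp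
  have hqδ' : freq k * δ ≤ H / (k + 1) := by rw [hqδ]; gcongr
  obtain ⟨hqt, ht2'⟩ := window_estimates ht1 ht2
  have hqm : (freq k : ℝ) * (m * (2 / freq (k + 2))) ≤ 6 / (k + 1) := by
    calc (freq k : ℝ) * (m * (2 / freq (k + 2))) ≤
          freq k * (3 * t * (2 / freq (k + 2))) := by gcongr
      _ = 6 * (freq k * t / freq (k + 2)) := by ring
      _ ≤ 6 * (1 / (k + 1)) := by gcongr
      _ = 6 / (k + 1) := by ring
  have hπ := Real.pi_pos
  have hπ2 := Real.pi_lt_d2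
  set B := amp k with hB
  set D := m * B * (2 * Real.pi * freq k * Real.cos (2 * Real.pi * freq k * x)) with hD
  have hDabs : |D| = m * B * (2 * Real.pi * freq k * |Real.cos (2 * Real.pi * freq k * x)|) := by
    rw [hD, abs_mul, abs_mul (2 * Real.pi * (freq k : ℝ)),
      abs_of_nonneg (by positivity : 0 ≤ m * B),
      abs_of_pos (by positivity : 0 < 2 * Real.pi * (freq k : ℝ))]
  have hDδ : |D| * δ = m / t * (2 * Real.pi * |Real.cos (2 * Real.pi * freq k * x)| * H) := by
    rw [hDabs, hδ]; field_simp
  refine ⟨m, D, hm1, hm2, ?_, ?_, fun r hr0 hr => ?_⟩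
  · rw [hDδ]
    have h1 : 1 / 2 ≤ m / t := by rw [div_le_div_iff₀ two_pos t0]; linarith
    calc Real.pi * η * H = 1 / 2 * (2 * Real.pi * η * H) := by ring
      _ ≤ _ := by gcongr; exact hsc.2
  · rw [hDδ]
    have h1 : m / t ≤ 3 := by rw [div_le_iff₀ t0]; exact m1
    calc m / t * (2 * Real.pi * |Real.cos (2 * Real.pi * freq k * x)| * H) ≤
          3 * (2 * Real.pi * 1 * H) := by gcongr; exact Real.abs_cos_le_one _
      _ = 6 * Real.pi * H := by ring
      _ ≤ 20 * H := by gcongr; linarith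
  · rw [bsum_roof_add_dir c i m hc hx]
    have hsin : ∀ x', |x' - x| ≤ r + m * (2 / (freqOf c (i + 1) : ℝ)) →
        waveOf c i x' = B * Real.sin (2 * Real.pi * freqOf c i * x') := by
      intro x' hx'
      rw [hQ'] at hx'
      refine wave_eq_sin hk3 hsc.1 ?_
      have h2 : freq k * |x' - x| ≤ H / (k + 1) + 6 / (k + 1) := by
        calc freq k * |x' - x| ≤ freq k * (δ + m * (2 / freq (k + 2))) := by
              gcongr; exact hx'.trans (by gcongr)
          _ = freq k * δ + freq k * (m * (2 / freq (k + 2))) := by ring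
          _ ≤ _ := add_le_add hqδ' hqm
      calc 14 * (freq k * |x' - x|) ≤ 14 * (H / (k + 1) + 6 / (k + 1)) := by gcongr
        _ = 14 * (H + 6) / (k + 1) := by rw [← add_div, mul_div_assoc]
        _ ≤ η * k / (k + 1) := by gcongr
        _ ≤ η := by
          rw [div_le_iff₀ k0]
          have : η * (k + 1) = η * k + η := by ring
          linarith
    have key := (tower c).abs_birk_stretch (B := B) b0.le hr0 hsin (m := m)
    rw [hQ, hQ'] at key
    refine key.trans ?_
    have e1 : freq k * r ≤ H / (k + 1) := le_trans (by gcongr) hqδ'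
    have e2 : 3 * (m : ℝ) ^ 2 / freq (k + 2) ≤ 27 / (k + 1) := by
      calc 3 * (m : ℝ) ^ 2 / freq (k + 2) ≤ 3 * (3 * t) ^ 2 / freq (k + 2) := by gcongr
        _ = 27 * (t ^ 2 / freq (k + 2)) := by ring
        _ ≤ 27 * (1 / (k + 1)) := by gcongr
        _ = 27 / (k + 1) := by ring
    have hpi : (2 * Real.pi) ^ 2 ≤ 40 :=
      (pow_le_pow_left₀ (by positivity) (show 2 * Real.pi ≤ 6.3 by linarith) 2).trans (by norm_num)
    have e3 : m * B * ((2 * Real.pi * freq k) ^ 2 * (r * (r + m * (2 / freq (k + 2))))) ≤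
        120 * H * (H + 6) / (k + 1) := by
      calc m * B * ((2 * Real.pi * freq k) ^ 2 * (r * (r + m * (2 / freq (k + 2))))) =
            m * B * ((2 * Real.pi) ^ 2 * (freq k * r * (freq k * r +
              freq k * (m * (2 / freq (k + 2)))))) := by ring
        _ ≤ 3 * t * B * (40 * (H / (t * B) * (H / (k + 1) + 6 / (k + 1)))) := by
            gcongr
            rw [← hqδ]
            gcongr
        _ = 120 * H * (H + 6) / (k + 1) := by field_simp; ring
    calc freq k * r + 3 * (m : ℝ) ^ 2 / freq (k + 2) +
          m * B * ((2 * Real.pi * freq k) ^ 2 * (r * (r + m * (2 / freq (k + 2))))) ≤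
          H / (k + 1) + 27 / (k + 1) + 120 * H * (H + 6) / (k + 1) :=
          add_le_add (add_le_add e1 e2) e3
      _ = _ := by rw [← add_div, ← add_div]

theorem tendsto_invWidth : Tendsto (fun k => (invWidth k : ℝ)) atTop atTop := by
  refine tendsto_natCast_atTop_atTop.comp (tendsto_atTop.2 fun n => ?_)
  filter_upwards [eventually_ge_atTop (n * n)] with k hk
  have := Nat.le_sqrt.2 hk
  unfold invWidth
  omega

/-- In the time window of stage `k`, continuous observables average out along short horizontal
segments. -/
theorem eventually_horizontal_average {g : Torus2 × ℝ → ℝ}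
    (hg : Invariant (rot 0) (rot 1) roof g) (hgc : Continuous g) {ε η : ℝ} (hε : 0 < ε)
    (hη : 0 < η) (K : ℝ) :
    ∀ᶠ k : ℕ in atTop, ∀ t : ℝ, start k ≤ t → t ≤ start (k + 1) → ∃ δ : ℝ, 0 < δ ∧ δ ≤ ε ∧
      ∀ (z : Torus2) (s : ℝ), |s| ≤ K → η ≤ ‖(4 * freq k) • coord k z‖ →
        |(∫ r in (0 : ℝ)..δ, g (vertical t (z + dir k r, s))) -
          (∫ p in domain roof, g p) / vol roof * δ| ≤ ε * δ := by
  obtain ⟨H₁, hH₁, hw⟩ := exists_forall_window hg hgc (half_pos hε)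
  set c := (∫ p in domain roof, g p) / vol roof with hcdef
  set H := H₁ / (Real.pi * η) with hHdef
  have hH : 0 < H := by positivity
  have hHη : Real.pi * η * H = H₁ := by rw [hHdef]; field_simp
  -- uniform continuity on a strip
  have hcomp : IsCompact ((Set.univ : Set Torus2) ×ˢ Set.Icc (-(20 * H + 3)) (20 * H + 3)) :=
    isCompact_univ.prod isCompact_Icc
  have huc := hcomp.uniformContinuousOn_of_continuous hgc.continuousOn
  obtain ⟨ρ, hρ, hgρ⟩ := Metric.uniformContinuousOn_iff.1 huc (ε / 2) (half_pos hε)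
  set E := H + 27 + 120 * H * (H + 6) with hE
  have E0 : 0 < E := by positivity
  have hρ1 : 0 < min 1 (ρ / 2) := by positivity
  filter_upwards [tendsto_natCast_atTop_atTop.eventually_ge_atTop (4 * |K| + 6),
    tendsto_natCast_atTop_atTop.eventually_ge_atTop (14 * (H + 6) / η),
    tendsto_invWidth.eventually_ge_atTop (20 / η),
    tendsto_natCast_atTop_atTop.eventually_ge_atTop (E / min 1 (ρ / 2)),
    tendsto_natCast_atTop_atTop.eventually_ge_atTop (H / min ε (ρ / 2))] with k h1 h2 h3 h4 h5
  intro t ht1 ht2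
  rw [div_le_iff₀ hη] at h2 h3
  rw [div_le_iff₀ hρ1] at h4
  rw [div_le_iff₀ (by positivity)] at h5
  have q1 : (1 : ℝ) ≤ freq k := by exact_mod_cast freq_pos k
  have k0 : (0 : ℝ) < (k : ℝ) + 1 := by positivity
  have t0 : 0 < t := (start_pos k).trans_le ht1
  have b0 := amp_pos k
  set δ := H / (t * amp k * freq k) with hδ
  have δ0 : 0 < δ := by positivity
  have hδk : δ ≤ H / (k + 1) := by
    have : (k : ℝ) + 1 ≤ t * amp k * freq k := by
      rw [← start_mul_amp k]
      calc start k * amp k ≤ t * amp k := by gcongr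
        _ ≤ t * amp k * freq k := le_mul_of_one_le_right (by positivity) q1
    rw [hδ]
    gcongr
  have hδ1 : δ ≤ min ε (ρ / 2) := by
    refine hδk.trans ?_
    rw [div_le_iff₀ k0]
    have : 0 < min ε (ρ / 2) := by positivity
    linarith
  have hEk : E / (k + 1) ≤ min 1 (ρ / 2) := by
    rw [div_le_iff₀ k0]
    linarith
  refine ⟨δ, δ0, hδ1.trans (min_le_left _ _), fun z s hs hz => ?_⟩
  obtain ⟨m, D, u0, u1, D1, D2, hr⟩ :=
    exists_slope hH hη h1 (by linarith) (by linarith) ht1 ht2 hs hz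
  rw [hHη] at D1
  have hD : D ≠ 0 := by
    rintro rfl
    simp at D1
    linarith
  set u := s + t - bsum (rot 0) (rot 1) roof m z with hu
  set p' : Torus2 × ℝ := (z + m • rvec, u) with hp'
  have main := abs_integral_speed_le (D := -D) hw δ0 (neg_ne_zero.2 hD)
    (by rw [abs_neg]; exact D1) p'
  have hdir := continuous_dir k
  have c1 : Continuous fun r => g (vertical t (z + dir k r, s)) :=
    hgc.comp (by unfold vertical; fun_prop)
  have c2 : Continuous fun r => g (vertical (-D * r) p') :=
    hgc.comp (by unfold vertical; fun_prop)
  have close : ∀ r ∈ Set.uIoc 0 δ,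
      ‖g (vertical t (z + dir k r, s)) - g (vertical (-D * r) p')‖ ≤ ε / 2 := by
    intro r hrδ
    rw [Set.uIoc_of_le δ0.le] at hrδ
    have h6 := (hr r hrδ.1.le hrδ.2).trans hEk
    set Δ := bsum (rot 0) (rot 1) roof m (z + dir k r) - bsum (rot 0) (rot 1) roof m z with hΔ
    have e1 : g (vertical t (z + dir k r, s)) = g (z + m • rvec + dir k r, u - Δ) := by
      have := hg.apply_add_bsum m (z + dir k r) (u - Δ)
      rw [show z + m • rvec + dir k r = z + dir k r + m • rvec by abel, ← this]
      unfold vertical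
      congr 2
      rw [hu, hΔ]
      ring
    have e2 : vertical (-D * r) p' = (z + m • rvec, u - D * r) := by
      rw [hp', vertical]
      refine Prod.ext rfl ?_
      change u + -D * r = u - D * r
      ring
    rw [e1, e2]
    have hDr : |D * r| ≤ 20 * H := by
      rw [abs_mul, abs_of_pos hrδ.1]
      refine le_trans ?_ D2
      gcongr
      exact hrδ.2
    have h7 := h6.trans (min_le_left _ _)
    have h8 := h6.trans (min_le_right _ _)
    have h9 := abs_le.1 h7
    have h10 := abs_le.1 hDr
    refine (hgρ _ ⟨Set.mem_univ _, ?_⟩ _ ⟨Set.mem_univ _, ?_⟩ ?_).le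
    · constructor <;> simp only <;> linarith
    · constructor <;> simp only <;> linarith
    · rw [Prod.dist_eq]
      refine max_lt ?_ ?_
      · simp only
        rw [dist_eq_norm, add_sub_cancel_left]
        refine (norm_dir_le k r).trans_lt ?_
        rw [abs_of_pos hrδ.1]
        have := hδ1.trans (min_le_right _ _)
        linarith [hrδ.2]
      · simp only
        rw [Real.dist_eq, show u - Δ - (u - D * r) = -(Δ - D * r) by ring, abs_neg]
        linarith
  have h11 := intervalIntegral.norm_integral_le_of_norm_le_const close
  rw [intervalIntegral.integral_sub (c1.intervalIntegrable _ _) (c2.intervalIntegrable _ _),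
    sub_zero, abs_of_pos δ0, Real.norm_eq_abs] at h11
  rw [abs_le] at *
  constructor <;> linarith

/-! ### Mixing -/

theorem measurePreserving_coord (k : ℕ) : MeasurePreserving (coord k) volume volume := by
  unfold coord
  split_ifs
  · exact measurePreserving_fst (μ := (volume : Measure UnitAddCircle))
      (ν := (volume : Measure UnitAddCircle))
  · exact measurePreserving_snd (μ := (volume : Measure UnitAddCircle))
      (ν := (volume : Measure UnitAddCircle))

theorem measurePreserving_nsmul_coord (k : ℕ) :
    MeasurePreserving (fun z => (4 * freq k) • coord k z) volume volume :=
  have h4 : 1 < 4 * freq k := by have := freq_pos k; omega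
  (AddCircle.ergodic_nsmul (T := 1) h4).toMeasurePreserving.comp (measurePreserving_coord k)

/-- The points at which the sine wave of stage `k` has a small value or a small derivative. -/
def badSet (k : ℕ) (η : ℝ) : Set Torus2 := {z | ‖(4 * freq k) • coord k z‖ < η}

theorem measurableSet_badSet (k : ℕ) (η : ℝ) : MeasurableSet (badSet k η) :=
  measurableSet_lt ((measurePreserving_nsmul_coord k).measurable.norm) measurable_const

theorem measureReal_badSet_le (k : ℕ) {η : ℝ} (hη : 0 < η) :
    volume.real (badSet k η) ≤ 2 * η := by
  have hmp := measurePreserving_nsmul_coord k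
  have e : badSet k η ⊆ (fun z => (4 * freq k) • coord k z) ⁻¹' Metric.closedBall 0 η := by
    intro z hz
    simp only [Set.mem_preimage, mem_closedBall_zero_iff]
    exact le_of_lt hz
  have h : volume (badSet k η) ≤ ENNReal.ofReal (2 * η) := by
    refine (measure_mono e).trans ((hmp.measure_preimage
      Metric.isClosed_closedBall.measurableSet.nullMeasurableSet).le.trans ?_)
    rw [AddCircle.volume_closedBall]
    exact ENNReal.ofReal_le_ofReal (min_le_right _ _)
  exact ENNReal.toReal_le_of_le_ofReal (by positivity) h

/-- A horizontal strip. -/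
def strip (K : ℝ) : Set (Torus2 × ℝ) := Set.univ ×ˢ Set.Icc (-K) K

theorem measurableSet_strip (K : ℝ) : MeasurableSet (strip K) :=
  MeasurableSet.univ.prod measurableSet_Icc

theorem volume_prod_Icc (A : Set Torus2) {K : ℝ} (hK : 0 ≤ K) :
    volume.real (A ×ˢ Set.Icc (-K) K) = volume.real A * (2 * K) := by
  rw [Measure.volume_eq_prod, measureReal_prod_prod, Real.volume_real_Icc_of_le (by linarith)]
  ring

theorem volume_strip_ne_top (K : ℝ) : volume (strip K) ≠ ⊤ := by
  rw [strip, Measure.volume_eq_prod, Measure.prod_prod]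
  exact ENNReal.mul_ne_top (measure_ne_top _ _) (by simp)

theorem measurePreserving_add_dir (k : ℕ) (r : ℝ) :
    MeasurePreserving (fun p : Torus2 × ℝ => (p.1 + dir k r, p.2)) volume volume :=
  (measurePreserving_add_torus (dir k r)).prod (MeasurePreserving.id (volume : Measure ℝ))

theorem integral_add_dir (k : ℕ) (r : ℝ) (f : Torus2 × ℝ → ℝ) :
    ∫ p : Torus2 × ℝ, f (p.1 + dir k r, p.2) = ∫ p, f p := by
  let e : Torus2 × ℝ ≃ᵐ Torus2 × ℝ :=
    (MeasurableEquiv.addRight (dir k r)).prodCongr (MeasurableEquiv.refl ℝ)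
  exact (measurePreserving_add_dir k r).integral_comp e.measurableEmbedding f

/-- Averaging a correlation over short horizontal translations. -/
theorem abs_correlation_sub_le {F g : Torus2 × ℝ → ℝ} (hF : Continuous F) (hg : Continuous g)
    {M C K c σ ε η δ t : ℝ} {k : ℕ} (hM0 : 0 ≤ M) (hC0 : 0 ≤ C) (hK : 0 ≤ K) (hδ : 0 < δ)
    (hη : 0 < η) (hε : 0 ≤ ε) (hσ : 0 ≤ σ)
    (hM : ∀ p, |F p| ≤ M) (hC : ∀ p, |g p| ≤ C) (hFK : ∀ p, F p ≠ 0 → |p.2| ≤ K)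
    (hFσ : ∀ p q, dist p q ≤ δ → |F p - F q| ≤ σ)
    (havg : ∀ (z : Torus2) (s : ℝ), |s| ≤ K → z ∉ badSet k η →
      |(∫ r in (0 : ℝ)..δ, g (vertical t (z + dir k r, s))) - c * δ| ≤ ε * δ) :
    |(∫ p, F p * g (vertical t p)) - c * ∫ p, F p| ≤
      (C * σ + M * ε) * (2 * K) + M * (C + |c|) * (2 * η * (2 * K)) := by
  have hstripfin := volume_strip_ne_top K
  have hS := measurableSet_strip K
  have hdir := continuous_dir k
  have hmem : ∀ p : Torus2 × ℝ, p ∈ strip K ↔ |p.2| ≤ K := fun p =>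
    ⟨fun h => abs_le.2 h.2, fun h => ⟨Set.mem_univ _, abs_le.1 h⟩⟩
  set w : Torus2 × ℝ → ℝ → ℝ := fun p r =>
    F (p.1 + dir k r, p.2) * g (vertical t (p.1 + dir k r, p.2)) with hw
  have hwc : Continuous fun x : (Torus2 × ℝ) × ℝ => w x.1 x.2 := by
    simp only [hw]
    refine Continuous.mul (hF.comp (by fun_prop)) (hg.comp ?_)
    unfold vertical
    fun_prop
  have hwb : ∀ p r, |w p r| ≤ M * C := fun p r => by
    rw [hw, abs_mul]; exact mul_le_mul (hM _) (hC _) (abs_nonneg _) hM0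
  have : IsFiniteMeasure (volume.restrict (strip K)) := isFiniteMeasure_restrict.2 hstripfin
  have hwint : Integrable (Function.uncurry w)
      ((volume.restrict (strip K)).prod (volume.restrict (Set.Ioc 0 δ))) :=
    Integrable.of_bound hwc.aestronglyMeasurable (M * C) (ae_of_all _ fun x => hwb x.1 x.2)
  -- the correlation is the same after each translation
  have hcorr : ∀ r, ∫ p in strip K, w p r = ∫ p, F p * g (vertical t p) := by
    intro r
    rw [← integral_add_dir k r fun p => F p * g (vertical t p)]
    refine setIntegral_eq_integral_of_forall_compl_eq_zero fun p hp => ?_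
    have : F (p.1 + dir k r, p.2) = 0 := by
      by_contra hne
      exact hp ((hmem p).2 (hFK (p.1 + dir k r, p.2) hne))
    simp only [hw, this, zero_mul]
  have hFstrip : ∫ p in strip K, F p = ∫ p, F p :=
    setIntegral_eq_integral_of_forall_compl_eq_zero fun p hp => by
      by_contra hne
      exact hp ((hmem p).2 (hFK _ hne))
  have hswap : ∫ p in strip K, (∫ r in (0 : ℝ)..δ, w p r) =
      δ * ∫ p, F p * g (vertical t p) := by
    simp only [intervalIntegral.integral_of_le hδ.le]
    rw [integral_integral_swap hwint]
    simp only [hcorr]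
    rw [setIntegral_const, smul_eq_mul, Real.volume_real_Ioc_of_le hδ.le, sub_zero]
  have hWi : IntegrableOn (fun p => ∫ r in (0 : ℝ)..δ, w p r) (strip K) := by
    simp only [intervalIntegral.integral_of_le hδ.le]
    exact hwint.integral_prod_left
  have hFi : IntegrableOn F (strip K) :=
    Measure.integrableOn_of_bounded hstripfin hF.aestronglyMeasurable (M := M)
      (ae_of_all _ fun p => hM p)
  -- the pointwise estimate
  set T : Set (Torus2 × ℝ) := badSet k η ×ˢ Set.Icc (-K) K with hT
  have hTm : MeasurableSet T := (measurableSet_badSet k η).prod measurableSet_Icc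
  have hTS : T ⊆ strip K := Set.prod_mono (Set.subset_univ _) le_rfl
  set β : Torus2 × ℝ → ℝ := fun p =>
    δ * (C * σ + M * ε) + T.indicator (fun _ => δ * (M * (C + |c|))) p with hβ
  have hii : ∀ p : Torus2 × ℝ,
      IntervalIntegrable (fun r => g (vertical t (p.1 + dir k r, p.2))) volume 0 δ := fun p =>
    (hg.comp (by unfold vertical; fun_prop)).intervalIntegrable _ _
  have hpt : ∀ p ∈ strip K, |(∫ r in (0 : ℝ)..δ, w p r) - c * δ * F p| ≤ β p := by
    intro p hp
    set A := ∫ r in (0 : ℝ)..δ, g (vertical t (p.1 + dir k r, p.2)) with hA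
    have hwi : IntervalIntegrable (w p) volume 0 δ :=
      (hwc.comp (by fun_prop : Continuous fun r : ℝ => (p, r))).intervalIntegrable _ _
    have h1 : |(∫ r in (0 : ℝ)..δ, w p r) - F p * A| ≤ σ * C * δ := by
      rw [hA, ← intervalIntegral.integral_const_mul,
        ← intervalIntegral.integral_sub hwi ((hii p).const_mul _)]
      have := intervalIntegral.norm_integral_le_of_norm_le_const (a := 0) (b := δ) (C := σ * C)
        (f := fun r => w p r - F p * g (vertical t (p.1 + dir k r, p.2))) (fun r hr => by
          rw [Set.uIoc_of_le hδ.le] at hr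
          simp only [hw]
          rw [← sub_mul, Real.norm_eq_abs, abs_mul]
          refine mul_le_mul (hFσ _ _ ?_) (hC _) (abs_nonneg _) hσ
          rw [Prod.dist_eq, dist_self, max_eq_left dist_nonneg, dist_eq_norm, add_sub_cancel_left]
          refine (norm_dir_le k r).trans ?_
          rw [abs_of_pos hr.1]
          exact hr.2)
      rwa [sub_zero, abs_of_pos hδ] at this
    have h2 : |F p * A - c * δ * F p| = |F p| * |A - c * δ| := by
      rw [← abs_mul]; congr 1; ring
    have h3 : |(∫ r in (0 : ℝ)..δ, w p r) - c * δ * F p| ≤ σ * C * δ + |F p| * |A - c * δ| := by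
      rw [← h2]
      exact (abs_sub_le _ (F p * A) _).trans (add_le_add h1 le_rfl)
    refine h3.trans ?_
    by_cases hbad : p ∈ T
    · rw [hβ]
      simp only [Set.indicator_of_mem hbad]
      have h4 : |A - c * δ| ≤ C * δ + |c| * δ := by
        refine (abs_sub _ _).trans (add_le_add ?_ ?_)
        · have := abs_intervalIntegral_le
            (f := fun r => g (vertical t (p.1 + dir k r, p.2))) (fun _ => hC _) 0 δ
          rwa [sub_zero, abs_of_pos hδ] at this
        · rw [abs_mul, abs_of_pos hδ]
      have h5 : |F p| * |A - c * δ| ≤ M * (C * δ + |c| * δ) :=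
        mul_le_mul (hM p) h4 (abs_nonneg _) hM0
      have h6 : 0 ≤ δ * (M * ε) := by positivity
      linarith
    · rw [hβ]
      simp only [Set.indicator_of_notMem hbad]
      have hz : p.1 ∉ badSet k η := fun h => hbad ⟨h, hp.2⟩
      have h5 : |F p| * |A - c * δ| ≤ M * (ε * δ) :=
        mul_le_mul (hM p) (havg p.1 p.2 ((hmem p).1 hp) hz) (abs_nonneg _) hM0
      linarith
  have hβi : IntegrableOn β (strip K) :=
    (integrable_const _).add ((integrable_const _).indicator hTm)
  have hβint : ∫ p in strip K, β p ≤
      δ * ((C * σ + M * ε) * (2 * K) + M * (C + |c|) * (2 * η * (2 * K))) := by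
    rw [hβ, integral_add (integrable_const _) ((integrable_const _).indicator hTm),
      setIntegral_const, setIntegral_indicator hTm, Set.inter_eq_self_of_subset_right hTS,
      setIntegral_const, strip, hT, volume_prod_Icc _ hK, volume_prod_Icc _ hK]
    simp only [probReal_univ, smul_eq_mul]
    have h1 := measureReal_badSet_le k hη
    have h2 : volume.real (badSet k η) * (2 * K) * (δ * (M * (C + |c|))) ≤
        2 * η * (2 * K) * (δ * (M * (C + |c|))) := by gcongr
    linarith
  have hfin : |δ * ((∫ p, F p * g (vertical t p)) - c * ∫ p, F p)| ≤
      δ * ((C * σ + M * ε) * (2 * K) + M * (C + |c|) * (2 * η * (2 * K))) := by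
    have e : δ * ((∫ p, F p * g (vertical t p)) - c * ∫ p, F p) =
        ∫ p in strip K, ((∫ r in (0 : ℝ)..δ, w p r) - c * δ * F p) := by
      rw [integral_sub hWi (hFi.const_mul _), hswap, integral_const_mul, hFstrip]
      ring
    rw [e]
    refine le_trans ?_ hβint
    rw [← Real.norm_eq_abs]
    exact norm_integral_le_of_norm_le hβi
      ((ae_restrict_iff' hS).2 (ae_of_all _ fun p hp => hpt p hp))
  rw [abs_mul, abs_of_pos hδ] at hfin
  exact le_of_mul_le_mul_left hfin hδ

theorem exists_stage (k₀ : ℕ) {t : ℝ} (ht : start k₀ ≤ t) :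
    ∃ k, k₀ ≤ k ∧ start k ≤ t ∧ t ≤ start (k + 1) := by
  classical
  have hex : ∃ n, k₀ ≤ n ∧ t ≤ start (n + 1) := by
    obtain ⟨n, hn⟩ := exists_nat_ge t
    refine ⟨max k₀ n, le_max_left _ _, hn.trans (le_trans ?_ (le_start _))⟩
    have : (n : ℝ) ≤ (max k₀ n : ℕ) := Nat.cast_le.2 (le_max_right _ _)
    push_cast at this ⊢
    linarith
  refine ⟨Nat.find hex, (Nat.find_spec hex).1, ?_, (Nat.find_spec hex).2⟩
  rcases (Nat.find_spec hex).1.eq_or_lt with h | h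
  · rwa [← h]
  · have := Nat.find_min hex (m := Nat.find hex - 1) (by omega)
    rw [not_and] at this
    have h2 := this (by omega)
    rw [Nat.sub_add_cancel (by omega)] at h2
    exact (not_le.1 h2).le

/-- The correlations of continuous observables decay. -/
theorem tendsto_continuous_correlation {F g : Torus2 × ℝ → ℝ} (hF : Continuous F)
    (hFs : HasCompactSupport F) (hg : Continuous g) (hgi : Invariant (rot 0) (rot 1) roof g) :
    Tendsto (fun t => ∫ p, F p * g (vertical t p)) atTop
      (𝓝 ((∫ p, F p) * ((∫ p in domain roof, g p) / vol roof))) := by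
  obtain ⟨M, hM⟩ := hF.bounded_above_of_compact_support hFs
  have hM0 : 0 ≤ M := (norm_nonneg _).trans (hM 0)
  obtain ⟨C, hC0, hC⟩ := hgi.exists_bound hg
  obtain ⟨K', hK'⟩ := exists_strip_of_hasCompactSupport hFs
  set K := max K' 0 with hKdef
  have hK0 : 0 ≤ K := le_max_right _ _
  have hK : ∀ p, F p ≠ 0 → |p.2| ≤ K := fun p hp => (hK' p hp).trans (le_max_left _ _)
  set c := (∫ p in domain roof, g p) / vol roof with hc
  rw [Metric.tendsto_atTop]
  intro ξ hξ
  set ε := ξ / (4 * ((C + M) * (2 * K) + 1)) with hε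
  have ε0 : 0 < ε := by positivity
  set η := ξ / (4 * (M * (C + |c|) * (2 * (2 * K)) + 1)) with hη
  have η0 : 0 < η := by positivity
  have hFu : UniformContinuous F := hFs.uniformContinuous_of_continuous hF
  obtain ⟨ρ, hρ, hFρ⟩ := Metric.uniformContinuous_iff.1 hFu ε ε0
  obtain ⟨k₀, hk₀⟩ := eventually_atTop.1
    (eventually_horizontal_average hgi hg (ε := min ε (ρ / 2)) (lt_min ε0 (half_pos hρ)) η0 K)
  refine ⟨start k₀, fun t ht => ?_⟩
  obtain ⟨k, hk, ht1, ht2⟩ := exists_stage k₀ ht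
  obtain ⟨δ, hδ, hδε, havg⟩ := hk₀ k hk t ht1 ht2
  have key := abs_correlation_sub_le (σ := ε) (ε := ε) (t := t) (c := c) hF hg hM0 hC0.le hK0 hδ η0
    ε0.le ε0.le hM hC hK
    (fun p q hpq => (hFρ (hpq.trans_lt (lt_of_le_of_lt (hδε.trans (min_le_right _ _))
      (half_lt_self hρ)))).le)
    (fun z s hs hz => (havg z s hs (not_lt.1 hz)).trans
      (mul_le_mul_of_nonneg_right (min_le_left _ _) hδ.le))
  rw [Real.dist_eq, mul_comm (∫ p, F p)]
  refine key.trans_lt ?_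
  have e1 : (C * ε + M * ε) * (2 * K) ≤ ξ / 4 := by
    rw [hε, ← add_mul, mul_right_comm, ← mul_div_assoc,
      div_le_div_iff₀ (by positivity) (by norm_num)]
    have : 0 ≤ (C + M) * (2 * K) := by positivity
    nlinarith
  have e2 : M * (C + |c|) * (2 * η * (2 * K)) ≤ ξ / 4 := by
    rw [show M * (C + |c|) * (2 * η * (2 * K)) = M * (C + |c|) * (2 * (2 * K)) * η by ring, hη,
      ← mul_div_assoc, div_le_div_iff₀ (by positivity) (by norm_num)]
    have : 0 ≤ M * (C + |c|) * (2 * (2 * K)) := by positivity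
    nlinarith
  linarith

/-! ### Super-recurrence -/

/-- The points at which the terms of the ceiling function of stages `2 i` and `2 i + 1` are flat. -/
def flatSet (i : ℕ) : Set Torus2 :=
  {z | ‖freq (2 * i) • z.1‖ ≤ 1 / invWidth (2 * i) ∧
    ‖freq (2 * i + 1) • z.2‖ ≤ 1 / invWidth (2 * i + 1)}

theorem isClosed_flatSet (i : ℕ) : IsClosed (flatSet i) :=
  (isClosed_le ((continuous_nsmul _).comp continuous_fst).norm continuous_const).inter
    (isClosed_le ((continuous_nsmul _).comp continuous_snd).norm continuous_const)

theorem wave_eq_zero {k : ℕ} {x : ℝ}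
    (h : ‖freq k • (x : UnitAddCircle)‖ ≤ 1 / invWidth k) : wave k x = 0 := by
  rw [← AddCircle.coe_nsmul, nsmul_eq_mul, UnitAddCircle.norm_eq] at h
  have hL : (0 : ℝ) < invWidth k := by exact_mod_cast Nat.succ_pos _
  rw [wave, profile_eq_zero_of_round hL h, mul_zero]

/-- The translates of the flat part of a wave cover the circle. -/
theorem exists_translate_flat (q : ℕ) {L : ℕ} (hq : 0 < q) (hL : 0 < L) (x : UnitAddCircle) :
    ∃ a < L, ‖q • (x + ((-(a / (q * L)) : ℝ) : UnitAddCircle))‖ ≤ 1 / L := by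
  induction x using QuotientAddGroup.induction_on with | H x =>
  have hL' : (0 : ℝ) < L := by exact_mod_cast hL
  have hq' : (q : ℝ) ≠ 0 := by exact_mod_cast hq.ne'
  set u := Int.fract (q * x) with hu
  have u0 : 0 ≤ u := Int.fract_nonneg _
  have u1 : u < 1 := Int.fract_lt_one _
  have f1 := Nat.floor_le (a := L * u) (by positivity)
  have f2 := Nat.lt_floor_add_one (L * u)
  refine ⟨⌊L * u⌋₊, ?_, ?_⟩
  · rw [Nat.floor_lt (by positivity)]
    nlinarith
  · have e : q • ((x : UnitAddCircle) + ((-((⌊L * u⌋₊ : ℝ) / (q * L)) : ℝ) : UnitAddCircle)) =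
        (((L * u - ⌊L * u⌋₊) / L : ℝ) : UnitAddCircle) := by
      rw [← AddCircle.coe_add, ← AddCircle.coe_nsmul, nsmul_eq_mul]
      have h1 : (q : ℝ) * (x + -((⌊L * u⌋₊ : ℝ) / (q * L))) =
          (L * u - ⌊L * u⌋₊) / L + ((⌊q * x⌋ : ℤ) : ℝ) := by
        have : (q : ℝ) * x = ⌊q * x⌋ + u := (Int.floor_add_fract _).symm
        field_simp
        linear_combination (L : ℝ) * this
      have h2 : (((⌊q * x⌋ : ℤ) : ℝ) : UnitAddCircle) = 0 :=
        (AddCircle.coe_eq_zero_iff (1 : ℝ)).2 ⟨⌊q * x⌋, by simp⟩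
      rw [h1, AddCircle.coe_add, h2, add_zero]
    change ‖q • ((x : UnitAddCircle) + ((-((⌊L * u⌋₊ : ℝ) / (q * L)) : ℝ) : UnitAddCircle))‖ ≤ _
    rw [e]
    refine (norm_coe_le_abs _).trans ?_
    rw [abs_div, abs_of_pos hL', abs_of_nonneg (by linarith)]
    gcongr
    linarith

/-- The translations under which the preimages of `flatSet i` cover the torus, for
`a < invWidth (2 i)` and `b < invWidth (2 i + 1)`. -/
def flatShift (i a b : ℕ) : Torus2 :=
  (((-(a / (freq (2 * i) * invWidth (2 * i))) : ℝ) : UnitAddCircle),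
    ((-(b / (freq (2 * i + 1) * invWidth (2 * i + 1))) : ℝ) : UnitAddCircle))

theorem invWidth_pos (k : ℕ) : 0 < invWidth k := Nat.succ_pos _

theorem nsmul_shift_eq_zero {q L Q : ℕ} (hq : 0 < q) (hL : 0 < L) (h : q * L ∣ Q) (a : ℕ) :
    Q • ((-((a : ℝ) / (q * L)) : ℝ) : UnitAddCircle) = 0 := by
  obtain ⟨d, rfl⟩ := h
  have hq' : (q : ℝ) ≠ 0 := by exact_mod_cast hq.ne'
  have hL' : (L : ℝ) ≠ 0 := by exact_mod_cast hL.ne'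
  rw [← AddCircle.coe_nsmul, nsmul_eq_mul]
  have e : ((q * L * d : ℕ) : ℝ) * -((a : ℝ) / (q * L)) = -((d * a : ℕ) : ℝ) := by
    push_cast; field_simp
  rw [e, AddCircle.coe_neg, coe_natCast_eq_zero, neg_zero]

/-- The later flat sets are invariant under the translations belonging to the earlier ones. -/
theorem add_flatShift_mem {i j : ℕ} (hij : i < j) (a b : ℕ) (z : Torus2) :
    z + flatShift i a b ∈ flatSet j ↔ z ∈ flatSet j := by
  have h1 : freq (2 * j) • (flatShift i a b).1 = 0 :=
    nsmul_shift_eq_zero (freq_pos _) (invWidth_pos _)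
      ((freq_mul_invWidth_dvd (2 * i)).trans (freq_dvd_of_le (by omega))) a
  have h2 : freq (2 * j + 1) • (flatShift i a b).2 = 0 :=
    nsmul_shift_eq_zero (freq_pos _) (invWidth_pos _)
      ((freq_mul_invWidth_dvd (2 * i + 1)).trans (freq_dvd_of_le (by omega))) b
  simp only [flatSet, Set.mem_ofPred_eq, Prod.fst_add, Prod.snd_add, nsmul_add, h1, h2, add_zero]

/-- A set with the periods of the later flat sets meets `flatSet i` in at least the expected
proportion. -/
theorem measureReal_le_mul_flat {i : ℕ} {P : Set Torus2} (hP : MeasurableSet P)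
    (hinv : ∀ a b z, z + flatShift i a b ∈ P ↔ z ∈ P) :
    volume.real P ≤ (invWidth (2 * i) * invWidth (2 * i + 1)) * volume.real (P ∩ flatSet i) := by
  have hm : MeasurableSet (P ∩ flatSet i) := hP.inter (isClosed_flatSet i).measurableSet
  set I := Finset.range (invWidth (2 * i)) ×ˢ Finset.range (invWidth (2 * i + 1)) with hI
  have hcover : P ⊆ ⋃ v ∈ I, (fun z => z + flatShift i v.1 v.2) ⁻¹' (P ∩ flatSet i) := by
    intro z hz
    obtain ⟨a, ha, ha'⟩ := exists_translate_flat _ (freq_pos (2 * i)) (invWidth_pos (2 * i)) z.1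
    obtain ⟨b, hb, hb'⟩ :=
      exists_translate_flat _ (freq_pos (2 * i + 1)) (invWidth_pos (2 * i + 1)) z.2
    simp only [Set.mem_iUnion]
    exact ⟨(a, b), Finset.mem_product.2 ⟨Finset.mem_range.2 ha, Finset.mem_range.2 hb⟩,
      (hinv a b z).2 hz, ha', hb'⟩
  have h1 : ∀ v : ℕ × ℕ, volume.real ((fun z => z + flatShift i v.1 v.2) ⁻¹' (P ∩ flatSet i)) =
      volume.real (P ∩ flatSet i) := fun v =>
    congrArg ENNReal.toReal
      ((measurePreserving_add_torus _).measure_preimage hm.nullMeasurableSet)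
  calc volume.real P ≤ volume.real (⋃ v ∈ I, (fun z => z + flatShift i v.1 v.2) ⁻¹'
          (P ∩ flatSet i)) := measureReal_mono hcover (measure_ne_top _ _)
    _ ≤ ∑ v ∈ I, volume.real ((fun z => z + flatShift i v.1 v.2) ⁻¹' (P ∩ flatSet i)) :=
        measureReal_biUnion_finset_le _ _
    _ = _ := by
        simp only [h1]
        rw [Finset.sum_const, hI, Finset.card_product, Finset.card_range, Finset.card_range,
          nsmul_eq_mul]
        push_cast
        ring

/-- The proportion of `flatSet i` guaranteed by the covering argument. -/
def flatRatio (i : ℕ) : ℝ := 1 / (invWidth (2 * i) * invWidth (2 * i + 1))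

/-- The points which avoid the `n` flat sets from the `m`-th one on. -/
def avoid (m n : ℕ) : Set Torus2 := ⋂ i ∈ Finset.range n, (flatSet (m + i))ᶜ

theorem measurableSet_avoid (m n : ℕ) : MeasurableSet (avoid m n) :=
  Finset.measurableSet_biInter _ fun _ _ => (isClosed_flatSet _).measurableSet.compl

theorem avoid_succ (m n : ℕ) : avoid m (n + 1) = avoid (m + 1) n \ flatSet m := by
  ext z
  simp only [avoid, Set.mem_iInter, Finset.mem_range, Set.mem_compl_iff, Set.mem_sdiff]
  constructor
  · intro h
    refine ⟨fun i hi => ?_, h 0 (by omega)⟩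
    have := h (i + 1) (by omega)
    rwa [show m + (i + 1) = m + 1 + i by ring] at this
  · rintro ⟨h1, h2⟩ i hi
    rcases i with _ | i
    · exact h2
    · rw [show m + (i + 1) = m + 1 + i by ring]
      exact h1 i (by omega)

theorem measureReal_avoid_le (m n : ℕ) :
    volume.real (avoid m n) ≤ Real.exp (-∑ i ∈ Finset.range n, flatRatio (m + i)) := by
  induction n generalizing m with
  | zero => simp [avoid]
  | succ n ih =>
    have hL1 : (0 : ℝ) < invWidth (2 * m) := by exact_mod_cast invWidth_pos _
    have hL2 : (0 : ℝ) < invWidth (2 * m + 1) := by exact_mod_cast invWidth_pos _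
    have h1 := measureReal_le_mul_flat (i := m) (measurableSet_avoid (m + 1) n) (fun a b z => by
      simp only [avoid, Set.mem_iInter, Set.mem_compl_iff]
      exact forall_congr' fun i => forall_congr' fun _ =>
        not_congr (add_flatShift_mem (by omega) a b z))
    have h2 := measureReal_sdiff_add_inter (μ := volume) (s := avoid (m + 1) n)
      (isClosed_flatSet m).measurableSet
    rw [← avoid_succ] at h2
    have h3 : flatRatio m * volume.real (avoid (m + 1) n) ≤
        volume.real (avoid (m + 1) n ∩ flatSet m) := by
      rw [flatRatio, one_div, inv_mul_le_iff₀ (by positivity)]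
      exact h1
    have h4 : 1 - flatRatio m ≤ Real.exp (-flatRatio m) := by
      have := Real.add_one_le_exp (-flatRatio m)
      linarith
    have h5 : (0 : ℝ) ≤ volume.real (avoid (m + 1) n) := measureReal_nonneg
    calc volume.real (avoid m (n + 1)) ≤ (1 - flatRatio m) * volume.real (avoid (m + 1) n) := by
          linarith
      _ ≤ Real.exp (-flatRatio m) *
          Real.exp (-∑ i ∈ Finset.range n, flatRatio (m + 1 + i)) := by
          gcongr
          exact ih (m + 1)
      _ = _ := by
          rw [← Real.exp_add, Finset.sum_range_succ']
          congr 1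
          have e : ∑ i ∈ Finset.range n, flatRatio (m + (i + 1)) =
              ∑ i ∈ Finset.range n, flatRatio (m + 1 + i) :=
            Finset.sum_congr rfl fun i _ => by rw [show m + (i + 1) = m + 1 + i by ring]
          rw [e, add_zero]
          ring

theorem le_flatRatio (i : ℕ) : 1 / 4 * (1 / ((i + 1 : ℕ) : ℝ)) ≤ flatRatio i := by
  have h1 : invWidth (2 * i) ≤ invWidth (2 * i + 1) :=
    Nat.succ_le_succ (Nat.sqrt_le_sqrt (by omega))
  have h2 : invWidth (2 * i) * invWidth (2 * i + 1) ≤ 4 * (i + 1) := by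
    have h3 := Nat.sqrt_le (2 * i + 1)
    have h4 : invWidth (2 * i) * invWidth (2 * i + 1) ≤
        invWidth (2 * i + 1) * invWidth (2 * i + 1) := Nat.mul_le_mul_right _ h1
    unfold invWidth at *
    nlinarith [sq_nonneg ((Nat.sqrt (2 * i + 1) : ℤ) - 1), Nat.sqrt_le_self (2 * i + 1)]
  have h3 : 0 < invWidth (2 * i) * invWidth (2 * i + 1) :=
    Nat.mul_pos (invWidth_pos _) (invWidth_pos _)
  have h4 : ((invWidth (2 * i) : ℝ) * invWidth (2 * i + 1)) ≤ 4 * ((i + 1 : ℕ) : ℝ) := by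
    exact_mod_cast h2
  have h5 : (0 : ℝ) < (invWidth (2 * i) : ℝ) * invWidth (2 * i + 1) := by exact_mod_cast h3
  unfold flatRatio
  rw [one_div_mul_one_div]
  exact one_div_le_one_div_of_le h5 h4

theorem tendsto_sum_flatRatio (m : ℕ) :
    Tendsto (fun n => ∑ i ∈ Finset.range n, flatRatio (m + i)) atTop atTop := by
  have h0 : ∀ i, 0 ≤ flatRatio (m + i) := fun i => by unfold flatRatio; positivity
  rw [← not_summable_iff_tendsto_nat_atTop_of_nonneg h0]
  intro hs
  have h1 : Summable fun i : ℕ => 1 / 4 * (1 / ((i + (m + 1) : ℕ) : ℝ)) := by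
    refine Summable.of_nonneg_of_le (fun i => by positivity) (fun i => ?_) hs
    have := le_flatRatio (m + i)
    rwa [show m + i + 1 = i + (m + 1) by ring] at this
  have h2 := (summable_mul_left_iff (by norm_num : (1 / 4 : ℝ) ≠ 0)).1 h1
  exact Real.not_summable_one_div_natCast ((summable_nat_add_iff (m + 1)).1 h2)

/-- Almost every point of the torus lies in infinitely many flat sets. -/
theorem ae_frequently_flat : ∀ᵐ z : Torus2, ∃ᶠ i in atTop, z ∈ flatSet i := by
  have h : ∀ m : ℕ, ∀ᵐ z : Torus2, ∃ i, m ≤ i ∧ z ∈ flatSet i := by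
    intro m
    have hle : ∀ n, volume.real {z : Torus2 | ¬∃ i, m ≤ i ∧ z ∈ flatSet i} ≤
        Real.exp (-∑ i ∈ Finset.range n, flatRatio (m + i)) := by
      intro n
      refine (measureReal_mono fun z hz => ?_).trans (measureReal_avoid_le m n)
      simp only [avoid, Set.mem_iInter, Set.mem_compl_iff]
      exact fun i _ hzi => hz ⟨m + i, by omega, hzi⟩
    have hlim : Tendsto (fun n => Real.exp (-∑ i ∈ Finset.range n, flatRatio (m + i))) atTop
        (𝓝 0) := Real.tendsto_exp_neg_atTop_nhds_zero.comp (tendsto_sum_flatRatio m)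
    have h0 : volume.real {z : Torus2 | ¬∃ i, m ≤ i ∧ z ∈ flatSet i} = 0 :=
      le_antisymm (ge_of_tendsto' hlim hle) measureReal_nonneg
    rw [ae_iff]
    exact (measureReal_eq_zero_iff).1 h0
  filter_upwards [ae_all_iff.2 h] with z hz
  rw [frequently_atTop]
  exact fun m => hz m

/-- The return time attached to `flatSet i`. -/
def returnTime (i : ℕ) : ℕ := freq (2 * i + 1)

/-- The left side bounds the displacement after the time `returnTime i`: a horizontal and a vertical
part. -/
theorem displacement_le (i : ℕ) :
    4 * ((returnTime i : ℝ) * (2 / freq (2 * i + 2))) +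
      4 * (returnTime i : ℝ) ^ 2 / freq (2 * i + 2) ≤ 12 * (returnTime i : ℝ) ^ 2 *
        Real.exp (-((returnTime i : ℝ) ^ 3)) := by
  have h1 := exp_le_freq_succ (2 * i + 1)
  have N1 : (1 : ℝ) ≤ returnTime i := by exact_mod_cast freq_pos (2 * i + 1)
  set N : ℝ := (returnTime i : ℝ) with hN
  have h2 : Real.exp (N ^ 3) ≤ freq (2 * i + 2) := h1
  have h3 := Real.exp_pos (N ^ 3)
  rw [Real.exp_neg]
  have h4 : (freq (2 * i + 2) : ℝ)⁻¹ ≤ (Real.exp (N ^ 3))⁻¹ := by gcongr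
  have h5 : N * (2 / freq (2 * i + 2)) ≤ 2 * (N ^ 2 * (freq (2 * i + 2) : ℝ)⁻¹) := by
    rw [div_eq_mul_inv]
    have : N ≤ N ^ 2 := by nlinarith
    have h6 : (0 : ℝ) ≤ (freq (2 * i + 2) : ℝ)⁻¹ := by positivity
    nlinarith
  calc _ ≤ 4 * (2 * (N ^ 2 * (freq (2 * i + 2) : ℝ)⁻¹)) +
        4 * (N ^ 2 * (freq (2 * i + 2) : ℝ)⁻¹) := by
        gcongr ?_ + ?_
        · gcongr
        · rw [mul_div_assoc, div_eq_mul_inv]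
    _ = 12 * (N ^ 2 * (freq (2 * i + 2) : ℝ)⁻¹) := by ring
    _ ≤ 12 * (N ^ 2 * (Real.exp (N ^ 3))⁻¹) := by gcongr
    _ = _ := by ring

theorem mul_exp_neg_cube_le {N : ℝ} (hN : 3 ≤ N) :
    12 * N ^ 2 * Real.exp (-(N ^ 3)) ≤ Real.exp (-(N ^ 2)) := by
  have h1 : 12 * N ^ 2 ≤ Real.exp (2 * N ^ 2) := by
    have := Real.quadratic_le_exp_of_nonneg (x := 2 * N ^ 2) (by positivity)
    have h9 : 9 ≤ N ^ 2 := by nlinarith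
    nlinarith
  calc 12 * N ^ 2 * Real.exp (-(N ^ 3)) ≤ Real.exp (2 * N ^ 2) * Real.exp (-(N ^ 3)) := by gcongr
    _ = Real.exp (2 * N ^ 2 - N ^ 3) := by rw [← Real.exp_add]; congr 1
    _ ≤ Real.exp (-(N ^ 2)) := by
      apply Real.exp_le_exp.2
      have : 0 ≤ N ^ 2 * (N - 3) := mul_nonneg (by positivity) (by linarith)
      nlinarith

theorem flow_iterate (n : ℕ) (p : Torus2 × ℝ) :
    (flow (rot 0) (rot 1) roof 1)^[n] (proj (rot 0) (rot 1) roof p) =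
      proj (rot 0) (rot 1) roof (vertical n p) := by
  induction n with
  | zero => simp [vertical]
  | succ n ih =>
    rw [Function.iterate_succ_apply', ih, flow_proj]
    congr 1
    simp only [vertical]
    push_cast
    refine Prod.ext rfl ?_
    simp only
    ring

theorem dist_proj_le {α α' : ℝ} {φ : Ceiling} {p q : Torus2 × ℝ} (hp : p ∈ closedDomain φ)
    (hq : q ∈ closedDomain φ) : dist (proj α α' φ p) (proj α α' φ q) ≤ euclid p q :=
  csInf_le (Chain.bddBelow _ _) (Chain.single hp hq)

theorem euclid_le (p q : Torus2 × ℝ) : euclid p q ≤ 2 * dist p.1 q.1 + dist p.2 q.2 := by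
  have h1 : dist p.1.1 q.1.1 ≤ dist p.1 q.1 := le_max_left _ _
  have h2 : dist p.1.2 q.1.2 ≤ dist p.1 q.1 := le_max_right _ _
  have h3 : 0 ≤ dist p.1.1 q.1.1 := dist_nonneg
  have h4 : 0 ≤ dist p.1.2 q.1.2 := dist_nonneg
  have h5 : 0 ≤ dist p.2 q.2 := dist_nonneg
  refine Real.sqrt_le_iff.2 ⟨by linarith, ?_⟩
  nlinarith [mul_nonneg h3 h4, mul_nonneg h3 h5, mul_nonneg h4 h5]

/-- On `flatSet i`, the Birkhoff sum over the return time is nearly the return time itself. -/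
theorem abs_bsum_sub_returnTime_le {i : ℕ} {z : Torus2} (hz : z ∈ flatSet i) :
    |bsum (rot 0) (rot 1) roof (returnTime i) z - returnTime i| ≤
      4 * (returnTime i : ℝ) ^ 2 / freq (2 * i + 2) := by
  obtain ⟨x, y⟩ := z
  induction x using QuotientAddGroup.induction_on with | H x =>
  induction y using QuotientAddGroup.induction_on with | H y =>
  have h1 : waveOf 0 i x = 0 := wave_eq_zero hz.1
  have h2 : waveOf 1 i y = 0 := wave_eq_zero hz.2
  have b1 := (tower 0).abs_birk_le_of_flat (N := returnTime i)
    (freq_dvd_of_le (show 2 * i + 0 ≤ 2 * i + 1 by omega)) h1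
  have b2 := (tower 1).abs_birk_le_of_flat (N := returnTime i) dvd_rfl h2
  have e0 : freqOf 0 (i + 1) = freq (2 * i + 2) := rfl
  have e1 : (freq (2 * i + 2) : ℝ) ≤ freqOf 1 (i + 1) :=
    Nat.cast_le.2 (freq_strictMono.monotone (by omega))
  have q0 : (0 : ℝ) < freq (2 * i + 2) := by exact_mod_cast freq_pos _
  have b3 : 2 * (returnTime i : ℝ) ^ 2 / freqOf 1 (i + 1) ≤
      2 * (returnTime i : ℝ) ^ 2 / freq (2 * i + 2) := by gcongr
  rw [e0] at b1
  have hb := bsum_roof (returnTime i) x y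
  change |bsum (rot 0) (rot 1) roof (returnTime i)
    ((x : UnitAddCircle), (y : UnitAddCircle)) - _| ≤ _
  rw [hb]
  have e2 : 4 * (returnTime i : ℝ) ^ 2 / freq (2 * i + 2) =
      2 * (returnTime i : ℝ) ^ 2 / freq (2 * i + 2) +
        2 * (returnTime i : ℝ) ^ 2 / freq (2 * i + 2) := by ring
  rw [e2]
  rw [abs_le] at *
  constructor <;> linarith

/-- An interior point of the fundamental domain over infinitely many flat sets is super-recurrent,
with exponent `2`. -/
theorem superRecurrent_of_frequently {z : Torus2} {s : ℝ} (hs : 0 < s) (hsz : s < roof z)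
    (hz : ∃ᶠ i in atTop, z ∈ flatSet i) :
    SuperRecurrent (flow (rot 0) (rot 1) roof 1) (proj (rot 0) (rot 1) roof (z, s)) := by
  obtain ⟨C, hC, hlip⟩ := roof.exists_lipschitz
  have hN : Tendsto (fun i => (returnTime i : ℝ)) atTop atTop :=
    tendsto_freq.comp (tendsto_atTop_mono (fun i => by simp only [id]; omega) tendsto_id)
  have hexp : Tendsto (fun i => Real.exp (-((returnTime i : ℝ) ^ 2))) atTop (𝓝 0) :=
    Real.tendsto_exp_neg_atTop_nhds_zero.comp ((tendsto_pow_atTop two_ne_zero).comp hN)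
  have hgap : 0 < min s (roof z - s) / (1 + C) :=
    div_pos (lt_min hs (by linarith)) (by linarith)
  obtain ⟨ψ, hψ, hψz⟩ := extraction_of_frequently_atTop
    (hz.and_eventually ((hN.eventually_ge_atTop 3).and (hexp.eventually_lt_const hgap)))
  refine ⟨2, one_lt_two, fun n => returnTime (ψ n), fun m n hmn => ?_, fun n => ?_⟩
  · have := hψ hmn
    exact freq_strictMono (by omega)
  obtain ⟨hflat, h3, hsmall⟩ := hψz n
  set i := ψ n
  set N := returnTime i with hNdef
  rw [Real.rpow_two]
  have hdisp := (displacement_le i).trans (mul_exp_neg_cube_le h3)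
  rw [lt_div_iff₀ (by linarith)] at hsmall
  set e := Real.exp (-((N : ℝ) ^ 2)) with he
  have e0 : 0 < e := Real.exp_pos _
  have hb := abs_bsum_sub_returnTime_le hflat
  have hd : dist (z + N • rvec) z ≤ N * (2 / freq (2 * i + 2)) := by
    have h := dist_nsmul_le i N z
    have h0 : N • avec i = 0 := nsmul_avec i
    rwa [h0, add_zero] at h
  have hd0 : (0 : ℝ) ≤ N * (2 / freq (2 * i + 2)) := by positivity
  have hb0 : 0 ≤ 4 * (N : ℝ) ^ 2 / freq (2 * i + 2) := by positivity
  set q : Torus2 × ℝ := (z + N • rvec, s + N - bsum (rot 0) (rot 1) roof N z) with hq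
  have hproj : proj (rot 0) (rot 1) roof (vertical N (z, s)) = proj (rot 0) (rot 1) roof q := by
    rw [proj_eq_iff]
    refine ⟨N, ?_⟩
    rw [zpow_natCast, glue_pow_apply]
    rfl
  have hsq : |q.2 - s| ≤ e := by
    have : q.2 - s = -(bsum (rot 0) (rot 1) roof N z - N) := by rw [hq]; ring
    rw [this, abs_neg]
    linarith
  have hφ : |roof q.1 - roof z| ≤ C * e := by
    refine (hlip _ _).trans ?_
    gcongr
    linarith
  have hCe : 0 ≤ C * e := by positivity
  have hmin1 := min_le_left s (roof z - s)
  have hmin2 := min_le_right s (roof z - s)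
  have hsq' := abs_le.1 hsq
  have hφ' := abs_le.1 hφ
  have hqmem : q ∈ closedDomain roof := ⟨by linarith, by linarith⟩
  have hpmem : (z, s) ∈ closedDomain roof := ⟨hs.le, hsz.le⟩
  rw [flow_iterate, hproj]
  refine (dist_proj_le hqmem hpmem).trans ((euclid_le _ _).trans ?_)
  have hsq2 : dist q.2 s ≤ 4 * (N : ℝ) ^ 2 / freq (2 * i + 2) := by
    rw [Real.dist_eq]
    have : q.2 - s = -(bsum (rot 0) (rot 1) roof N z - N) := by rw [hq]; ring
    rw [this, abs_neg]
    exact hb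
  change 2 * dist (z + N • rvec) z + dist q.2 s ≤ e
  linarith

theorem ae_superRecurrent : ∀ᵐ ξ ∂measure (rot 0) (rot 1) roof,
    SuperRecurrent (flow (rot 0) (rot 1) roof 1) ξ := by
  -- the points of the domain to which the criterion applies
  set W : Set (Torus2 × ℝ) := {p | p ∈ domain roof ∧ 0 < p.2 ∧ ∃ᶠ i in atTop, p.1 ∈ flatSet i}
    with hW
  have hWm : MeasurableSet W := by
    refine measurableSet_domain.inter ((measurableSet_lt measurable_const measurable_snd).inter ?_)
    have e : {p : Torus2 × ℝ | ∃ᶠ i in atTop, p.1 ∈ flatSet i} =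
        Prod.fst ⁻¹' limsup flatSet atTop := by
      ext p
      simp only [Set.mem_preimage, mem_limsup_iff_frequently_mem, Set.mem_ofPred_eq]
    change MeasurableSet {p : Torus2 × ℝ | ∃ᶠ i in atTop, p.1 ∈ flatSet i}
    rw [e]
    exact measurable_fst
      (MeasurableSet.measurableSet_limsup fun i => (isClosed_flatSet i).measurableSet)
  have hWae : ∀ᵐ p : Torus2 × ℝ, p ∈ domain roof → p ∈ W := by
    have h1 : ∀ᵐ p : Torus2 × ℝ, ∃ᶠ i in atTop, p.1 ∈ flatSet i :=
      (Measure.quasiMeasurePreserving_fst (μ := (volume : Measure Torus2))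
        (ν := (volume : Measure ℝ))).ae ae_frequently_flat
    have h2 : ∀ᵐ p : Torus2 × ℝ, p.2 ≠ 0 :=
      (Measure.quasiMeasurePreserving_snd (μ := (volume : Measure Torus2))
        (ν := (volume : Measure ℝ))).ae (compl_mem_ae_iff.2 (measure_singleton (0 : ℝ)))
    filter_upwards [h1, h2] with p hp1 hp2 hp
    exact ⟨hp, lt_of_le_of_ne hp.1 hp2.symm, hp1⟩
  set S : Set (Space (rot 0) (rot 1) roof) := proj (rot 0) (rot 1) roof '' W with hS
  have hSm : MeasurableSet S := by
    have e : proj (rot 0) (rot 1) roof ⁻¹' S =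
        ⋃ i : ℤ, ⇑(glue (rotation (rot 0) (rot 1)) roof ^ i) ⁻¹' W := by
      ext p
      simp only [Set.mem_preimage, Set.mem_iUnion, hS, Set.mem_image]
      constructor
      · rintro ⟨q, hq, e⟩
        obtain ⟨i, hi⟩ := proj_eq_iff.1 e.symm
        exact ⟨i, hi ▸ hq⟩
      · rintro ⟨i, hi⟩
        exact ⟨_, hi, (proj_eq_iff.2 ⟨i, rfl⟩).symm⟩
    have : MeasurableSet (proj (rot 0) (rot 1) roof ⁻¹' S) := by
      rw [e]
      exact MeasurableSet.iUnion fun i => (continuous_glue_zpow i).measurable hWm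
    exact this
  have hnull : volume (proj (rot 0) (rot 1) roof ⁻¹' Sᶜ ∩ domain roof) = 0 := by
    refine measure_mono_null (fun p hp => ?_) (ae_iff.1 hWae)
    exact fun h => hp.1 ⟨p, h hp.2, rfl⟩
  have hSae : measure (rot 0) (rot 1) roof Sᶜ = 0 := by
    rw [measure_apply hSm.compl, measureReal_def, hnull]
    simp
  filter_upwards [compl_mem_ae_iff.2 hSae] with ξ hξ
  rw [compl_compl] at hξ
  obtain ⟨⟨z, s⟩, ⟨hD, hs, hz⟩, rfl⟩ := hξ
  exact superRecurrent_of_frequently hs hD.2 hz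

end SpecialFlow

end

/-- There are `α`, `α'` and a smooth positive ceiling function `φ` on the two-torus such that the
special flow over the rotation `R_{α,α'}` under `φ` is mixing and almost every point of its phase
space is super-recurrent for its time-one map. -/
theorem mainTheorem2 :
    ∃ (α α' : ℝ) (φ : SpecialFlow.Ceiling),
      SpecialFlow.IsMixing (SpecialFlow.flow α α' φ) (SpecialFlow.measure α α' φ) ∧
      ∀ᵐ ξ ∂(SpecialFlow.measure α α' φ),
        SpecialFlow.SuperRecurrent (SpecialFlow.flow α α' φ 1) ξ :=
  ⟨SpecialFlow.rot 0, SpecialFlow.rot 1, SpecialFlow.roof,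
    SpecialFlow.isMixing_of_continuous fun _ _ hF hFs hg hgi =>
      SpecialFlow.tendsto_continuous_correlation hF hFs hg hgi,
    SpecialFlow.ae_superRecurrent⟩
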